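/- **Conventions.** A *generalized quantum circuit* is a circuit over the gate set $\{CNOT,H,T\}$ in which some input qubits are initialized to zero and some output qubits are traced out at the end; it acts as a quantum channel, and its *size* is the number of gates plus the numbers of all its input and output qubits. A *quantum polynomial-time (QPT) algorithm* is a family $(A_\lambda)_{\lambda\in\mathbb N}$ of generalized circuits of size at most $p(\lambda)$ for a polynomial $p$; a *non-uniform QPT adversary* may in addition receive, for each $\lambda$, an arbitrary quantum advice state, and it outputs one bit. A function is *negligible* if it tends to $0$ faster than every inverse polynomial in $\lambda$. $\mathscr H_m$ is the uniform (Haar) distribution on the unit vectors of $m$ qubits. The output register of a generator holds $m$ qubits and one further qubit flagging an abort; $m$-qubit states are those with flag $0$, and $|\bot\rangle=|1\rangle|0^m\rangle$ is a fixed state orthogonal to them. An output $\rho$ has *recognizable abort* if $\rho=\eta|\psi\rangle\langle\psi|+(1-\eta)|\bot\rangle\langle\bot|$ for an $m$-qubit unit vector $|\psi\rangle$ and some $0\le\eta\le1$. An *$m(\lambda)$-PRS generator* is a QPT algorithm $G$ that maps a key $k\in\{0,1\}^\lambda$ to an output $G_\lambda(k)$ with recognizable abort (for instance, to an $m(\lambda)$-qubit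 pure state), such that for every polynomially bounded $t(\lambda)$ and every non-uniform QPT adversary $A$ there is a negligible $\varepsilon$ with, for all $\lambda$, $$\Big|\Pr_{k\leftarrow\{0,1\}^\lambda}[A_\lambda(G_\lambda(k)^{\otimes t})=1]-\Pr_{|\vartheta\rangle\leftarrow\mathscr H_{m}}[A_\lambda(|\vartheta\rangle^{\otimes t})=1]\Big|\le\varepsilon(\lambda).$$ A *$(d(\lambda),n(\lambda))$-PRFS generator* is a QPT algorithm $F$ that maps $k\in\{0,1\}^\lambda$ and $x\in\{0,1\}^{d(\lambda)}$ to an output $F_\lambda(k,x)$ on $n(\lambda)$ qubits and the flag, such that for all polynomially bounded $s(\lambda),t(\lambda)$, every family of distinct inputs $x_1,\dots,x_{s(\lambda)}\in\{0,1\}^{d(\lambda)}$ and every non-uniform QPT adversary $A$ there is a negligible $\varepsilon$ with, for all $\lambda$, $$\Big|\Pr_{k}[A_\lambda(x_1,\dots,x_s,F_\lambda(k,x_1)^{\otimes t},\dots,F_\lambda(k,x_s)^{\otimes t})=1]-\Pr_{|\vartheta_1\rangle,\dots,|\vartheta_s\rangle\leftarrow\mathscr H_{n}}[A_\lambda(x_1,\dots,x_s,|\vartheta_1\rangle^{\otimes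 t},\dots,|\vartheta_s\rangle^{\otimes t})=1]\Big|\le\varepsilon(\lambda).$$ **Theorem.** Let $d,n:\mathbb N\to\mathbb N$ satisfy $d(\lambda)=O(\log\lambda)$ and $n(\lambda)=d(\lambda)+\omega(\log\log\lambda)$. There are a constant $c$ and a family $(C_\lambda)$ of circuits with black-box calls, making at most $2^{d(\lambda)}\lambda$ calls and not depending on the circuit that answers them, such that for every $(d(\lambda)+n(\lambda))$-PRS generator $G$ the family $F_\lambda=C_\lambda[G_\lambda]$, in which every call is answered by $G_\lambda$, has the following properties. 1. $F$ is a $(d(\lambda),n(\lambda))$-PRFS generator. 2. $F$ has recognizable abort: for all $\lambda,k,x$ the output $F_\lambda(k,x)$ has recognizable abort. 3. $F_\lambda$ has size at most $c\,(2^{d(\lambda)}\lambda+1)$ times the size of $G_\lambda$. 4. For all $\lambda,k,x$, $F_\lambda(k,x)$ is the output of the following procedure: up to $2^{d(\lambda)}\lambda$ times, produce $G_\lambda(k)$ and measure its first $d(\lambda)$ qubits (an abort counts as a failure); if the outcome is $x$, output the remaining $n(\lambda)$ qubits and stop; if this never happens, output $|\bot\rangle$. -/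

import Mathlib

open Filter MeasureTheory
open scoped ComplexOrder

noncomputable section

/-! ### Generalized quantum circuits over the gate set {CNOT, H, T} -/

/-- A gate acting on qubits labelled by `W`. -/
inductive QGate (W : Type) : Type
  | H (i : W) : QGate W
  | T (i : W) : QGate W
  | CNOT (control target : W) (ne : control ≠ target) : QGate W

/-- Relabelling of the qubits that a gate acts on. -/
def QGate.map {W W' : Type} (f : W ↪ W') : QGate W → QGate W'
  | .H i => .H (f i)
  | .T i => .T (f i)
  | .CNOT i j h => .CNOT (f i) (f j) (fun e => h (f.injective e))

/-- Operators on a register whose qubits are labelled by `Q`, as matrices in the computational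
basis `Q → Bool` (`true` stands for 1). -/
abbrev QOp (Q : Type) : Type := Matrix (Q → Bool) (Q → Bool) ℂ

open Classical in
/-- The unitary matrix of a gate on the whole register. -/
def QGate.mat {W : Type} : QGate W → QOp W
  | .H i => Matrix.of fun w v =>
      if ∀ j, j ≠ i → w j = v j then
        (if w i = true ∧ v i = true then -1 else 1) * ((Real.sqrt 2 : ℝ) : ℂ)⁻¹
      else 0
  | .T i => Matrix.of fun w v =>
      if w = v then (if w i = true then Complex.exp (Complex.I * Real.pi / 4) else 1) else 0
  | .CNOT i j _ => Matrix.of fun w v =>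
      if w = Function.update v j (xor (v i) (v j)) then 1 else 0

/-- The unitary matrix of a sequence of gates; the head of the list is applied first. -/
def gatesMat {W : Type} [Fintype W] [DecidableEq W] (gs : List (QGate W)) : QOp W :=
  gs.foldl (fun U g => g.mat * U) 1

open Classical in
/-- The isometry which places a register `I` on the qubits `f i` of `W` and initializes the other
qubits of `W` to zero. -/
def adjoinZeros {I W : Type} (f : I ↪ W) : Matrix (W → Bool) (I → Bool) ℂ :=
  Matrix.of fun w v =>
    if (∀ i, w (f i) = v i) ∧ ∀ j, (∀ i, f i ≠ j) → w j = false then 1 else 0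

open Classical in
/-- The partial trace over all qubits of `W` except the qubits `f o`. -/
def traceOut {O W : Type} [Fintype W] (f : O ↪ W) (σ : QOp W) : QOp O :=
  Matrix.of fun y y' => ∑ w : W → Bool, ∑ w' : W → Bool,
    if (∀ o, w (f o) = y o) ∧ (∀ o, w' (f o) = y' o) ∧ ∀ j, (∀ o, f o ≠ j) → w j = w' j then
      σ w w'
    else 0

/-- A generalized quantum circuit from the input register `I` to the output register `O`: the
qubits of `W` outside the range of `inp` are initialized to zero, and those outside the range of
`out` are traced out at the end. -/
structure QCircuit (I O : Type) where
  W : Type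
  [fintypeW : Fintype W]
  [decEqW : DecidableEq W]
  inp : I ↪ W
  gates : List (QGate W)
  out : O ↪ W

attribute [instance] QCircuit.fintypeW QCircuit.decEqW

namespace QCircuit

variable {I J O I' O' : Type}

/-- Number of gates, plus the number of input qubits (with those initialized to zero), plus the
number of output qubits (with those that are traced out). -/
def size (c : QCircuit I O) : ℕ := c.gates.length + Fintype.card c.W + Fintype.card c.W

/-- The quantum channel of a generalized circuit: adjoin zeros, apply the unitary part, and trace
out the qubits that are not output qubits. -/
def channel [Fintype I] [DecidableEq I] (c : QCircuit I O) (ρ : QOp I) : QOp O :=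
  traceOut c.out (gatesMat c.gates * (adjoinZeros c.inp * ρ * (adjoinZeros c.inp).conjTranspose) *
    (gatesMat c.gates).conjTranspose)

/-- The circuit without gates. -/
def ident (R : Type) [Fintype R] [DecidableEq R] : QCircuit R R where
  W := R
  inp := Function.Embedding.refl R
  gates := []
  out := Function.Embedding.refl R

/-- Two circuits side by side. -/
def par (c : QCircuit I O) (c' : QCircuit I' O') : QCircuit (I ⊕ I') (O ⊕ O') where
  W := c.W ⊕ c'.W
  inp := c.inp.sumMap c'.inp
  gates := c.gates.map (QGate.map Function.Embedding.inl) ++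
    c'.gates.map (QGate.map Function.Embedding.inr)
  out := c.out.sumMap c'.out

/-- `q` copies of a circuit side by side. -/
def copies (c : QCircuit I O) (q : ℕ) : QCircuit (Fin q × I) (Fin q × O) where
  W := Fin q × c.W
  inp := (Function.Embedding.refl (Fin q)).prodMap c.inp
  gates := (List.finRange q).flatMap
    (fun r => c.gates.map (QGate.map (Function.Embedding.sectR r c.W)))
  out := (Function.Embedding.refl (Fin q)).prodMap c.out

open Classical in
/-- Where the wires of the second circuit go in a composition: its input wires are the output
wires of the first circuit, the others are new. -/
def gluingFun (c : QCircuit I J) (c' : QCircuit J O) (w : c'.W) : c.W ⊕ c'.W :=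
  if h : ∃ j, c'.inp j = w then Sum.inl (c.out h.choose) else Sum.inr w

theorem gluingFun_injective (c : QCircuit I J) (c' : QCircuit J O) :
    Function.Injective (gluingFun c c') := by
  intro a b hab
  unfold gluingFun at hab
  split_ifs at hab with ha hb hb
  · have h := c.out.injective (Sum.inl.inj hab)
    rw [← ha.choose_spec, ← hb.choose_spec, h]
  · exact Sum.inr.inj hab

/-- Sequential composition: first `c`, then `c'` on the output register of `c`. -/
def comp (c : QCircuit I J) (c' : QCircuit J O) : QCircuit I O where
  W := c.W ⊕ c'.W
  inp := c.inp.trans Function.Embedding.inl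
  gates := c.gates.map (QGate.map Function.Embedding.inl) ++
    c'.gates.map (QGate.map ⟨gluingFun c c', gluingFun_injective c c'⟩)
  out := c'.out.trans ⟨gluingFun c c', gluingFun_injective c c'⟩

end QCircuit

/-- A circuit from `I` to `O` that invokes a circuit from `A` to `B` as a black box: it consists
of a part before the calls, `calls` calls, a memory register of `mem` qubits on which the calls
do not act, and a part after the calls. -/
structure BlackBoxCircuit (I A B O : Type) where
  calls : ℕ
  mem : ℕ
  pre : QCircuit I ((Fin calls × A) ⊕ Fin mem)
  post : QCircuit ((Fin calls × B) ⊕ Fin mem) O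

/-- The circuit obtained when every call is answered by the circuit `G`. -/
def BlackBoxCircuit.inst {I A B O : Type} (C : BlackBoxCircuit I A B O) (G : QCircuit A B) :
    QCircuit I O :=
  (C.pre.comp ((G.copies C.calls).par (QCircuit.ident (Fin C.mem)))).comp C.post

/-! ### States -/

/-- A basis state, as a density matrix. -/
def basisState {Q : Type} [Fintype Q] (v : Q → Bool) : QOp Q :=
  Matrix.single v v 1

/-- Density matrices. -/
def IsDensity {Q : Type} [Fintype Q] [DecidableEq Q] (ρ : QOp Q) : Prop :=
  ρ.PosSemidef ∧ ρ.trace = 1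

/-- The product state of two registers. -/
def tensorState {Q R : Type} (ρ : QOp Q) (σ : QOp R) : QOp (Q ⊕ R) := Matrix.of fun v w =>
  ρ (fun i => v (Sum.inl i)) (fun i => w (Sum.inl i)) *
    σ (fun i => v (Sum.inr i)) (fun i => w (Sum.inr i))

/-- The product state of a family of registers of the same size. -/
def tensorFamily {S Q : Type} [Fintype S] (ρ : S → QOp Q) : QOp (S × Q) :=
  Matrix.of fun v w => ∏ r, ρ r (fun i => v (r, i)) (fun i => w (r, i))

/-- Unit vectors in the space of `n` qubits. -/
abbrev UnitKet (n : ℕ) : Type := Metric.sphere (0 : EuclideanSpace ℂ (Fin n → Bool)) 1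

/-- The density matrix of a pure state. -/
def pureState {n : ℕ} (ψ : UnitKet n) : QOp (Fin n) := Matrix.of fun v w =>
  ψ.1 v * star (ψ.1 w)

/-- The uniform (Haar) probability measure on the unit vectors of `n` qubits: normalized surface
measure of the sphere. -/
def haarKet (n : ℕ) : Measure (UnitKet n) :=
  ((volume : Measure (EuclideanSpace ℂ (Fin n → Bool))).toSphere Set.univ)⁻¹ •
    (volume : Measure (EuclideanSpace ℂ (Fin n → Bool))).toSphere

/-! The output register of a state generator holds `n` qubits `some i` and the qubit `none`, which
tells whether the generator has aborted: an `n`-qubit state is embedded with `none` in state 0, and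
the symbol ⊥ is the basis state with `none` in state 1 and all other qubits in state 0; it is
orthogonal to all `n`-qubit states. -/

/-- An `n`-qubit operator, as an operator on the output register of a generator. -/
def noAbort {n : ℕ} (ρ : QOp (Fin n)) : QOp (Option (Fin n)) :=
  Matrix.of fun v w =>
    if v none = true ∨ w none = true then 0 else ρ (fun i => v (some i)) (fun i => w (some i))

/-- The state ⊥. -/
def abortState (n : ℕ) : QOp (Option (Fin n)) :=
  basisState (fun o => o.isNone)

/-- The shape of an output with recognizable abort. The case `η = 1` is perfect state
generation. -/
def IsRecognizable {n : ℕ} (ρ : QOp (Option (Fin n))) : Prop :=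
  ∃ (ψ : UnitKet n) (η : ℝ), 0 ≤ η ∧ η ≤ 1 ∧
    ρ = (η : ℂ) • noAbort (pureState ψ) + ((1 - η : ℝ) : ℂ) • abortState n

/-! ### Asymptotics and algorithms; the security parameter is `l` -/

/-- Bounded by a polynomial. -/
def PolyBounded (f : ℕ → ℕ) : Prop := ∃ p : Polynomial ℕ, ∀ l, f l ≤ p.eval l

/-- Negligible functions. -/
def Negligible (ε : ℕ → ℝ) : Prop :=
  Asymptotics.SuperpolynomialDecay atTop (fun l : ℕ => (l : ℝ)) ε

/-- Quantum polynomial time. -/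
def IsQPT {I O : ℕ → Type} (A : ∀ l, QCircuit (I l) (O l)) : Prop :=
  PolyBounded (fun l => (A l).size)

/-- The probability that a circuit with one output bit outputs 1 on the input `ρ`, when its
advice register is in the state `σ`. -/
def acceptProb {I : Type} [Fintype I] [DecidableEq I] {a : ℕ}
    (A : QCircuit (I ⊕ Fin a) Unit) (ρ : QOp I) (σ : QOp (Fin a)) : ℝ :=
  (A.channel (tensorState ρ σ) (fun _ => true) (fun _ => true)).re

/-- The average over a uniformly random key of `l` bits. -/
def keyAverage (l : ℕ) (f : (Fin l → Bool) → ℝ) : ℝ :=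
  (∑ k : Fin l → Bool, f k) / 2 ^ l

/-! ### PRS generators -/

/-- The output of a generator on the key `k`. -/
def prsOut {l m : ℕ} (G : QCircuit (Fin l) (Option (Fin m))) (k : Fin l → Bool) :
    QOp (Option (Fin m)) :=
  G.channel (basisState k)

/-- Many copies of the output are indistinguishable from copies of a Haar-random state, for
non-uniform quantum polynomial-time adversaries with quantum advice. -/
def PRSPseudorandom (m : ℕ → ℕ) (G : ∀ l, QCircuit (Fin l) (Option (Fin (m l)))) : Prop :=
  ∀ t : ℕ → ℕ, PolyBounded t →
  ∀ (a : ℕ → ℕ) (A : ∀ l, QCircuit ((Fin (t l) × Option (Fin (m l))) ⊕ Fin (a l)) Unit)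
    (σ : ∀ l, QOp (Fin (a l))), IsQPT A → (∀ l, IsDensity (σ l)) →
  ∃ ε : ℕ → ℝ, Negligible ε ∧ ∀ l,
    |keyAverage l (fun k =>
        acceptProb (A l) (tensorFamily (fun _ : Fin (t l) => prsOut (G l) k)) (σ l)) -
      ∫ θ, acceptProb (A l) (tensorFamily (fun _ : Fin (t l) => noAbort (pureState θ))) (σ l)
        ∂haarKet (m l)| ≤ ε l

/-- `m(l)`-PRS generators, with keys of `l` bits. State generation is required only up to
recognizable abort, so that generators with perfect state generation are included. -/
structure IsPRS (m : ℕ → ℕ) (G : ∀ l, QCircuit (Fin l) (Option (Fin (m l)))) : Prop where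
  qpt : IsQPT G
  stateGeneration : ∀ l k, IsRecognizable (prsOut (G l) k)
  pseudorandom : PRSPseudorandom m G

/-! ### PRFS generators -/

/-- The output of a generator on the key `k` and the input `x`. -/
def prfsOut {l d n : ℕ} (F : QCircuit (Fin l ⊕ Fin d) (Option (Fin n))) (k : Fin l → Bool)
    (x : Fin d → Bool) : QOp (Option (Fin n)) :=
  F.channel (basisState (Sum.elim k x))

/-- For distinct inputs `x 0, …, x (s - 1)`, many copies of the outputs are indistinguishable from
copies of independent Haar-random states, for non-uniform quantum polynomial-time adversaries with
quantum advice, who are also given the inputs. -/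
def PRFSPseudorandom (d n : ℕ → ℕ)
    (F : ∀ l, QCircuit (Fin l ⊕ Fin (d l)) (Option (Fin (n l)))) : Prop :=
  ∀ s t : ℕ → ℕ, PolyBounded s → PolyBounded t →
  ∀ x : ∀ l, Fin (s l) → (Fin (d l) → Bool), (∀ l, Function.Injective (x l)) →
  ∀ (a : ℕ → ℕ)
    (A : ∀ l, QCircuit (((Fin (s l) × Fin (d l)) ⊕
      (Fin (s l) × (Fin (t l) × Option (Fin (n l))))) ⊕ Fin (a l)) Unit)
    (σ : ∀ l, QOp (Fin (a l))), IsQPT A → (∀ l, IsDensity (σ l)) →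
  ∃ ε : ℕ → ℝ, Negligible ε ∧ ∀ l,
    |keyAverage l (fun k => acceptProb (A l)
        (tensorState (basisState (fun p => x l p.1 p.2))
          (tensorFamily fun j => tensorFamily fun _ : Fin (t l) => prfsOut (F l) k (x l j)))
        (σ l)) -
      ∫ θ : Fin (s l) → UnitKet (n l), acceptProb (A l)
        (tensorState (basisState (fun p => x l p.1 p.2))
          (tensorFamily fun j => tensorFamily fun _ : Fin (t l) => noAbort (pureState (θ j))))
        (σ l) ∂(Measure.pi fun _ => haarKet (n l))| ≤ ε l

/-- `(d(l), n(l))`-PRFS generators, with keys of `l` bits. -/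
structure IsPRFS (d n : ℕ → ℕ)
    (F : ∀ l, QCircuit (Fin l ⊕ Fin (d l)) (Option (Fin (n l)))) : Prop where
  qpt : IsQPT F
  pseudorandom : PRFSPseudorandom d n F

/-- Recognizable abort for PRFS generators. -/
def RecognizableAbort {d n : ℕ → ℕ}
    (F : ∀ l, QCircuit (Fin l ⊕ Fin (d l)) (Option (Fin (n l)))) : Prop :=
  ∀ l k x, IsRecognizable (prfsOut (F l) k x)

/-! ### Post-selection -/

/-- The state of the last `n` qubits, not normalized, after the first `d` qubits of a non-aborted
output have been measured with outcome `x`; its trace is the probability of this outcome. -/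
def prefixBlock {d n : ℕ} (ρ : QOp (Option (Fin (d + n)))) (x : Fin d → Bool) : QOp (Fin n) :=
  Matrix.of fun v w =>
    ρ (fun o => o.elim false (Fin.append x v)) (fun o => o.elim false (Fin.append x w))

/-- The output of the following procedure: at most `q` times, take a new copy of `ρ` and measure its
first `d` qubits; as soon as the outcome is `x`, stop and output the other `n` qubits; if this
never happens, output ⊥. -/
def postSelect {d n : ℕ} (q : ℕ) (ρ : QOp (Option (Fin (d + n)))) (x : Fin d → Bool) :
    QOp (Option (Fin n)) :=
  (∑ r ∈ Finset.range q,
      (1 - (prefixBlock ρ x).trace) ^ r • noAbort (prefixBlock ρ x)) +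
    (1 - (prefixBlock ρ x).trace) ^ q • abortState n

end

/-!
The circuit `postSelectGenerator` copies the key `q = 2 ^ d * l` times by CNOT gates, calls the
generator on every copy, and performs `q` rounds of classical reversible gates: a round tests
whether a fresh output has flag 0 and prefix `x`, and in that case exchanges it with the output
register, which initially holds `⊥`. Classical gates are available because NOT and Toffoli gates
can be written exactly over the gate set. The calculus of channels (`QCircuit.channel_comp`,
`QCircuit.channel_par`, `QCircuit.channel_copies`) and the channel of a single round
(`channel_selectRound`) show that the circuit outputs exactly `postSelect q ρ x` on the output `ρ`
of the generator (`prfsOut_postSelectGenerator`). Since the unnormalized block of a pure state at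
the prefix `x` is pure, abort stays recognizable (`isRecognizable_postSelect`).

For pseudorandomness, post-selection is itself efficient, so a distinguisher for the outputs of
the post-selection, with the inputs put into its advice, yields a distinguisher for the state
generator (`acceptProb_reduction`). It remains to compare post-selection from copies of one
Haar-random state `θ` with independent Haar-random states. Here `θ` is the direction of a Gaussian
vector. The blocks of a Gaussian vector at distinct prefixes are independent Gaussian vectors, so
the directions of the blocks of `θ` are independent and Haar distributed
(`map_ketDir_ketBlock_comp_haarKet`). Hence the two situations differ only when a post-selection
fails, and a hybrid argument (`abs_sub_le_sum_of_mix`) bounds the difference by the sum of the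
failure probabilities. For a block of weight `p` the failure probability is `(1 - p) ^ q`, at most
`(1 + (l / 2 ^ n) * p) ^ (-2 ^ (d + n))`, and the average of the latter over `θ` is exactly `(1 +
l / 2 ^ n) ^ (-2 ^ n)` (`lintegral_haarKet_ketBlock`). This is negligible because `2 ^ n` grows
faster than every power of `log l` (`negligible_inv_one_add_div_pow`).
-/

noncomputable section

/-! ### Sums over bit assignments -/

open Classical in
/-- The indicator of a proposition, as a complex number. -/
def ind (P : Prop) : ℂ := if P then 1 else 0

theorem ind_pos {P : Prop} (h : P) : ind P = 1 := if_pos h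

theorem ind_neg {P : Prop} (h : ¬ P) : ind P = 0 := if_neg h

theorem ind_congr {P Q : Prop} (h : P ↔ Q) : ind P = ind Q := by rw [propext h]

theorem ind_and (P Q : Prop) : ind (P ∧ Q) = ind P * ind Q := by
  by_cases hP : P <;> by_cases hQ : Q <;> simp [ind, hP, hQ]

theorem ind_mul_congr {P : Prop} {a b : ℂ} (h : P → a = b) : ind P * a = ind P * b := by
  by_cases hP : P
  · rw [h hP]
  · simp [ind_neg hP]

theorem star_ind (P : Prop) : star (ind P) = ind P := by
  by_cases hP : P <;> simp [ind, hP]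

theorem ite_eq_ind (P : Prop) [Decidable P] (a : ℂ) : (if P then a else 0) = ind P * a := by
  by_cases hP : P <;> simp [ind, hP]

theorem sum_ind_eq {α : Type} [Fintype α] (a : α) (F : α → ℂ) :
    (∑ w, ind (w = a) * F w) = F a := by
  rw [Finset.sum_eq_single a]
  · simp [ind_pos]
  · intro b _ hb
    simp [ind_neg hb]
  · simp

theorem sum_ind_eq' {α : Type} [Fintype α] (a : α) (F : α → ℂ) :
    (∑ w, ind (a = w) * F w) = F a := by
  simp only [eq_comm (a := a), sum_ind_eq]

/-- Two assignments agree on all qubits outside the range of `f`. -/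
def EqOff {A W : Type} (f : A → W) (w v : W → Bool) : Prop :=
  ∀ j, (∀ i, f i ≠ j) → w j = v j

theorem extend_comp_self {A W : Type} (f : A ↪ W) (t : A → Bool) (v : W → Bool) :
    Function.extend f t v ∘ f = t :=
  funext fun i => f.injective.extend_apply _ _ i

theorem eqOff_extend {A W : Type} (f : A ↪ W) (t : A → Bool) (v : W → Bool) :
    EqOff f (Function.extend f t v) v := fun _ hj =>
  Function.extend_apply' _ _ _ (fun ⟨i, hi⟩ => hj i hi)

theorem eq_extend_iff {A W : Type} (f : A ↪ W) (t : A → Bool) (v w : W → Bool) :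
    w = Function.extend f t v ↔ w ∘ f = t ∧ EqOff f w v := by
  constructor
  · rintro rfl
    exact ⟨extend_comp_self f t v, eqOff_extend f t v⟩
  · rintro ⟨rfl, h⟩
    funext j
    by_cases hj : ∃ i, f i = j
    · obtain ⟨i, rfl⟩ := hj
      rw [f.injective.extend_apply]; rfl
    · rw [Function.extend_apply' _ _ _ hj]
      exact h j (fun i hi => hj ⟨i, hi⟩)

theorem EqOff.symm {A W : Type} {f : A → W} {w v : W → Bool} (h : EqOff f w v) : EqOff f v w :=
  fun j hj => (h j hj).symm

theorem EqOff.trans {A W : Type} {f : A → W} {u v w : W → Bool} (h : EqOff f u v)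
    (h' : EqOff f v w) : EqOff f u w :=
  fun j hj => (h j hj).trans (h' j hj)

/-- Summation over the assignments that agree with `v` outside the range of `f`. -/
theorem sum_eqOff {A W : Type} [Fintype A] [Fintype W] [DecidableEq A] [DecidableEq W] (f : A ↪ W)
    (v : W → Bool) (F : (W → Bool) → ℂ) :
    (∑ w : W → Bool, ind (EqOff f w v) * F w) =
      ∑ t : A → Bool, F (Function.extend f t v) := by
  classical
  simp only [← ite_eq_ind]
  rw [← Finset.sum_filter]
  refine Finset.sum_nbij' (fun w => w ∘ f) (fun t => Function.extend f t v) ?_ ?_ ?_ ?_ ?_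
  · simp
  · intro t _
    simpa using eqOff_extend f t v
  · intro w hw
    exact ((eq_extend_iff f _ v w).2 ⟨rfl, by simpa using hw⟩).symm
  · intro t _
    exact extend_comp_self f t v
  · intro w hw
    rw [← (eq_extend_iff f _ v w).2 ⟨rfl, by simpa using hw⟩]

theorem sum_comm_four {α β γ δ : Type} [Fintype α] [Fintype β] [Fintype γ] [Fintype δ]
    (F : α → β → γ → δ → ℂ) :
    (∑ a, ∑ b, ∑ c, ∑ d, F a b c d) = ∑ c, ∑ d, ∑ a, ∑ b, F a b c d := by
  have h1 : ∀ a, (∑ b, ∑ c, ∑ d, F a b c d) = ∑ c, ∑ d, ∑ b, F a b c d := by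
    intro a
    rw [Finset.sum_comm]
    exact Finset.sum_congr rfl fun c _ => Finset.sum_comm
  simp only [h1]
  rw [Finset.sum_comm]
  exact Finset.sum_congr rfl fun c _ => Finset.sum_comm

/-! ### Partial traces and initialized qubits -/

theorem traceOut_apply {O W : Type} [Fintype W] [DecidableEq W] (f : O ↪ W) (σ : QOp W)
    (y y' : O → Bool) :
    traceOut f σ y y' = ∑ w : W → Bool, ∑ w' : W → Bool,
      ind (w ∘ f = y) * (ind (w' ∘ f = y') * (ind (EqOff f w w') * σ w w')) := by
  have : ∀ w w' : W → Bool, ind (w ∘ f = y) * (ind (w' ∘ f = y') * (ind (EqOff f w w') * σ w w')) =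
      ind ((∀ o, w (f o) = y o) ∧ (∀ o, w' (f o) = y' o) ∧
        ∀ j, (∀ o, f o ≠ j) → w j = w' j) * σ w w' := by
    intro w w'
    rw [ind_and, ind_and, mul_assoc, mul_assoc, ind_congr funext_iff, ind_congr (funext_iff (f := w' ∘ f))]
    rfl
  simp only [this, traceOut, Matrix.of_apply, ite_eq_ind]
  congr!

/-- The partial trace is adjoint to the extension of operators by the identity. -/
theorem sum_traceOut_mul {O W : Type} [Fintype O] [DecidableEq O] [Fintype W] [DecidableEq W]
    (f : O ↪ W) (σ : QOp W) (φ : (O → Bool) → (O → Bool) → ℂ) :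
    (∑ y, ∑ y', traceOut f σ y y' * φ y y') =
      ∑ w : W → Bool, ∑ w' : W → Bool, ind (EqOff f w w') * σ w w' * φ (w ∘ f) (w' ∘ f) := by
  simp only [traceOut_apply, Finset.sum_mul]
  rw [sum_comm_four]
  refine Finset.sum_congr rfl fun w _ => Finset.sum_congr rfl fun w' _ => ?_
  have : ∀ y y', ind (w ∘ f = y) * (ind (w' ∘ f = y') * (ind (EqOff f w w') * σ w w')) * φ y y' =
      ind (w ∘ f = y) * (ind (w' ∘ f = y') * (ind (EqOff f w w') * σ w w' * φ y y')) :=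
    fun y y' => by ring
  simp only [this, ← Finset.mul_sum, sum_ind_eq']

theorem traceOut_trans {A B W : Type} [Fintype B] [DecidableEq B] [Fintype W] [DecidableEq W]
    (f : A ↪ B) (g : B ↪ W) (σ : QOp W) :
    traceOut (f.trans g) σ = traceOut f (traceOut g σ) := by
  ext y y'
  have h := sum_traceOut_mul g σ
    (fun u u' => ind (u ∘ f = y) * ind (u' ∘ f = y') * ind (EqOff f u u'))
  have e : traceOut f (traceOut g σ) y y' = ∑ u, ∑ u', traceOut g σ u u' *
      (ind (u ∘ f = y) * ind (u' ∘ f = y') * ind (EqOff f u u')) := by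
    rw [traceOut_apply]
    refine Finset.sum_congr rfl fun w _ => Finset.sum_congr rfl fun w' _ => ?_
    ring
  rw [e, h, traceOut_apply]
  refine Finset.sum_congr rfl fun w _ => Finset.sum_congr rfl fun w' _ => ?_
  have : EqOff (f.trans g) w w' ↔ EqOff g w w' ∧ EqOff f (w ∘ g) (w' ∘ g) := by
    constructor
    · intro h
      refine ⟨fun j hj => h j fun i => hj _, fun j hj => h _ fun i hi => hj i (g.injective hi)⟩
    · rintro ⟨h1, h2⟩ j hj
      by_cases hb : ∃ b, g b = j
      · obtain ⟨b, rfl⟩ := hb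
        exact h2 b fun i hi => hj i (by simp [hi])
      · exact h1 j fun i hi => hb ⟨i, hi⟩
  rw [ind_congr this, ind_and]
  have e1 : w ∘ (f.trans g) = (w ∘ g) ∘ f := rfl
  have e2 : w' ∘ (f.trans g) = (w' ∘ g) ∘ f := rfl
  rw [e1, e2]
  ring

theorem adjoinZeros_apply {I W : Type} (f : I ↪ W) (w : W → Bool) (v : I → Bool) :
    adjoinZeros f w v = ind (w = Function.extend f v (fun _ => false)) := by
  rw [ind_congr (eq_extend_iff _ _ _ _)]
  rw [ind_congr (and_congr_left' funext_iff)]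
  simp only [adjoinZeros, Matrix.of_apply, ite_eq_ind, mul_one]
  rfl

theorem extend_trans {A B W : Type} (f : A ↪ B) (g : B ↪ W) (v : A → Bool) (b : Bool) :
    Function.extend (f.trans g) v (fun _ => b) =
      Function.extend g (Function.extend f v (fun _ => b)) (fun _ => b) := by
  rw [eq_comm, eq_extend_iff]
  constructor
  · funext i
    simp [g.injective.extend_apply, f.injective.extend_apply]
  · intro j hj
    by_cases hb : ∃ b, g b = j
    · obtain ⟨b', rfl⟩ := hb
      rw [g.injective.extend_apply]
      exact Function.extend_apply' _ _ _ fun ⟨i, hi⟩ => hj i (by simp [hi])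
    · exact Function.extend_apply' _ _ _ hb

theorem adjoinZeros_trans {A B W : Type} [Fintype B] [DecidableEq B] (f : A ↪ B) (g : B ↪ W) :
    adjoinZeros (f.trans g) = adjoinZeros g * adjoinZeros f := by
  ext w v
  simp only [Matrix.mul_apply, adjoinZeros_apply, extend_trans]
  simp only [mul_comm (ind (w = _)), sum_ind_eq]

/-! ### Gates on a larger register -/

/-- The operator `U` on the qubits `f i` of a larger register. -/
def liftOp {A W : Type} (f : A ↪ W) (U : QOp A) : QOp W := Matrix.of fun w v =>
  ind (EqOff f w v) * U (w ∘ f) (v ∘ f)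

theorem liftOp_apply {A W : Type} (f : A ↪ W) (U : QOp A) (w v : W → Bool) :
    liftOp f U w v = ind (EqOff f w v) * U (w ∘ f) (v ∘ f) := rfl

theorem one_apply_ind {A : Type} [DecidableEq (A → Bool)] (w v : A → Bool) :
    (1 : QOp A) w v = ind (w = v) := by
  rw [Matrix.one_apply, ite_eq_ind, mul_one]

theorem eq_iff_eqOff {A W : Type} (f : A ↪ W) (w v : W → Bool) :
    w = v ↔ EqOff f w v ∧ w ∘ f = v ∘ f := by
  constructor
  · rintro rfl; exact ⟨fun _ _ => rfl, rfl⟩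
  · rintro ⟨h1, h2⟩
    rw [(eq_extend_iff f (v ∘ f) v w).2 ⟨h2, h1⟩,
      ← (eq_extend_iff f (v ∘ f) v v).2 ⟨rfl, fun _ _ => rfl⟩]

theorem liftOp_one {A W : Type} [DecidableEq (A → Bool)] [DecidableEq (W → Bool)] (f : A ↪ W) :
    liftOp f (1 : QOp A) = 1 := by
  ext w v
  rw [liftOp_apply, one_apply_ind, one_apply_ind, ind_congr (eq_iff_eqOff f w v), ind_and]

theorem liftOp_mul {A W : Type} [Fintype A] [DecidableEq A] [Fintype W] [DecidableEq W]
    (f : A ↪ W) (U V : QOp A) : liftOp f (U * V) = liftOp f U * liftOp f V := by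
  ext w v
  simp only [liftOp_apply, Matrix.mul_apply]
  have : ∀ u : W → Bool, (ind (EqOff f w u) * U (w ∘ f) (u ∘ f)) *
      (ind (EqOff f u v) * V (u ∘ f) (v ∘ f)) =
      ind (EqOff f u v) * (ind (EqOff f w v) * (U (w ∘ f) (u ∘ f) * V (u ∘ f) (v ∘ f))) := by
    intro u
    by_cases h : EqOff f u v
    · have : EqOff f w u ↔ EqOff f w v := ⟨fun h' => h'.trans h, fun h' => h'.trans h.symm⟩
      rw [ind_congr this]
      ring
    · simp [ind_neg h]
  simp only [this, sum_eqOff, extend_comp_self, Finset.mul_sum]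

theorem QGate.mat_map {A W : Type} (f : A ↪ W) (g : QGate A) :
    (g.map f).mat = liftOp f g.mat := by
  have key : ∀ (w v : W → Bool) (P : A → Prop),
      (∀ j, (∀ i, P i → j ≠ f i) → w j = v j) ↔
        EqOff f w v ∧ ∀ j, ¬ P j → (w ∘ f) j = (v ∘ f) j := by
    intro w v P
    constructor
    · intro h
      exact ⟨fun j hj => h j fun i _ e => hj i e.symm,
        fun j hj => h _ fun i hi e => hj (by rwa [f.injective e])⟩
    · rintro ⟨h1, h2⟩ j hj
      by_cases hb : ∃ b, f b = j
      · obtain ⟨b, rfl⟩ := hb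
        exact h2 b fun hb => hj b hb rfl
      · exact h1 j fun i hi => hb ⟨i, hi⟩
  classical
  ext w v
  rw [liftOp_apply]
  cases g with
  | H i =>
    have := key w v (fun j => j = i)
    simp only [forall_eq] at this
    simp only [QGate.map, QGate.mat, Matrix.of_apply, ite_eq_ind _ ((_ : ℂ) * _)]
    rw [ind_congr this, ind_and, mul_assoc]
    rfl
  | T i =>
    simp only [QGate.map, QGate.mat, Matrix.of_apply, ite_eq_ind (_ = _)]
    rw [ind_congr (eq_iff_eqOff f w v), ind_and, mul_assoc]
    rfl
  | CNOT i j h =>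
    simp only [QGate.map, QGate.mat, Matrix.of_apply, ite_eq_ind (_ = _)]
    have e : Function.update v (f j) (xor (v (f i)) (v (f j))) ∘ f =
        Function.update (v ∘ f) j (xor ((v ∘ f) i) ((v ∘ f) j)) := by
      funext k
      by_cases hk : k = j
      · subst hk; simp
      · simp [Function.update_of_ne hk, Function.update_of_ne (fun e => hk (f.injective e))]
    have e' : EqOff f w (Function.update v (f j) (xor (v (f i)) (v (f j)))) ↔ EqOff f w v := by
      refine forall_congr' fun k => forall_congr' fun hk => ?_
      rw [Function.update_of_ne (hk j).symm]
    rw [ind_congr (eq_iff_eqOff f w _), ind_and, ind_congr e', e, mul_assoc]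

theorem foldl_mat {W : Type} [Fintype W] [DecidableEq W] (gs : List (QGate W)) (U : QOp W) :
    gs.foldl (fun U g => g.mat * U) U = gatesMat gs * U := by
  induction gs generalizing U with
  | nil => simp [gatesMat]
  | cons g gs ih =>
    simp only [gatesMat, List.foldl_cons] at ih ⊢
    rw [ih, ih (g.mat * 1), mul_one, Matrix.mul_assoc]

theorem gatesMat_nil {W : Type} [Fintype W] [DecidableEq W] :
    gatesMat ([] : List (QGate W)) = 1 := rfl

theorem gatesMat_append {W : Type} [Fintype W] [DecidableEq W] (gs hs : List (QGate W)) :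
    gatesMat (gs ++ hs) = gatesMat hs * gatesMat gs := by
  conv_lhs => rw [gatesMat, List.foldl_append, foldl_mat]
  rfl

theorem gatesMat_cons {W : Type} [Fintype W] [DecidableEq W] (g : QGate W) (gs : List (QGate W)) :
    gatesMat (g :: gs) = gatesMat gs * g.mat := by
  conv_lhs => rw [gatesMat, List.foldl_cons, foldl_mat, mul_one]

theorem gatesMat_map {A W : Type} [Fintype A] [DecidableEq A] [Fintype W] [DecidableEq W]
    (f : A ↪ W) (gs : List (QGate A)) :
    gatesMat (gs.map (QGate.map f)) = liftOp f (gatesMat gs) := by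
  induction gs with
  | nil => rw [List.map_nil, gatesMat_nil, gatesMat_nil, liftOp_one]
  | cons g gs ih => rw [List.map_cons, gatesMat_cons, gatesMat_cons, ih, QGate.mat_map, liftOp_mul]

theorem liftOp_mul_adjoinZeros {A W : Type} [Fintype A] [Fintype W] [DecidableEq A] [DecidableEq W]
    (f : A ↪ W) (U : QOp A) : liftOp f U * adjoinZeros f = adjoinZeros f * U := by
  ext w v
  simp only [Matrix.mul_apply, liftOp_apply, adjoinZeros_apply, mul_comm _ (ind (_ = _)), sum_ind_eq,
    extend_comp_self]
  simp only [eq_extend_iff, ind_and, mul_assoc, sum_ind_eq']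
  refine congrArg (· * _) (ind_congr ?_)
  exact ⟨fun h => h.trans (eqOff_extend _ _ _), fun h => h.trans (eqOff_extend _ _ _).symm⟩

theorem conj_apply {A B : Type} [Fintype A] [DecidableEq A]
    (U : Matrix (B → Bool) (A → Bool) ℂ) (σ : QOp A) (y y' : B → Bool) :
    (U * σ * U.conjTranspose) y y' = ∑ u, ∑ u', σ u u' * (U y u * star (U y' u')) := by
  simp only [Matrix.mul_apply, Finset.sum_mul, Matrix.conjTranspose_apply]
  rw [Finset.sum_comm]
  refine Finset.sum_congr rfl fun u _ => Finset.sum_congr rfl fun u' _ => ?_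
  ring

theorem traceOut_liftOp {A W : Type} [Fintype A] [Fintype W] [DecidableEq A] [DecidableEq W]
    (f : A ↪ W) (U : QOp A) (σ : QOp W) :
    traceOut f (liftOp f U * σ * (liftOp f U).conjTranspose) =
      U * traceOut f σ * U.conjTranspose := by
  ext y y'
  rw [conj_apply, sum_traceOut_mul f σ (fun u u' => U y u * star (U y' u')), traceOut_apply]
  simp only [conj_apply, liftOp_apply, Finset.mul_sum]
  rw [sum_comm_four]
  refine Finset.sum_congr rfl fun a _ => Finset.sum_congr rfl fun b _ => ?_
  have : ∀ w w' : W → Bool, ind (w ∘ f = y) * (ind (w' ∘ f = y') * (ind (EqOff f w w') *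
      (σ a b * (ind (EqOff f w a) * U (w ∘ f) (a ∘ f) *
        star (ind (EqOff f w' b) * U (w' ∘ f) (b ∘ f)))))) =
      ind (w = Function.extend f y a) * (ind (w' = Function.extend f y' b) *
        (ind (EqOff f w w') * (σ a b * (U (w ∘ f) (a ∘ f) * star (U (w' ∘ f) (b ∘ f)))))) := by
    intro w w'
    rw [ind_congr (eq_extend_iff f y a w), ind_congr (eq_extend_iff f y' b w'), ind_and, ind_and,
      star_mul', star_ind]
    ring
  simp only [this, ← Finset.mul_sum, sum_ind_eq, extend_comp_self]
  rw [mul_assoc]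
  refine congrArg (· * _) (ind_congr ?_)
  exact ⟨fun h => (eqOff_extend _ _ _).symm.trans (h.trans (eqOff_extend _ _ _)),
    fun h => (eqOff_extend _ _ _).trans (h.trans (eqOff_extend _ _ _).symm)⟩

/-- Base change: tracing out new qubits that have just been initialized to zero. The maps `g` and
`a` glue `W'` to `W` along the register `J`. -/
theorem traceOut_adjoinZeros {J W W' X : Type} [Fintype J] [DecidableEq J] [Fintype W]
    [DecidableEq W] [Fintype W'] [DecidableEq W'] [Fintype X] [DecidableEq X]
    (out : J ↪ W) (inp : J ↪ W') (a : W ↪ X) (g : W' ↪ X) (hsq : ∀ j, g (inp j) = a (out j))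
    (hpb : ∀ w w', a w = g w' → ∃ j, out j = w)
    (τ : QOp W) :
    traceOut g (adjoinZeros a * τ * (adjoinZeros a).conjTranspose) =
      adjoinZeros inp * traceOut out τ * (adjoinZeros inp).conjTranspose := by
  ext z z'
  rw [conj_apply, traceOut_apply, sum_traceOut_mul out τ
    (fun u u' => adjoinZeros inp z u * star (adjoinZeros inp z' u'))]
  simp only [conj_apply, Finset.mul_sum]
  rw [sum_comm_four]
  refine Finset.sum_congr rfl fun u _ => Finset.sum_congr rfl fun u' _ => ?_
  simp only [adjoinZeros_apply, star_ind]
  have : ∀ w w' : X → Bool, ind (w ∘ g = z) * (ind (w' ∘ g = z') * (ind (EqOff g w w') *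
      (τ u u' * (ind (w = Function.extend a u fun _ => false) *
        ind (w' = Function.extend a u' fun _ => false))))) =
      ind (w = Function.extend a u fun _ => false) *
      (ind (w' = Function.extend a u' fun _ => false) *
      (ind (w ∘ g = z) * (ind (w' ∘ g = z') * (ind (EqOff g w w') * τ u u')))) := fun _ _ => by ring
  simp only [this, ← Finset.mul_sum, sum_ind_eq]
  have h1 : ∀ (u : W → Bool) (z : W' → Bool), Function.extend a u (fun _ => false) ∘ g = z ↔
      z = Function.extend inp (u ∘ out) (fun _ => false) := by
    intro u z
    have : Function.extend a u (fun _ => false) ∘ g =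
        Function.extend inp (u ∘ out) (fun _ => false) := by
      rw [eq_extend_iff]
      constructor
      · funext j
        simp [hsq, a.injective.extend_apply]
      · intro k hk
        refine Function.extend_apply' _ _ _ ?_
        rintro ⟨w, hw⟩
        obtain ⟨j, rfl⟩ := hpb _ _ hw
        rw [← hsq] at hw
        exact hk j (g.injective hw)
    rw [this, eq_comm]
  have h2 : EqOff g (Function.extend a u fun _ => false) (Function.extend a u' fun _ => false) ↔
      EqOff out u u' := by
    constructor
    · intro h w hw
      have := h (a w) (fun w' e => by
        obtain ⟨j, hj⟩ := hpb _ _ e.symm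
        exact hw j hj)
      rwa [a.injective.extend_apply, a.injective.extend_apply] at this
    · intro h x hx
      by_cases hxa : ∃ w, a w = x
      · obtain ⟨w, rfl⟩ := hxa
        rw [a.injective.extend_apply, a.injective.extend_apply]
        exact h w fun j e => hx (inp j) (by rw [hsq, e])
      · rw [Function.extend_apply' _ _ _ hxa, Function.extend_apply' _ _ _ hxa]
  rw [ind_congr (h1 u z), ind_congr (h1 u' z'), ind_congr h2]
  ring

/-! ### Composition of circuits -/

namespace QCircuit

variable {I J O I' O' : Type}

theorem gluingFun_inp (c : QCircuit I J) (c' : QCircuit J O) (j : J) :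
    gluingFun c c' (c'.inp j) = Sum.inl (c.out j) := by
  have h : ∃ j', c'.inp j' = c'.inp j := ⟨j, rfl⟩
  unfold gluingFun
  rw [dif_pos h, c'.inp.injective h.choose_spec]

theorem gluingFun_not_inp (c : QCircuit I J) (c' : QCircuit J O) (w : c'.W)
    (h : ¬ ∃ j, c'.inp j = w) : gluingFun c c' w = Sum.inr w := by
  unfold gluingFun
  rw [dif_neg h]

/-- The channel of a composition is the composition of the channels: the partial trace over the
discarded qubits of `c` can be moved past the gates of `c'`, which do not act on them, and past the
initialization of the new qubits of `c'`. -/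
theorem channel_comp [Fintype I] [DecidableEq I] [Fintype J] [DecidableEq J]
    (c : QCircuit I J) (c' : QCircuit J O) (ρ : QOp I) :
    (c.comp c').channel ρ = c'.channel (c.channel ρ) := by
  let a : c.W ↪ c.W ⊕ c'.W := Function.Embedding.inl
  let g : c'.W ↪ c.W ⊕ c'.W := ⟨gluingFun c c', gluingFun_injective c c'⟩
  have hbase := traceOut_adjoinZeros c.out c'.inp a g (gluingFun_inp c c')
    (fun w w' e => by
      by_cases h : ∃ j, c'.inp j = w'
      · obtain ⟨j, rfl⟩ := h
        exact ⟨j, (Sum.inl.inj (e.trans (gluingFun_inp c c' j))).symm⟩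
      · exact absurd (e.trans (gluingFun_not_inp c c' w' h)) Sum.inl_ne_inr)
    (gatesMat c.gates * (adjoinZeros c.inp * ρ * (adjoinZeros c.inp).conjTranspose) *
      (gatesMat c.gates).conjTranspose)
  change traceOut (c'.out.trans g) (gatesMat (c.gates.map (QGate.map a) ++
    c'.gates.map (QGate.map g)) * (adjoinZeros (c.inp.trans a) * ρ *
      (adjoinZeros (c.inp.trans a)).conjTranspose) * (gatesMat (c.gates.map (QGate.map a) ++
    c'.gates.map (QGate.map g))).conjTranspose) = _
  rw [traceOut_trans, gatesMat_append, gatesMat_map, gatesMat_map, adjoinZeros_trans]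
  have e : liftOp g (gatesMat c'.gates) * liftOp a (gatesMat c.gates) *
      (adjoinZeros a * adjoinZeros c.inp * ρ * (adjoinZeros a * adjoinZeros c.inp).conjTranspose) *
      (liftOp g (gatesMat c'.gates) * liftOp a (gatesMat c.gates)).conjTranspose =
      liftOp g (gatesMat c'.gates) * ((liftOp a (gatesMat c.gates) * adjoinZeros a) *
      (adjoinZeros c.inp * ρ * (adjoinZeros c.inp).conjTranspose) *
        (liftOp a (gatesMat c.gates) * adjoinZeros a).conjTranspose) *
      (liftOp g (gatesMat c'.gates)).conjTranspose := by
    simp only [Matrix.conjTranspose_mul, Matrix.mul_assoc]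
  rw [e, traceOut_liftOp, liftOp_mul_adjoinZeros]
  simp only [Matrix.conjTranspose_mul, Matrix.mul_assoc] at hbase ⊢
  rw [hbase]
  simp only [channel, Matrix.mul_assoc]

end QCircuit

/-! ### Circuits side by side -/

/-- The tensor product of two operators between registers. -/
def kron {I J I' J' : Type} (A : Matrix (I → Bool) (J → Bool) ℂ)
    (B : Matrix (I' → Bool) (J' → Bool) ℂ) : Matrix (I ⊕ I' → Bool) (J ⊕ J' → Bool) ℂ :=
  Matrix.of fun v w => A (fun i => v (Sum.inl i)) (fun i => w (Sum.inl i)) *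
    B (fun i => v (Sum.inr i)) (fun i => w (Sum.inr i))

/-- The tensor product of a family of operators between registers. -/
def famKron {S I J : Type} [Fintype S] (A : S → Matrix (I → Bool) (J → Bool) ℂ) :
    Matrix (S × I → Bool) (S × J → Bool) ℂ :=
  Matrix.of fun v w => ∏ r, A r (fun i => v (r, i)) (fun i => w (r, i))

theorem tensorState_eq_kron {Q R : Type} (ρ : QOp Q) (σ : QOp R) :
    tensorState ρ σ = kron ρ σ := rfl

theorem tensorFamily_eq_famKron {S Q : Type} [Fintype S] (ρ : S → QOp Q) :
    tensorFamily ρ = famKron ρ := rfl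

theorem sum_sumArrow {A B : Type} [Fintype A] [DecidableEq A] [Fintype B] [DecidableEq B]
    (F : (A ⊕ B → Bool) → ℂ) :
    ∑ v, F v = ∑ a : A → Bool, ∑ b : B → Bool, F (Sum.elim a b) := by
  rw [← (Equiv.sumArrowEquivProdArrow A B Bool).symm.sum_comp, Fintype.sum_prod_type]
  rfl

theorem kron_mul {I J K I' J' K' : Type} [Fintype J] [DecidableEq J] [Fintype J'] [DecidableEq J']
    (A : Matrix (I → Bool) (J → Bool) ℂ) (B : Matrix (J → Bool) (K → Bool) ℂ)
    (A' : Matrix (I' → Bool) (J' → Bool) ℂ) (B' : Matrix (J' → Bool) (K' → Bool) ℂ) :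
    kron A A' * kron B B' = kron (A * B) (A' * B') := by
  ext v w
  simp only [Matrix.mul_apply, kron, Matrix.of_apply, sum_sumArrow, Sum.elim_inl, Sum.elim_inr,
    Finset.sum_mul_sum]
  refine Finset.sum_congr rfl fun u _ => Finset.sum_congr rfl fun u' _ => ?_
  ring

theorem kron_conjTranspose {I J I' J' : Type} (A : Matrix (I → Bool) (J → Bool) ℂ)
    (B : Matrix (I' → Bool) (J' → Bool) ℂ) :
    (kron A B).conjTranspose = kron A.conjTranspose B.conjTranspose := by
  ext v w
  simp only [Matrix.conjTranspose_apply, kron, Matrix.of_apply, star_mul']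

theorem famKron_mul {S I J K : Type} [Fintype S] [DecidableEq S] [Fintype J] [DecidableEq J]
    (A : S → Matrix (I → Bool) (J → Bool) ℂ) (B : S → Matrix (J → Bool) (K → Bool) ℂ) :
    famKron A * famKron B = famKron (fun r => A r * B r) := by
  ext v w
  simp only [Matrix.mul_apply, famKron, Matrix.of_apply, ← Finset.prod_mul_distrib]
  rw [Finset.prod_univ_sum, ← (Equiv.curry S J Bool).symm.sum_comp]
  simp

theorem famKron_conjTranspose {S I J : Type} [Fintype S]
    (A : S → Matrix (I → Bool) (J → Bool) ℂ) :
    (famKron A).conjTranspose = famKron (fun r => (A r).conjTranspose) := by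
  ext v w
  simp only [Matrix.conjTranspose_apply, famKron, Matrix.of_apply, star_prod]

theorem eq_sum_iff {A B : Type} (v w : A ⊕ B → Bool) :
    v = w ↔ v ∘ Sum.inl = w ∘ Sum.inl ∧ v ∘ Sum.inr = w ∘ Sum.inr := by
  simp [funext_iff]

theorem eqOff_sumMap {A B A' B' : Type} (f : A → A') (g : B → B') (w v : A' ⊕ B' → Bool) :
    EqOff (Sum.map f g) w v ↔
      EqOff f (w ∘ Sum.inl) (v ∘ Sum.inl) ∧ EqOff g (w ∘ Sum.inr) (v ∘ Sum.inr) := by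
  simp [EqOff]

theorem adjoinZeros_sumMap {I W I' W' : Type} (f : I ↪ W) (g : I' ↪ W') :
    adjoinZeros (f.sumMap g) = kron (adjoinZeros f) (adjoinZeros g) := by
  ext w v
  simp only [kron, Matrix.of_apply, adjoinZeros_apply, ← ind_and]
  refine ind_congr ?_
  simp only [eq_extend_iff]
  have := eqOff_sumMap f g w (fun _ => false)
  simp only [Function.Embedding.coe_sumMap] at this ⊢
  rw [this, eq_sum_iff]
  simp only [Function.comp_def, Sum.map_inl, Sum.map_inr]
  tauto

theorem liftOp_inl {A B : Type} [DecidableEq (B → Bool)] (U : QOp A) :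
    liftOp (Function.Embedding.inl : A ↪ A ⊕ B) U = kron U 1 := by
  ext w v
  rw [liftOp_apply]
  simp only [kron, Matrix.of_apply]
  rw [one_apply_ind, mul_comm]
  refine congrArg (_ * ·) (ind_congr ?_)
  simp [EqOff, funext_iff]

theorem liftOp_inr {A B : Type} [DecidableEq (A → Bool)] (U : QOp B) :
    liftOp (Function.Embedding.inr : B ↪ A ⊕ B) U = kron 1 U := by
  ext w v
  rw [liftOp_apply]
  simp only [kron, Matrix.of_apply]
  rw [one_apply_ind]
  refine congrArg (· * _) (ind_congr ?_)
  simp [EqOff, funext_iff]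

theorem traceOut_sumMap {A B A' B' : Type} [Fintype A'] [DecidableEq A'] [Fintype B']
    [DecidableEq B'] (f : A ↪ A') (g : B ↪ B') (σ : QOp A') (τ : QOp B') :
    traceOut (f.sumMap g) (kron σ τ) = kron (traceOut f σ) (traceOut g τ) := by
  ext y y'
  simp only [kron, Matrix.of_apply, traceOut_apply, sum_sumArrow, Finset.sum_mul_sum]
  refine Finset.sum_congr rfl fun a _ => Finset.sum_congr rfl fun b _ =>
    Finset.sum_congr rfl fun a' _ => Finset.sum_congr rfl fun b' _ => ?_
  have h1 : ∀ (u : A' → Bool) (v : B' → Bool) (z : A ⊕ B → Bool),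
      Sum.elim u v ∘ (f.sumMap g) = z ↔ u ∘ f = z ∘ Sum.inl ∧ v ∘ g = z ∘ Sum.inr := by
    intro u v z
    rw [eq_sum_iff]
    exact Iff.rfl
  have h2 := eqOff_sumMap f g (Sum.elim a b) (Sum.elim a' b')
  rw [← Function.Embedding.coe_sumMap, Sum.elim_comp_inl, Sum.elim_comp_inr, Sum.elim_comp_inl,
    Sum.elim_comp_inr] at h2
  rw [ind_congr (h1 a b y), ind_congr (h1 a' b' y'), ind_congr h2]
  simp only [ind_and, Sum.elim_inl, Sum.elim_inr, Function.comp_def]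
  ring

namespace QCircuit

variable {I J O I' O' : Type}

theorem channel_par [Fintype I] [DecidableEq I] [Fintype I'] [DecidableEq I']
    (c : QCircuit I O) (c' : QCircuit I' O') (ρ : QOp I) (ρ' : QOp I') :
    (c.par c').channel (tensorState ρ ρ') = tensorState (c.channel ρ) (c'.channel ρ') := by
  have hU : gatesMat (c.gates.map (QGate.map Function.Embedding.inl) ++
      c'.gates.map (QGate.map Function.Embedding.inr) : List (QGate (c.W ⊕ c'.W))) =
      kron (gatesMat c.gates) (gatesMat c'.gates) := by
    rw [gatesMat_append, gatesMat_map, gatesMat_map, liftOp_inl, liftOp_inr, kron_mul, one_mul,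
      mul_one]
  refine Eq.trans (b := traceOut (c.out.sumMap c'.out) (gatesMat (W := c.W ⊕ c'.W)
    (c.gates.map (QGate.map Function.Embedding.inl) ++
      c'.gates.map (QGate.map Function.Embedding.inr)) * (adjoinZeros (c.inp.sumMap c'.inp) *
      kron ρ ρ' * (adjoinZeros (c.inp.sumMap c'.inp)).conjTranspose) * (gatesMat (W := c.W ⊕ c'.W)
    (c.gates.map (QGate.map Function.Embedding.inl) ++
      c'.gates.map (QGate.map Function.Embedding.inr))).conjTranspose)) rfl ?_
  rw [hU, adjoinZeros_sumMap]
  simp only [kron_conjTranspose, kron_mul, traceOut_sumMap]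
  rfl

theorem channel_ident (R : Type) [Fintype R] [DecidableEq R] (ρ : QOp R) :
    (ident R).channel ρ = ρ := by
  have h1 : adjoinZeros (Function.Embedding.refl R) = 1 := by
    ext w v
    rw [adjoinZeros_apply, one_apply_ind]
    exact ind_congr (by
      rw [show Function.extend (Function.Embedding.refl R) v (fun _ => false) = v from
        Function.extend_id _ _])
  have h2 : traceOut (Function.Embedding.refl R) ρ = ρ := by
    ext y y'
    have : ∀ w w' : R → Bool, EqOff (Function.Embedding.refl R) w w' :=
      fun w w' j hj => absurd rfl (hj j)
    rw [traceOut_apply]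
    simp only [Function.Embedding.coe_refl, Function.comp_id, ← Finset.mul_sum, sum_ind_eq]
    exact (congrArg (· * _) (ind_pos (this y y'))).trans (one_mul _)
  refine Eq.trans (b := traceOut (Function.Embedding.refl R) (gatesMat (W := R) [] *
    (adjoinZeros (Function.Embedding.refl R) * ρ *
      (adjoinZeros (Function.Embedding.refl R)).conjTranspose) *
        (gatesMat (W := R) []).conjTranspose)) rfl ?_
  rw [gatesMat_nil, h1]
  simp [h2]

/-- The same circuit with its input register relabelled. -/
def reindexIn (c : QCircuit I O) (e : I' ≃ I) : QCircuit I' O where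
  W := c.W
  inp := e.toEmbedding.trans c.inp
  gates := c.gates
  out := c.out

theorem size_reindexIn (c : QCircuit I O) (e : I' ≃ I) : (c.reindexIn e).size = c.size := rfl

theorem channel_reindexIn [Fintype I] [DecidableEq I] [Fintype I'] [DecidableEq I']
    (c : QCircuit I O) (e : I' ≃ I) (ρ : QOp I') :
    (c.reindexIn e).channel ρ = c.channel (ρ.submatrix (fun v => v ∘ e) (fun v => v ∘ e)) := by
  have h : adjoinZeros e.toEmbedding * ρ * (adjoinZeros e.toEmbedding).conjTranspose =
      ρ.submatrix (fun v => v ∘ e) (fun v => v ∘ e) := by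
    ext v v'
    have h1 : ∀ (v : I → Bool) (u : I' → Bool),
        v = Function.extend e.toEmbedding u (fun _ => false) ↔ u = v ∘ e := by
      intro v u
      rw [eq_extend_iff]
      have : EqOff e.toEmbedding v (fun _ => false) := fun j hj => absurd (e.apply_symm_apply j) (hj _)
      simp only [this, and_true]
      exact eq_comm
    rw [conj_apply]
    simp only [adjoinZeros_apply, star_ind, h1]
    have h2 : ∀ u u' : I' → Bool, ρ u u' * (ind (u = v ∘ e) * ind (u' = v' ∘ e)) =
        ind (u = v ∘ e) * (ind (u' = v' ∘ e) * ρ u u') := fun u u' => by ring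
    simp only [h2, ← Finset.mul_sum, sum_ind_eq, Matrix.submatrix_apply]
  refine Eq.trans (b := traceOut c.out (gatesMat c.gates * (adjoinZeros (e.toEmbedding.trans c.inp) *
    ρ * (adjoinZeros (e.toEmbedding.trans c.inp)).conjTranspose) *
      (gatesMat c.gates).conjTranspose)) rfl ?_
  rw [adjoinZeros_trans, channel, ← h]
  simp only [Matrix.conjTranspose_mul, Matrix.mul_assoc]

end QCircuit

theorem eqOff_prodMap {S A B : Type} (f : A → B) (w v : S × B → Bool) :
    EqOff (Prod.map id f) w v ↔ ∀ r : S, EqOff f (fun i => w (r, i)) (fun i => v (r, i)) := by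
  constructor
  · intro h r j hj
    exact h (r, j) fun i e => hj i.2 (congrArg Prod.snd e)
  · rintro h ⟨r, j⟩ hj
    exact h r j fun i e => hj (r, i) (by simp [Prod.map, e])

theorem ind_forall {S : Type} [Fintype S] (P : S → Prop) : ind (∀ r, P r) = ∏ r, ind (P r) := by
  classical
  by_cases h : ∀ r, P r
  · rw [ind_pos h, Finset.prod_eq_one fun r _ => ind_pos (h r)]
  · rw [ind_neg h]
    push Not at h
    obtain ⟨r, hr⟩ := h
    rw [Finset.prod_eq_zero (Finset.mem_univ r) (ind_neg hr)]

theorem adjoinZeros_prodMap {S A B : Type} [Fintype S] (f : A ↪ B) :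
    adjoinZeros ((Function.Embedding.refl S).prodMap f) = famKron (fun _ => adjoinZeros f) := by
  ext w v
  simp only [famKron, Matrix.of_apply, adjoinZeros_apply, ← ind_forall]
  refine ind_congr ?_
  simp only [eq_extend_iff]
  have := eqOff_prodMap (S := S) f w (fun _ => false)
  have e : ⇑((Function.Embedding.refl S).prodMap f) = Prod.map id f := rfl
  rw [e, this, forall_and]
  refine and_congr_left' ?_
  simp [funext_iff, Prod.map]

theorem liftOp_sectR {S A : Type} [Fintype S] [DecidableEq S] [DecidableEq (A → Bool)] (r : S)
    (U : QOp A) :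
    liftOp (Function.Embedding.sectR r A) U = famKron (Function.update (fun _ => 1) r U) := by
  ext w v
  rw [liftOp_apply]
  simp only [famKron, Matrix.of_apply]
  rw [← Finset.mul_prod_erase _ _ (Finset.mem_univ r), Function.update_self, mul_comm]
  refine congrArg₂ (· * ·) rfl ?_
  have : ∀ s ∈ Finset.univ.erase r, Function.update (fun _ => (1 : QOp A)) r U s
      (fun i => w (s, i)) (fun i => v (s, i)) = ind (∀ i, s ≠ r → w (s, i) = v (s, i)) := by
    intro s hs
    have hs' := Finset.ne_of_mem_erase hs
    rw [Function.update_of_ne hs', one_apply_ind]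
    exact ind_congr (by simp [hs', funext_iff])
  rw [Finset.prod_congr rfl this, ← one_mul (∏ s ∈ _, _),
    ← ind_pos (P := ∀ i, r ≠ r → w (r, i) = v (r, i)) (by simp),
    Finset.mul_prod_erase _ (fun s => ind (∀ i, s ≠ r → w (s, i) = v (s, i))) (Finset.mem_univ r),
    ← ind_forall]
  refine ind_congr ?_
  simp only [EqOff, Prod.forall]
  refine forall_congr' fun s => forall_congr' fun i => ?_
  simp only [Function.Embedding.sectR_apply, ne_eq, Prod.mk.injEq, not_and]
  exact ⟨fun h hs => h fun j e => absurd e.symm hs, fun h hs => h fun e => hs i e.symm rfl⟩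

theorem traceOut_prodMap {S A B : Type} [Fintype S] [DecidableEq S] [Fintype B] [DecidableEq B]
    (f : A ↪ B) (σ : S → QOp B) :
    traceOut ((Function.Embedding.refl S).prodMap f) (famKron σ) =
      famKron (fun r => traceOut f (σ r)) := by
  ext y y'
  simp only [famKron, Matrix.of_apply, traceOut_apply]
  have h1 : ∀ (w : S × B → Bool) (y : S × A → Bool),
      w ∘ ((Function.Embedding.refl S).prodMap f) = y ↔
        ∀ r, (fun i => w (r, i)) ∘ f = fun i => y (r, i) := by
    intro w y
    simp [funext_iff, Prod.map]
  have h2 : ∀ w w' : S × B → Bool, EqOff ((Function.Embedding.refl S).prodMap f) w w' ↔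
      ∀ r, EqOff f (fun i => w (r, i)) (fun i => w' (r, i)) := fun w w' => eqOff_prodMap f w w'
  simp only [h1, h2, ind_forall, ← Finset.prod_mul_distrib]
  rw [Finset.prod_univ_sum, ← (Equiv.curry S B Bool).symm.sum_comp]
  simp only [Finset.prod_univ_sum, Fintype.piFinset_univ]
  refine Finset.sum_congr rfl fun w _ => ?_
  rw [← (Equiv.curry S B Bool).symm.sum_comp]
  rfl

namespace QCircuit

variable {I O : Type}

theorem gatesMat_copies (c : QCircuit I O) (q : ℕ) :
    gatesMat (W := Fin q × c.W) ((List.finRange q).flatMap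
      (fun r => c.gates.map (QGate.map (Function.Embedding.sectR r c.W)))) =
      famKron (fun _ => gatesMat c.gates) := by
  have key : ∀ L : List (Fin q), L.Nodup → gatesMat (W := Fin q × c.W) (L.flatMap
      (fun r => c.gates.map (QGate.map (Function.Embedding.sectR r c.W)))) =
      famKron (fun r => if r ∈ L then gatesMat c.gates else 1) := by
    intro L
    induction L with
    | nil =>
      intro _
      rw [List.flatMap_nil, gatesMat_nil]
      ext w v
      simp only [one_apply_ind, famKron, Matrix.of_apply, List.not_mem_nil, if_false]
      rw [← ind_forall]
      exact ind_congr (by simp [funext_iff])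
    | cons r L ih =>
      intro hL
      rw [List.nodup_cons] at hL
      rw [List.flatMap_cons, gatesMat_append, gatesMat_map, ih hL.2, liftOp_sectR, famKron_mul]
      refine congrArg famKron (funext fun s => ?_)
      by_cases hs : s = r
      · subst hs
        simp [hL.1]
      · simp [hs]
  rw [key _ (List.nodup_finRange q)]
  simp

theorem channel_copies [Fintype I] [DecidableEq I] (c : QCircuit I O) (q : ℕ) (ρ : Fin q → QOp I) :
    (c.copies q).channel (tensorFamily ρ) = tensorFamily (fun r => c.channel (ρ r)) := by
  refine Eq.trans (b := traceOut ((Function.Embedding.refl (Fin q)).prodMap c.out)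
    (gatesMat (W := Fin q × c.W) ((List.finRange q).flatMap
      (fun r => c.gates.map (QGate.map (Function.Embedding.sectR r c.W)))) *
      (adjoinZeros ((Function.Embedding.refl (Fin q)).prodMap c.inp) * famKron ρ *
      (adjoinZeros ((Function.Embedding.refl (Fin q)).prodMap c.inp)).conjTranspose) *
      (gatesMat (W := Fin q × c.W) ((List.finRange q).flatMap
      (fun r => c.gates.map (QGate.map (Function.Embedding.sectR r c.W))))).conjTranspose)) rfl ?_
  rw [gatesMat_copies, adjoinZeros_prodMap]
  simp only [famKron_conjTranspose, famKron_mul, traceOut_prodMap]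
  rfl

theorem size_comp (c : QCircuit I J) (c' : QCircuit J O) : (c.comp c').size = c.size + c'.size := by
  have : Fintype.card (c.comp c').W = Fintype.card c.W + Fintype.card c'.W := Fintype.card_sum
  simp only [size, this]
  simp only [comp, List.length_append, List.length_map]
  omega

theorem size_par {I' O' : Type} (c : QCircuit I O) (c' : QCircuit I' O') :
    (c.par c').size = c.size + c'.size := by
  have : Fintype.card (c.par c').W = Fintype.card c.W + Fintype.card c'.W := Fintype.card_sum
  simp only [size, this]
  simp only [par, List.length_append, List.length_map]
  omega

theorem size_copies (c : QCircuit I O) (q : ℕ) : (c.copies q).size = q * c.size := by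
  have : Fintype.card (c.copies q).W = q * Fintype.card c.W := by
    rw [show Fintype.card (c.copies q).W = Fintype.card (Fin q × c.W) from rfl]
    simp
  simp only [size, this]
  simp only [copies, List.length_flatMap, List.length_map, List.map_const', List.sum_replicate,
    List.length_finRange, smul_eq_mul]
  ring

theorem size_ident (R : Type) [Fintype R] [DecidableEq R] :
    (ident R).size = 2 * Fintype.card R := by
  have : Fintype.card (ident R).W = Fintype.card R := rfl
  simp only [size, this]
  simp only [ident, List.length_nil]
  ring

end QCircuit

/-! ### Unitarity of the gates and classical reversible circuits -/

/-- The operator which maps the basis state `v` to the basis state `f v`. -/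
def funMat {A W : Type} (f : (A → Bool) → (W → Bool)) : Matrix (W → Bool) (A → Bool) ℂ :=
  Matrix.of fun w v => ind (w = f v)

theorem funMat_apply {A W : Type} (f : (A → Bool) → (W → Bool)) (w : W → Bool) (v : A → Bool) :
    funMat f w v = ind (w = f v) := rfl

theorem funMat_mul {A B W : Type} [Fintype B] [DecidableEq B] (f : (B → Bool) → (W → Bool))
    (g : (A → Bool) → (B → Bool)) : funMat f * funMat g = funMat (f ∘ g) := by
  ext w v
  simp only [Matrix.mul_apply, funMat_apply]
  simp only [mul_comm (ind (w = _)), sum_ind_eq]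
  rfl

theorem funMat_id {W : Type} [DecidableEq (W → Bool)] : funMat (id : (W → Bool) → W → Bool) = 1 := by
  ext w v
  rw [funMat_apply, one_apply_ind]
  rfl

theorem adjoinZeros_eq_funMat {I W : Type} (f : I ↪ W) :
    adjoinZeros f = funMat (fun v => Function.extend f v (fun _ => false)) := by
  ext w v
  rw [adjoinZeros_apply, funMat_apply]

theorem diagonal_apply_ind {W : Type} [DecidableEq (W → Bool)] (φ : (W → Bool) → ℂ)
    (w v : W → Bool) : Matrix.diagonal φ w v = ind (w = v) * φ v := by
  rw [Matrix.diagonal_apply, ite_eq_ind]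
  exact ind_mul_congr fun h => by rw [h]

theorem funMat_mul_diagonal_mul_funMat {W : Type} [Fintype W] [DecidableEq W]
    (f : (W → Bool) → (W → Bool)) (hf : Function.Involutive f) (φ : (W → Bool) → ℂ) :
    funMat f * Matrix.diagonal φ * funMat f = Matrix.diagonal (φ ∘ f) := by
  ext w v
  rw [Matrix.mul_apply]
  simp only [Matrix.mul_diagonal, funMat_apply]
  simp only [mul_comm _ (ind (_ = f v)), sum_ind_eq]
  rw [hf v, diagonal_apply_ind]
  rfl

/-- The action of a CNOT gate on basis states. -/
def cnotFun {W : Type} [DecidableEq W] (i j : W) (v : W → Bool) : W → Bool :=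
  Function.update v j (xor (v i) (v j))

theorem cnotFun_involutive {W : Type} [DecidableEq W] {i j : W} (h : i ≠ j) :
    Function.Involutive (cnotFun i j) := by
  intro v
  funext k
  by_cases hk : k = j
  · subst hk
    simp [cnotFun, Function.update_of_ne h]
  · simp [cnotFun, hk]

theorem mat_CNOT {W : Type} [DecidableEq W] (i j : W) (h : i ≠ j) :
    (QGate.CNOT i j h).mat = funMat (cnotFun i j) := by
  ext w v
  simp only [QGate.mat, Matrix.of_apply, funMat_apply, ite_eq_ind, mul_one]
  refine ind_congr ?_
  unfold cnotFun
  rw [Subsingleton.elim (fun a b => Classical.propDecidable (a = b)) (‹DecidableEq W›)]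

/-- The eighth root of unity on the diagonal of the gate `T`. -/
def omega8 : ℂ := Complex.exp (Complex.I * Real.pi / 4)

theorem omega8_pow_four : omega8 ^ 4 = -1 := by
  rw [omega8, ← Complex.exp_nat_mul]
  rw [show ((4 : ℕ) : ℂ) * (Complex.I * Real.pi / 4) = Real.pi * Complex.I by push_cast; ring]
  exact Complex.exp_pi_mul_I

theorem mat_T {W : Type} [DecidableEq (W → Bool)] (i : W) :
    (QGate.T i).mat = Matrix.diagonal (fun v : W → Bool => if v i then omega8 else 1) := by
  ext w v
  rw [diagonal_apply_ind]
  rw [QGate.mat, Matrix.of_apply, ite_eq_ind]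
  refine ind_mul_congr ?_
  rintro rfl
  rfl

/-- The scalar `(-1) ^ (a b)`. -/
def sgn (a b : Bool) : ℂ := if a = true ∧ b = true then -1 else 1

theorem inv_sqrt_two_mul_self : ((Real.sqrt 2 : ℝ) : ℂ)⁻¹ * ((Real.sqrt 2 : ℝ) : ℂ)⁻¹ = 1 / 2 := by
  rw [← mul_inv, ← Complex.ofReal_mul, Real.mul_self_sqrt (by norm_num)]
  norm_num

theorem mat_H_apply {W : Type} (i : W) (w v : W → Bool) :
    (QGate.H i).mat w v =
      ind (∀ j, j ≠ i → w j = v j) * (sgn (w i) (v i) * ((Real.sqrt 2 : ℝ) : ℂ)⁻¹) := by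
  rw [QGate.mat, Matrix.of_apply, ite_eq_ind]
  rfl

theorem mat_H_apply' {W : Type} [DecidableEq W] (i : W) (w v : W → Bool) :
    (QGate.H i).mat w v = ∑ b : Bool, ind (w = Function.update v i b) *
      (sgn b (v i) * ((Real.sqrt 2 : ℝ) : ℂ)⁻¹) := by
  have h : ∀ b, w = Function.update v i b ↔ b = w i ∧ ∀ j, j ≠ i → w j = v j := by
    intro b
    rw [eq_comm, Function.update_eq_iff]
    exact and_congr_right' (forall_congr' fun j => forall_congr' fun _ => eq_comm)
  simp only [h, ind_and, mul_assoc, sum_ind_eq]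
  rw [mat_H_apply]

/-- Conjugating a controlled phase flip by a Hadamard gate gives a controlled bit flip. -/
theorem mat_H_diagonal_mat_H {W : Type} [Fintype W] [DecidableEq W] (i : W)
    (P : (W → Bool) → Bool) (hP : ∀ v b, P (Function.update v i b) = P v) :
    (QGate.H i).mat * Matrix.diagonal (fun v => sgn (P v) (v i)) * (QGate.H i).mat =
      funMat (fun v => Function.update v i (xor (P v) (v i))) := by
  ext w v
  rw [Matrix.mul_apply]
  have h0 : ∀ u, ((QGate.H i).mat * Matrix.diagonal (fun v => sgn (P v) (v i))) w u *
      (QGate.H i).mat u v = ∑ b : Bool, (QGate.H i).mat w u * sgn (P u) (u i) *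
      (ind (u = Function.update v i b) * (sgn b (v i) * ((Real.sqrt 2 : ℝ) : ℂ)⁻¹)) := by
    intro u
    rw [Matrix.mul_diagonal, mat_H_apply' i u v, Finset.mul_sum]
  rw [Finset.sum_congr rfl fun u _ => h0 u, Finset.sum_comm]
  have h1 : ∀ b : Bool, (∑ u, (QGate.H i).mat w u * sgn (P u) (u i) *
      (ind (u = Function.update v i b) * (sgn b (v i) * ((Real.sqrt 2 : ℝ) : ℂ)⁻¹))) =
      ind (∀ j, j ≠ i → w j = Function.update v i b j) *
        (sgn (w i) b * ((Real.sqrt 2 : ℝ) : ℂ)⁻¹) * sgn (P v) b *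
          (sgn b (v i) * ((Real.sqrt 2 : ℝ) : ℂ)⁻¹) := by
    intro b
    have h := sum_ind_eq (Function.update v i b) (fun u => (QGate.H i).mat w u * sgn (P u) (u i) *
      (sgn b (v i) * ((Real.sqrt 2 : ℝ) : ℂ)⁻¹))
    rw [mat_H_apply, hP, Function.update_self] at h
    rw [← h]
    exact Finset.sum_congr rfl fun u _ => by ring
  rw [Finset.sum_congr rfl fun b _ => h1 b, funMat_apply]
  have h2 : ∀ b, (∀ j, j ≠ i → w j = Function.update v i b j) ↔ ∀ j, j ≠ i → w j = v j :=
    fun b => forall_congr' fun j => forall_congr' fun hj => by rw [Function.update_of_ne hj]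
  have h3 : w = Function.update v i (xor (P v) (v i)) ↔
      w i = xor (P v) (v i) ∧ ∀ j, j ≠ i → w j = v j := by
    rw [eq_comm, Function.update_eq_iff]
    exact and_congr eq_comm (forall_congr' fun j => forall_congr' fun _ => eq_comm)
  simp only [h2, h3, ind_and, Fintype.sum_bool]
  have h4 : ∀ a b c d e : ℂ, ind (∀ j, j ≠ i → w j = v j) * (a * ((Real.sqrt 2 : ℝ) : ℂ)⁻¹) * b *
      (c * ((Real.sqrt 2 : ℝ) : ℂ)⁻¹) = ind (∀ j, j ≠ i → w j = v j) * (a * b * c * (1 / 2)) := by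
    intro a b c d e
    rw [← inv_sqrt_two_mul_self]
    ring
  simp only [h4 _ _ _ 0 0]
  rw [← mul_add, mul_comm]
  refine congrArg (· * _) ?_
  generalize P v = p
  generalize v i = b
  generalize w i = a
  rcases p <;> rcases a <;> rcases b <;> simp [sgn, ind] <;> norm_num

theorem mat_H_conjTranspose {W : Type} (i : W) : (QGate.H i).mat.conjTranspose = (QGate.H i).mat := by
  ext w v
  rw [Matrix.conjTranspose_apply, mat_H_apply, mat_H_apply, star_mul', star_ind]
  have h1 : (∀ j, j ≠ i → v j = w j) ↔ (∀ j, j ≠ i → w j = v j) :=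
    forall_congr' fun j => forall_congr' fun _ => eq_comm
  have h2 : star (sgn (v i) (w i) * ((Real.sqrt 2 : ℝ) : ℂ)⁻¹) =
      sgn (w i) (v i) * ((Real.sqrt 2 : ℝ) : ℂ)⁻¹ := by
    rw [star_mul', star_inv₀]
    congr 1
    · rcases v i <;> rcases w i <;> simp [sgn]
    · simp
  rw [h2, ind_congr h1]

theorem mat_H_mul_self {W : Type} [Fintype W] [DecidableEq W] (i : W) :
    (QGate.H i).mat * (QGate.H i).mat = 1 := by
  have h := mat_H_diagonal_mat_H i (fun _ => false) (fun _ _ => rfl)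
  have h1 : (fun v : W → Bool => sgn false (v i)) = fun _ => 1 := by
    funext v
    simp [sgn]
  have h2 : (fun v : W → Bool => Function.update v i (xor false (v i))) = id := by
    funext v
    simp
  rw [h1, h2, funMat_id, Matrix.diagonal_one, mul_one] at h
  exact h

theorem mat_conjTranspose_mul_self {W : Type} [Fintype W] [DecidableEq W] (g : QGate W) :
    g.mat.conjTranspose * g.mat = 1 := by
  cases g with
  | H i => rw [mat_H_conjTranspose, mat_H_mul_self]
  | T i =>
    rw [mat_T, Matrix.diagonal_conjTranspose, Matrix.diagonal_mul_diagonal, ← Matrix.diagonal_one]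
    congr 1
    funext v
    simp only [Pi.star_apply]
    split_ifs
    · rw [omega8, Complex.star_def, ← Complex.exp_conj, ← Complex.exp_add]
      rw [show (starRingEnd ℂ) (Complex.I * Real.pi / 4) + Complex.I * Real.pi / 4 = 0 by
        simp [Complex.conj_ofNat]; ring]
      exact Complex.exp_zero
    · simp
  | CNOT i j h =>
    have h1 : (funMat (cnotFun i j)).conjTranspose = funMat (cnotFun i j) := by
      ext w v
      rw [Matrix.conjTranspose_apply, funMat_apply, funMat_apply, star_ind]
      refine ind_congr ⟨?_, ?_⟩
      · rintro rfl
        exact (cnotFun_involutive h _).symm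
      · rintro rfl
        exact (cnotFun_involutive h _).symm
    rw [mat_CNOT, h1, funMat_mul, (cnotFun_involutive h).comp_self, funMat_id]

theorem gatesMat_conjTranspose_mul_self {W : Type} [Fintype W] [DecidableEq W]
    (gs : List (QGate W)) : (gatesMat gs).conjTranspose * gatesMat gs = 1 := by
  induction gs with
  | nil => simp [gatesMat_nil]
  | cons g gs ih =>
    rw [gatesMat_cons, Matrix.conjTranspose_mul, Matrix.mul_assoc, ← Matrix.mul_assoc _ _ g.mat, ih,
      one_mul, mat_conjTranspose_mul_self]

theorem gatesMat_replicate_T {W : Type} [Fintype W] [DecidableEq W] (i : W) (k : ℕ) :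
    gatesMat (List.replicate k (QGate.T i)) =
      Matrix.diagonal (fun v : W → Bool => if v i then omega8 ^ k else 1) := by
  induction k with
  | zero => simp [gatesMat_nil]
  | succ k ih =>
    rw [List.replicate_succ, gatesMat_cons, ih, mat_T, Matrix.diagonal_mul_diagonal]
    congr 1
    funext v
    split_ifs
    · rw [pow_succ]
    · simp

/-- The phase `omega8 ^ k` controlled by the parity of two bits. -/
def parityPhaseTwo {W : Type} (k : ℕ) (i j : W) (h : i ≠ j) : List (QGate W) :=
  QGate.CNOT i j h :: (List.replicate k (QGate.T j) ++ [QGate.CNOT i j h])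

theorem gatesMat_parityPhaseTwo {W : Type} [Fintype W] [DecidableEq W] (k : ℕ) (i j : W)
    (h : i ≠ j) : gatesMat (parityPhaseTwo k i j h) =
      Matrix.diagonal (fun v : W → Bool => if xor (v i) (v j) then omega8 ^ k else 1) := by
  rw [parityPhaseTwo, gatesMat_cons, gatesMat_append, gatesMat_replicate_T, gatesMat_cons,
    gatesMat_nil, one_mul, mat_CNOT, funMat_mul_diagonal_mul_funMat _ (cnotFun_involutive h)]
  congr 1
  funext v
  simp [cnotFun]

/-- A phase flip when three bits are 1, from phases that are controlled by parities. -/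
def ccz {W : Type} (a b c : W) (hab : a ≠ b) (hac : a ≠ c) (hbc : b ≠ c) : List (QGate W) :=
  [QGate.T a, QGate.T b, QGate.T c] ++ parityPhaseTwo 7 a b hab ++ parityPhaseTwo 7 b c hbc ++
    parityPhaseTwo 7 a c hac ++
    (QGate.CNOT a c hac :: (parityPhaseTwo 1 b c hbc ++ [QGate.CNOT a c hac]))

/-- The phases multiply up to `(-1) ^ (a b c)` because, for bits,
`4 a b c = a + b + c - (a ⊕ b) - (b ⊕ c) - (a ⊕ c) + (a ⊕ b ⊕ c)`, and `omega8 ^ 7` is the inverse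
of `omega8`. -/
theorem gatesMat_ccz {W : Type} [Fintype W] [DecidableEq W] (a b c : W) (hab : a ≠ b)
    (hac : a ≠ c) (hbc : b ≠ c) : gatesMat (ccz a b c hab hac hbc) =
      Matrix.diagonal (fun v : W → Bool => sgn (v a && v b) (v c)) := by
  have h8 : omega8 ^ 8 = 1 := by
    rw [show (8 : ℕ) = 4 * 2 from rfl, pow_mul, omega8_pow_four]
    norm_num
  simp only [ccz, gatesMat_append, gatesMat_cons, gatesMat_nil, gatesMat_parityPhaseTwo, one_mul,
    mat_T, mat_CNOT]
  rw [funMat_mul_diagonal_mul_funMat _ (cnotFun_involutive hac)]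
  simp only [Matrix.diagonal_mul_diagonal]
  congr 1
  funext v
  simp only [Function.comp_apply, cnotFun, Function.update_of_ne hbc, Function.update_self]
  generalize v a = x
  generalize v b = y
  generalize v c = z
  rcases x <;> rcases y <;> rcases z <;> simp [sgn] <;>
    first
      | linear_combination h8
      | linear_combination (omega8 ^ 8 + 1) * h8
      | linear_combination (omega8 ^ 16 + omega8 ^ 8 + 1) * h8
      | linear_combination omega8_pow_four

/-- Classical reversible gates. -/
inductive CGate (W : Type) : Type
  | X (i : W) : CGate W
  | CNOT (i j : W) (h : i ≠ j) : CGate W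
  | TOF (a b c : W) (hab : a ≠ b) (hac : a ≠ c) (hbc : b ≠ c) : CGate W

namespace CGate

variable {W : Type}

/-- The action of a classical gate on bit assignments. -/
def fn [DecidableEq W] : CGate W → (W → Bool) → (W → Bool)
  | X i, v => Function.update v i (xor true (v i))
  | CNOT i j _, v => Function.update v j (xor (v i) (v j))
  | TOF a b c _ _ _, v => Function.update v c (xor (v a && v b) (v c))

/-- The implementation of a classical gate over the gate set. -/
def compile : CGate W → List (QGate W)
  | X i => QGate.H i :: (List.replicate 4 (QGate.T i) ++ [QGate.H i])
  | CNOT i j h => [QGate.CNOT i j h]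
  | TOF a b c hab hac hbc => QGate.H c :: (ccz a b c hab hac hbc ++ [QGate.H c])

theorem length_compile_le (g : CGate W) : g.compile.length ≤ 37 := by
  cases g <;> simp [compile, ccz, parityPhaseTwo]

theorem gatesMat_compile [Fintype W] [DecidableEq W] (g : CGate W) :
    gatesMat g.compile = funMat g.fn := by
  cases g with
  | X i =>
    have h := mat_H_diagonal_mat_H i (fun _ => true) (fun _ _ => rfl)
    rw [compile, gatesMat_cons, gatesMat_append, gatesMat_replicate_T, gatesMat_cons, gatesMat_nil,
      one_mul, omega8_pow_four]
    refine Eq.trans ?_ h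
    congr 3
    funext v
    simp [sgn]
  | CNOT i j h =>
    rw [compile, gatesMat_cons, gatesMat_nil, one_mul, mat_CNOT]
    rfl
  | TOF a b c hab hac hbc =>
    have h := mat_H_diagonal_mat_H c (fun v => v a && v b)
      (fun v b' => by simp [Function.update_of_ne hac, Function.update_of_ne hbc])
    rw [compile, gatesMat_cons, gatesMat_append, gatesMat_ccz, gatesMat_cons, gatesMat_nil, one_mul]
    exact h

/-- The action of a list of classical gates; the head is applied first. -/
def run [DecidableEq W] (gs : List (CGate W)) (v : W → Bool) : W → Bool :=
  gs.foldl (fun v g => g.fn v) v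

theorem run_nil [DecidableEq W] (v : W → Bool) : run [] v = v := rfl

theorem run_append [DecidableEq W] (gs hs : List (CGate W)) (v : W → Bool) :
    run (gs ++ hs) v = run hs (run gs v) := by
  simp [run]

theorem run_cons [DecidableEq W] (g : CGate W) (gs : List (CGate W)) (v : W → Bool) :
    run (g :: gs) v = run gs (g.fn v) := rfl

theorem gatesMat_flatMap_compile [Fintype W] [DecidableEq W] (gs : List (CGate W)) :
    gatesMat (gs.flatMap compile) = funMat (run gs) := by
  induction gs with
  | nil => rw [List.flatMap_nil, gatesMat_nil, ← funMat_id]; rfl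
  | cons g gs ih =>
    rw [List.flatMap_cons, gatesMat_append, ih, gatesMat_compile, funMat_mul]
    rfl

theorem length_flatMap_compile_le (gs : List (CGate W)) :
    (gs.flatMap compile).length ≤ 37 * gs.length := by
  induction gs with
  | nil => simp
  | cons g gs ih =>
    rw [List.flatMap_cons, List.length_append, List.length_cons]
    have := g.length_compile_le
    omega

end CGate

/-- A generalized circuit made of classical gates. -/
def classicalCircuit {I O W : Type} [Fintype W] [DecidableEq W] (inp : I ↪ W)
    (gs : List (CGate W)) (out : O ↪ W) : QCircuit I O where
  W := W
  inp := inp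
  gates := gs.flatMap CGate.compile
  out := out

theorem size_classicalCircuit_le {I O W : Type} [Fintype W] [DecidableEq W] (inp : I ↪ W)
    (gs : List (CGate W)) (out : O ↪ W) :
    (classicalCircuit inp gs out).size ≤ 37 * gs.length + 2 * Fintype.card W := by
  have := CGate.length_flatMap_compile_le gs
  change (gs.flatMap CGate.compile).length + Fintype.card W + Fintype.card W ≤ _
  omega

theorem conj_funMat_apply {A W : Type} [Fintype A] [DecidableEq A]
    (f : (A → Bool) → (W → Bool)) (ρ : QOp A) (w w' : W → Bool) :
    (funMat f * ρ * (funMat f).conjTranspose) w w' =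
      ∑ v, ∑ v', ind (w = f v) * (ind (w' = f v') * ρ v v') := by
  rw [conj_apply]
  simp only [funMat_apply, star_ind]
  exact Finset.sum_congr rfl fun u _ => Finset.sum_congr rfl fun u' _ => by ring

/-- The channel of a classical circuit: coherences survive between inputs on which the qubits that
are traced out agree. -/
theorem channel_classicalCircuit {I O W : Type} [Fintype I] [DecidableEq I] [Fintype W]
    [DecidableEq W] (inp : I ↪ W) (gs : List (CGate W)) (out : O ↪ W) (F : (I → Bool) → (W → Bool))
    (hF : ∀ v, CGate.run gs (Function.extend inp v fun _ => false) = F v) (ρ : QOp I)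
    (y y' : O → Bool) :
    (classicalCircuit inp gs out).channel ρ y y' = ∑ v, ∑ v',
      ind (F v ∘ out = y) * (ind (F v' ∘ out = y') * (ind (EqOff out (F v) (F v')) * ρ v v')) := by
  have hF' : CGate.run gs ∘ (fun v => Function.extend inp v fun _ => false) = F := funext hF
  have h : (classicalCircuit inp gs out).channel ρ =
      traceOut out (funMat F * ρ * (funMat F).conjTranspose) := by
    refine Eq.trans (b := traceOut out (gatesMat (gs.flatMap CGate.compile) *
      (adjoinZeros inp * ρ * (adjoinZeros inp).conjTranspose) *
        (gatesMat (gs.flatMap CGate.compile)).conjTranspose)) rfl ?_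
    rw [CGate.gatesMat_flatMap_compile, adjoinZeros_eq_funMat, ← hF', ← funMat_mul]
    simp only [Matrix.conjTranspose_mul, Matrix.mul_assoc]
  rw [h, traceOut_apply]
  simp only [conj_funMat_apply, Finset.mul_sum]
  rw [sum_comm_four]
  refine Finset.sum_congr rfl fun v _ => Finset.sum_congr rfl fun v' _ => ?_
  have : ∀ w w' : W → Bool, ind (w ∘ out = y) * (ind (w' ∘ out = y') * (ind (EqOff out w w') *
      (ind (w = F v) * (ind (w' = F v') * ρ v v')))) =
      ind (w = F v) * (ind (w' = F v') * (ind (w ∘ out = y) * (ind (w' ∘ out = y') *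
        (ind (EqOff out w w') * ρ v v')))) := fun _ _ => by ring
  simp only [this, ← Finset.mul_sum, sum_ind_eq]

/-! ### Product states and partial traces -/

theorem basisState_apply {Q : Type} [Fintype Q] (v w w' : Q → Bool) :
    basisState v w w' = ind (w = v) * ind (w' = v) := by
  classical
  rw [← ind_and]
  simp only [basisState, Matrix.single, Matrix.of_apply, ind, eq_comm (a := v)]
  congr!

theorem tensorState_basisState {Q R : Type} [Fintype Q] [Fintype R] (v : Q → Bool) (w : R → Bool) :
    tensorState (basisState v) (basisState w) = basisState (Sum.elim v w) := by
  ext u u'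
  have h : ∀ u : Q ⊕ R → Bool, u = Sum.elim v w ↔
      (fun i => u (Sum.inl i)) = v ∧ (fun i => u (Sum.inr i)) = w := fun u => eq_sum_iff u _
  simp only [tensorState, Matrix.of_apply, basisState_apply, h, ind_and]
  ring

theorem tensorFamily_basisState {S Q : Type} [Fintype S] [Fintype Q] (v : S → Q → Bool) :
    tensorFamily (fun r => basisState (v r)) = basisState (fun p : S × Q => v p.1 p.2) := by
  ext u u'
  have h : ∀ u : S × Q → Bool, u = (fun p => v p.1 p.2) ↔ ∀ r, (fun i => u (r, i)) = v r := by
    intro u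
    simp [funext_iff]
  simp only [tensorFamily, Matrix.of_apply, basisState_apply, h, ind_forall,
    Finset.prod_mul_distrib]

theorem channel_classicalCircuit_basisState {I O W : Type} [Fintype I] [DecidableEq I] [Fintype O]
    [Fintype W] [DecidableEq W] (inp : I ↪ W) (gs : List (CGate W)) (out : O ↪ W) (v : I → Bool) :
    (classicalCircuit inp gs out).channel (basisState v) =
      basisState (CGate.run gs (Function.extend inp v fun _ => false) ∘ out) := by
  ext y y'
  rw [channel_classicalCircuit inp gs out _ (fun _ => rfl)]
  simp only [basisState_apply]
  set F := fun v => CGate.run gs (Function.extend inp v fun _ => false)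
  have : ∀ u u' : I → Bool, ind (F u ∘ out = y) * (ind (F u' ∘ out = y') *
      (ind (EqOff out (F u) (F u')) * (ind (u = v) * ind (u' = v)))) =
      ind (u = v) * (ind (u' = v) * (ind (F u ∘ out = y) * (ind (F u' ∘ out = y') *
        ind (EqOff out (F u) (F u'))))) := fun _ _ => by ring
  simp only [F] at this
  simp only [this, ← Finset.mul_sum, sum_ind_eq]
  rw [show ind (EqOff out (F v) (F v)) = 1 from ind_pos fun _ _ => rfl, mul_one,
    ind_congr eq_comm, ind_congr (eq_comm (b := y'))]

/-- The circuit which in addition traces out the output qubits outside the range of `f`. -/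
def QCircuit.restrictOut {I O O' : Type} (c : QCircuit I O) (f : O' ↪ O) : QCircuit I O' where
  W := c.W
  inp := c.inp
  gates := c.gates
  out := f.trans c.out

theorem QCircuit.channel_restrictOut {I O O' : Type} [Fintype I] [DecidableEq I] [Fintype O]
    [DecidableEq O] (c : QCircuit I O) (f : O' ↪ O) (ρ : QOp I) :
    (c.restrictOut f).channel ρ = traceOut f (c.channel ρ) :=
  traceOut_trans f c.out _

theorem traceOut_inl_tensorState {A B : Type} [Fintype A] [DecidableEq A] [Fintype B]
    [DecidableEq B] (σ : QOp A) (τ : QOp B) :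
    traceOut (Function.Embedding.inl : A ↪ A ⊕ B) (tensorState σ τ) = τ.trace • σ := by
  ext y y'
  simp only [traceOut_apply, sum_sumArrow, tensorState, Matrix.of_apply, Sum.elim_inl, Sum.elim_inr]
  have h : ∀ (a a' : A → Bool) (b b' : B → Bool),
      EqOff (Function.Embedding.inl : A ↪ A ⊕ B) (Sum.elim a b) (Sum.elim a' b') ↔ b' = b := by
    intro a a' b b'
    simp [EqOff, funext_iff, eq_comm]
  have h' : ∀ (a : A → Bool) (b : B → Bool), Sum.elim a b ∘ (Function.Embedding.inl : A ↪ A ⊕ B) =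
      a := fun _ _ => rfl
  simp only [h, h', ← Finset.mul_sum, sum_ind_eq]
  exact mul_comm _ _

theorem trace_basisState {Q : Type} [Fintype Q] [DecidableEq Q] (v : Q → Bool) :
    (basisState v).trace = 1 := by
  simp only [Matrix.trace, Matrix.diag_apply, basisState_apply, sum_ind_eq]
  exact ind_pos trivial

/-! ### Loops of classical gates -/

/-- Loop rule with a counter: `st i` is the state before round `i`. -/
theorem CGate.run_flatMap_finRange {W : Type} [DecidableEq W] {d : ℕ}
    (body : Fin d → List (CGate W)) (st : ℕ → W → Bool)
    (h : ∀ i : Fin d, CGate.run (body i) (st i) = st (i + 1)) :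
    CGate.run ((List.finRange d).flatMap body) (st 0) = st d := by
  induction d with
  | zero => rfl
  | succ d ih =>
    rw [List.finRange_succ_last, List.flatMap_append, List.flatMap_map, CGate.run_append,
      ih (fun i => body i.castSucc) (fun i => h i.castSucc)]
    simpa using h (Fin.last d)

/-- Loop rule for rounds in any order: `st A` is the state after the rounds in `A`. -/
theorem CGate.run_flatMap_toList {W S : Type} [DecidableEq W] [DecidableEq S]
    (body : S → List (CGate W)) (st : Finset S → W → Bool)
    (h : ∀ A a, a ∉ A → CGate.run (body a) (st A) = st (insert a A)) (L : List S) (hL : L.Nodup)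
    (A : Finset S) (hA : ∀ a ∈ L, a ∉ A) :
    CGate.run (L.flatMap body) (st A) = st (A ∪ L.toFinset) := by
  induction L generalizing A with
  | nil => simp [CGate.run_nil]
  | cons a L ih =>
    rw [List.nodup_cons] at hL
    rw [List.flatMap_cons, CGate.run_append, h A a (hA a (by simp)), ih hL.2]
    · congr 1
      ext b
      simp
    · intro b hb
      rw [Finset.mem_insert, not_or]
      exact ⟨fun e => hL.1 (e ▸ hb), hA b (by simp [hb])⟩

theorem CGate.run_flatMap_univ {W S : Type} [DecidableEq W] [DecidableEq S] [Fintype S]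
    (body : S → List (CGate W)) (st : Finset S → W → Bool)
    (h : ∀ A a, a ∉ A → CGate.run (body a) (st A) = st (insert a A)) :
    CGate.run (Finset.univ.toList.flatMap body) (st ∅) = st Finset.univ := by
  rw [CGate.run_flatMap_toList body st h _ (Finset.nodup_toList _) _ (by simp)]
  simp

/-! ### Distributing the key -/

section Distribute

variable (q l d : ℕ)

/-- Where the output qubits of `distribute` are: the copies of the key are new, the input stays. -/
def distributeOut : (Fin q × Fin l) ⊕ Fin d ↪ (Fin l ⊕ Fin d) ⊕ (Fin q × Fin l) where
  toFun := Sum.elim Sum.inr (fun x => Sum.inl (Sum.inr x))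
  inj' := by
    rintro (a | a) (b | b) h <;> simp_all

/-- The circuit which makes `q` copies of a classical key of `l` bits and keeps `d` other bits. -/
def distribute : QCircuit (Fin l ⊕ Fin d) ((Fin q × Fin l) ⊕ Fin d) :=
  classicalCircuit (W := (Fin l ⊕ Fin d) ⊕ (Fin q × Fin l)) Function.Embedding.inl
    (Finset.univ.toList.flatMap fun p : Fin q × Fin l =>
      [CGate.CNOT (Sum.inl (Sum.inl p.2)) (Sum.inr p) Sum.inl_ne_inr]) (distributeOut q l d)

theorem channel_distribute (k : Fin l → Bool) (x : Fin d → Bool) :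
    (distribute q l d).channel (basisState (Sum.elim k x)) =
      tensorState (tensorFamily fun _ : Fin q => basisState k) (basisState x) := by
  have h := CGate.run_flatMap_univ (W := (Fin l ⊕ Fin d) ⊕ (Fin q × Fin l))
    (fun p : Fin q × Fin l => [CGate.CNOT (Sum.inl (Sum.inl p.2)) (Sum.inr p) Sum.inl_ne_inr])
    (fun A => Sum.elim (Sum.elim k x) (fun p => if p ∈ A then k p.2 else false)) (by
      intro A a ha
      simp only [CGate.run_cons, CGate.run_nil, CGate.fn]
      funext w
      rcases w with w | p
      · simp
      · by_cases hp : p = a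
        · subst hp
          simp [ha]
        · simp [hp])
  have h0 : Function.extend (Function.Embedding.inl : Fin l ⊕ Fin d ↪ (Fin l ⊕ Fin d) ⊕ (Fin q × Fin l))
      (Sum.elim k x) (fun _ => false) =
      Sum.elim (Sum.elim k x) (fun p => if p ∈ (∅ : Finset (Fin q × Fin l)) then k p.2 else false) := by
    rw [eq_comm, eq_extend_iff]
    refine ⟨rfl, ?_⟩
    rintro (w | p) hj
    · exact absurd rfl (hj w)
    · simp
  rw [distribute, channel_classicalCircuit_basisState, tensorFamily_basisState,
    tensorState_basisState, h0, h]
  congr 1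
  funext w
  simp only [Finset.mem_univ, if_true]
  rcases w with p | i <;> rfl

theorem size_distribute_le : (distribute q l d).size ≤ 39 * (q * l) + 2 * (l + d) := by
  refine (size_classicalCircuit_le _ _ _).trans ?_
  simp
  omega

end Distribute

/-! ### One round of the post-selection -/

section Round

variable (d n : ℕ)

/-- The register of one round: the fresh output (flag and suffix, then prefix), the output register
with the sought prefix, and ancillas. -/
abbrev RoundReg : Type :=
  ((Option (Fin n) ⊕ Fin d) ⊕ (Option (Fin n) ⊕ Fin d)) ⊕ Fin (d + 1)

variable {d n}

/-- The fresh output has not aborted and its first `i` bits are the sought ones. -/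
def prefixGood (v : (Option (Fin n) ⊕ Fin d) ⊕ (Option (Fin n) ⊕ Fin d) → Bool) (i : ℕ) : Bool :=
  decide (v (Sum.inl (Sum.inl none)) = false ∧
    ∀ j : Fin d, (j : ℕ) < i → v (Sum.inl (Sum.inr j)) = v (Sum.inr (Sum.inr j)))

/-- The state of the register after `i` prefix bits have been compared and the outputs in `A` have
been exchanged under the control of the last ancilla. -/
def roundState (v : (Option (Fin n) ⊕ Fin d) ⊕ (Option (Fin n) ⊕ Fin d) → Bool) (i : ℕ)
    (A : Finset (Option (Fin n))) : RoundReg d n → Bool :=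
  Sum.elim (Sum.elim
    (Sum.elim (fun o => if o ∈ A ∧ prefixGood v d then v (Sum.inr (Sum.inl o)) else
        v (Sum.inl (Sum.inl o)))
      (fun j => if (j : ℕ) < i then (v (Sum.inl (Sum.inr j)) == v (Sum.inr (Sum.inr j))) else
        v (Sum.inl (Sum.inr j))))
    (Sum.elim (fun o => if o ∈ A ∧ prefixGood v d then v (Sum.inl (Sum.inl o)) else
        v (Sum.inr (Sum.inl o)))
      (fun j => v (Sum.inr (Sum.inr j)))))
    (fun s => if (s : ℕ) ≤ i then prefixGood v s else false)

variable (d n)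

/-- The comparison of one prefix bit. -/
def compareGates (j : Fin d) : List (CGate (RoundReg d n)) :=
  [CGate.CNOT (Sum.inl (Sum.inr (Sum.inr j))) (Sum.inl (Sum.inl (Sum.inr j))) (by simp),
    CGate.X (Sum.inl (Sum.inl (Sum.inr j))),
    CGate.TOF (Sum.inr j.castSucc) (Sum.inl (Sum.inl (Sum.inr j))) (Sum.inr j.succ) (by simp)
      (by simp [Fin.ext_iff]) (by simp)]

/-- The exchange of two qubits under the control of the last ancilla. -/
def exchangeGates (o : Option (Fin n)) : List (CGate (RoundReg d n)) :=
  [CGate.CNOT (Sum.inl (Sum.inr (Sum.inl o))) (Sum.inl (Sum.inl (Sum.inl o))) (by simp),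
    CGate.TOF (Sum.inr (Fin.last d)) (Sum.inl (Sum.inl (Sum.inl o))) (Sum.inl (Sum.inr (Sum.inl o)))
      (by simp) (by simp) (by simp),
    CGate.CNOT (Sum.inl (Sum.inr (Sum.inl o))) (Sum.inl (Sum.inl (Sum.inl o))) (by simp)]

/-- The gates of one round: test the flag, compare the prefix, exchange the outputs. -/
def roundGates : List (CGate (RoundReg d n)) :=
  [CGate.X (Sum.inr 0), CGate.CNOT (Sum.inl (Sum.inl (Sum.inl none))) (Sum.inr 0) (by simp)] ++
    (List.finRange d).flatMap (compareGates d n) ++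
    Finset.univ.toList.flatMap (exchangeGates d n)

theorem length_roundGates : (roundGates d n).length = 3 * d + 3 * n + 5 := by
  simp [roundGates, compareGates, exchangeGates, List.length_flatMap]
  ring

/-- One round: if the fresh output has the sought prefix, it replaces the output register. -/
def selectRound : QCircuit ((Option (Fin n) ⊕ Fin d) ⊕ (Option (Fin n) ⊕ Fin d))
    (Option (Fin n) ⊕ Fin d) :=
  classicalCircuit (W := RoundReg d n) Function.Embedding.inl (roundGates d n)
    (Function.Embedding.inr.trans Function.Embedding.inl)

theorem size_selectRound_le : (selectRound d n).size ≤ 120 * (d + n + 2) := by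
  refine (size_classicalCircuit_le _ _ _).trans ?_
  rw [length_roundGates]
  simp
  omega

variable {d n}

section RoundStateApply

variable (v : (Option (Fin n) ⊕ Fin d) ⊕ (Option (Fin n) ⊕ Fin d) → Bool) (i : ℕ)
  (A : Finset (Option (Fin n)))

theorem roundState_fresh (o : Option (Fin n)) : roundState v i A (Sum.inl (Sum.inl (Sum.inl o))) =
    if o ∈ A ∧ prefixGood v d then v (Sum.inr (Sum.inl o)) else v (Sum.inl (Sum.inl o)) := rfl

theorem roundState_prefix (j : Fin d) : roundState v i A (Sum.inl (Sum.inl (Sum.inr j))) =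
    if (j : ℕ) < i then (v (Sum.inl (Sum.inr j)) == v (Sum.inr (Sum.inr j))) else
      v (Sum.inl (Sum.inr j)) := rfl

theorem roundState_output (o : Option (Fin n)) : roundState v i A (Sum.inl (Sum.inr (Sum.inl o))) =
    if o ∈ A ∧ prefixGood v d then v (Sum.inl (Sum.inl o)) else v (Sum.inr (Sum.inl o)) := rfl

theorem roundState_sought (j : Fin d) : roundState v i A (Sum.inl (Sum.inr (Sum.inr j))) =
    v (Sum.inr (Sum.inr j)) := rfl

theorem roundState_ancilla (a : Fin (d + 1)) : roundState v i A (Sum.inr a) =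
    if (a : ℕ) ≤ i then prefixGood v a else false := rfl

end RoundStateApply

theorem run_roundGates (v : (Option (Fin n) ⊕ Fin d) ⊕ (Option (Fin n) ⊕ Fin d) → Bool) :
    CGate.run (roundGates d n) (Function.extend (Function.Embedding.inl :
      (Option (Fin n) ⊕ Fin d) ⊕ (Option (Fin n) ⊕ Fin d) ↪ RoundReg d n) v fun _ => false) =
      roundState v d Finset.univ := by
  have h0 : CGate.run [CGate.X (Sum.inr 0),
      CGate.CNOT (Sum.inl (Sum.inl (Sum.inl none))) (Sum.inr 0) (by simp)]
      (Function.extend (Function.Embedding.inl :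
      (Option (Fin n) ⊕ Fin d) ⊕ (Option (Fin n) ⊕ Fin d) ↪ RoundReg d n) v fun _ => false) =
      roundState v 0 ∅ := by
    have : Function.extend (Function.Embedding.inl :
      (Option (Fin n) ⊕ Fin d) ⊕ (Option (Fin n) ⊕ Fin d) ↪ RoundReg d n) v (fun _ => false) =
      Sum.elim v (fun _ => false) := by
      rw [eq_comm, eq_extend_iff]
      refine ⟨rfl, ?_⟩
      rintro (w | p) hj
      · exact absurd rfl (hj w)
      · rfl
    rw [this]
    simp only [CGate.run_cons, CGate.run_nil, CGate.fn]
    funext w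
    simp only [Function.update_apply]
    rcases w with ((w | w) | (w | w)) | s
    · simp [roundState_fresh]
    · simp [roundState_prefix]
    · simp [roundState_output]
    · simp [roundState_sought]
    · by_cases hs : s = 0
      · subst hs
        simp [roundState_ancilla, prefixGood]
      · have : (s : ℕ) ≠ 0 := fun h => hs (Fin.ext h)
        simp [roundState_ancilla, hs]
  have h1 := CGate.run_flatMap_finRange (compareGates d n) (fun i => roundState v i ∅) (by
    intro i
    simp only [compareGates, CGate.run_cons, CGate.run_nil, CGate.fn]
    funext w
    rcases w with ((w | w) | (w | w)) | s
    · simp [roundState_fresh, roundState_prefix, roundState_sought, roundState_ancilla]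
    · by_cases hw : w = i
      · subst hw
        simp [roundState_prefix, roundState_sought, roundState_ancilla]
        rcases v (Sum.inl (Sum.inr w)) <;> rcases v (Sum.inr (Sum.inr w)) <;> rfl
      · have : (w : ℕ) ≠ i := fun h => hw (Fin.ext h)
        have h' : (w : ℕ) < i + 1 ↔ (w : ℕ) < i := by omega
        simp [roundState_prefix, roundState_sought, roundState_ancilla, hw, h']
    · simp [roundState_prefix, roundState_output, roundState_sought, roundState_ancilla]
    · simp [roundState_prefix, roundState_sought, roundState_ancilla]
    · by_cases hs : s = i.succ
      · subst hs
        have e : prefixGood v (i + 1) = (prefixGood v i &&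
            (v (Sum.inl (Sum.inr i)) == v (Sum.inr (Sum.inr i)))) := by
          rw [Bool.eq_iff_iff]
          simp only [prefixGood, decide_eq_true_eq, Bool.and_eq_true, beq_iff_eq]
          constructor
          · rintro ⟨h1, h2⟩
            exact ⟨⟨h1, fun j hj => h2 j (by omega)⟩, h2 i (by omega)⟩
          · rintro ⟨⟨h1, h2⟩, h3⟩
            refine ⟨h1, fun j hj => ?_⟩
            by_cases hji : j = i
            · rw [hji, h3]
            · exact h2 j (by have : (j : ℕ) ≠ i := fun h => hji (Fin.ext h)
                             omega)
        simp [roundState_prefix, roundState_sought, roundState_ancilla, e]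
        rcases v (Sum.inl (Sum.inr i)) <;> rcases v (Sum.inr (Sum.inr i)) <;> simp
      · have : (s : ℕ) ≠ i + 1 := fun h => hs (Fin.ext h)
        have h' : (s : ℕ) ≤ i + 1 ↔ (s : ℕ) ≤ i := by omega
        simp [roundState_prefix, roundState_sought, roundState_ancilla, hs, h'])
  have h2 := CGate.run_flatMap_univ (exchangeGates d n) (fun A => roundState v d A) (by
    intro A o ho
    simp only [exchangeGates, CGate.run_cons, CGate.run_nil, CGate.fn]
    funext w
    rcases w with ((w | w) | (w | w)) | s
    · by_cases hw : w = o
      · subst hw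
        cases hg : prefixGood v d <;>
          simp [roundState_fresh, roundState_output, roundState_ancilla, ho, hg]
      · simp [roundState_fresh, roundState_output, roundState_ancilla, hw]
    · simp [roundState_fresh, roundState_prefix, roundState_output, roundState_ancilla]
    · by_cases hw : w = o
      · subst hw
        cases hg : prefixGood v d <;>
          simp [roundState_fresh, roundState_output, roundState_ancilla, ho, hg]
        rcases v (Sum.inl (Sum.inl w)) <;> rcases v (Sum.inr (Sum.inl w)) <;> rfl
      · simp [roundState_fresh, roundState_output, roundState_ancilla, hw]
    · simp [roundState_fresh, roundState_output, roundState_sought, roundState_ancilla]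
    · simp [roundState_fresh, roundState_output, roundState_ancilla])
  rw [roundGates, CGate.run_append, CGate.run_append, h0, h1, h2]

/-- The flag of the fresh output `u` is 0 and its prefix is `x`. -/
def HasPrefix (u : Option (Fin n) ⊕ Fin d → Bool) (x : Fin d → Bool) : Prop :=
  u (Sum.inl none) = false ∧ ∀ j, u (Sum.inr j) = x j

theorem prefixGood_eq_true_iff (u : Option (Fin n) ⊕ Fin d → Bool) (o : Option (Fin n) → Bool)
    (x : Fin d → Bool) : prefixGood (Sum.elim u (Sum.elim o x)) d = true ↔ HasPrefix u x := by
  simp [prefixGood, HasPrefix]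

theorem roundState_comp_of_hasPrefix {u : Option (Fin n) ⊕ Fin d → Bool} {x : Fin d → Bool}
    (h : HasPrefix u x) (o : Option (Fin n) → Bool) :
    roundState (Sum.elim u (Sum.elim o x)) d Finset.univ ∘ (Sum.inl ∘ Sum.inr) =
      Sum.elim (u ∘ Sum.inl) x := by
  have := (prefixGood_eq_true_iff u o x).2 h
  funext w
  rcases w with w | w <;> simp [roundState, this]

theorem roundState_comp_of_not_hasPrefix {u : Option (Fin n) ⊕ Fin d → Bool} {x : Fin d → Bool}
    (h : ¬ HasPrefix u x) (o : Option (Fin n) → Bool) :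
    roundState (Sum.elim u (Sum.elim o x)) d Finset.univ ∘ (Sum.inl ∘ Sum.inr) =
      Sum.elim o x := by
  have := mt (prefixGood_eq_true_iff u o x).1 h
  funext w
  rcases w with w | w <;> simp [roundState, this]

/-- The qubits that a round traces out determine whether it succeeds, and hold the old output in
case of success and the fresh output in case of failure; so they destroy the coherence between
success and failure, and only the indicated coherences survive. -/
theorem eqOff_roundState_iff (u u' : Option (Fin n) ⊕ Fin d → Bool) (o o' : Option (Fin n) → Bool)
    (x : Fin d → Bool) :
    EqOff (Sum.inl ∘ Sum.inr : Option (Fin n) ⊕ Fin d → RoundReg d n)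
      (roundState (Sum.elim u (Sum.elim o x)) d Finset.univ)
      (roundState (Sum.elim u' (Sum.elim o' x)) d Finset.univ) ↔
      (HasPrefix u x ∧ HasPrefix u' x ∧ o = o') ∨ (¬ HasPrefix u x ∧ ¬ HasPrefix u' x ∧ u = u') := by
  have hg := prefixGood_eq_true_iff u o x
  have hg' := prefixGood_eq_true_iff u' o' x
  constructor
  · intro h
    have hs := h (Sum.inr (Fin.last d)) (by simp)
    simp [roundState] at hs
    have h1 := fun i => h (Sum.inl (Sum.inl (Sum.inl i))) (by simp)
    have h2 := fun j => h (Sum.inl (Sum.inl (Sum.inr j))) (by simp)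
    by_cases hu : HasPrefix u x
    · have hu' : HasPrefix u' x := hg'.1 (hs ▸ hg.2 hu)
      refine Or.inl ⟨hu, hu', funext fun i => ?_⟩
      have := h1 i
      simpa [roundState, hg.2 hu, hg'.2 hu'] using this
    · have hu' : ¬ HasPrefix u' x := fun hu' => hu (hg.1 (hs ▸ hg'.2 hu'))
      refine Or.inr ⟨hu, hu', funext fun i => ?_⟩
      rcases i with i | j
      · have := h1 i
        simpa [roundState, mt hg.1 hu, mt hg'.1 hu'] using this
      · have := h2 j
        simp [roundState] at this
        revert this
        cases u (Sum.inr j) <;> cases u' (Sum.inr j) <;> cases x j <;> simp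
  · rintro (⟨hu, hu', rfl⟩ | ⟨hu, hu', rfl⟩)
    · rintro (((i | j) | i) | s) hi
      · simp [roundState, hg.2 hu, hg'.2 hu']
      · simp [roundState, hu.2 j, hu'.2 j]
      · exact absurd rfl (hi i)
      · have e : ∀ w : Option (Fin n) ⊕ Fin d → Bool, HasPrefix w x →
            prefixGood (Sum.elim w (Sum.elim o x)) s = true := by
          intro w hw
          simp only [prefixGood, decide_eq_true_eq]
          exact ⟨hw.1, fun j _ => hw.2 j⟩
        simp [roundState, e u hu, e u' hu']
    · rintro (((i | j) | i) | s) hi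
      · simp [roundState, mt hg.1 hu, mt hg'.1 hu]
      · simp [roundState]
      · exact absurd rfl (hi i)
      · have e : prefixGood (Sum.elim u (Sum.elim o x)) s =
            prefixGood (Sum.elim u (Sum.elim o' x)) s := by
          rw [Bool.eq_iff_iff]
          simp only [prefixGood, decide_eq_true_eq]
          exact Iff.rfl
        simp [roundState, e]

open Classical in
/-- The part of an operator on a fresh output where the flag is 0 and the prefix is `x`. -/
def successBlock (ρ : QOp (Option (Fin n) ⊕ Fin d)) (x : Fin d → Bool) : QOp (Option (Fin n)) :=
  Matrix.of fun v w => if v none = true ∨ w none = true then 0 else ρ (Sum.elim v x) (Sum.elim w x)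

theorem successBlock_apply (ρ : QOp (Option (Fin n) ⊕ Fin d)) (x : Fin d → Bool)
    (v w : Option (Fin n) → Bool) : successBlock ρ x v w =
      ind (HasPrefix (Sum.elim v x) x) * (ind (HasPrefix (Sum.elim w x) x) *
        ρ (Sum.elim v x) (Sum.elim w x)) := by
  have h : ∀ v : Option (Fin n) → Bool, HasPrefix (Sum.elim v x) x ↔ v none = false := by
    intro v
    simp [HasPrefix]
  simp only [successBlock, Matrix.of_apply, h]
  cases v none <;> cases w none <;> simp [ind]

theorem hasPrefix_and_iff (u : Option (Fin n) ⊕ Fin d → Bool) (x : Fin d → Bool)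
    (y : Option (Fin n) → Bool) :
    HasPrefix u x ∧ u ∘ Sum.inl = y ↔ u = Sum.elim y x ∧ HasPrefix (Sum.elim y x) x := by
  constructor
  · rintro ⟨h, rfl⟩
    have : u = Sum.elim (u ∘ Sum.inl) x := by
      funext w
      rcases w with w | w
      · rfl
      · exact h.2 w
    exact ⟨this, this ▸ h⟩
  · rintro ⟨rfl, h⟩
    exact ⟨h, rfl⟩

theorem sum_hasPrefix (ρ : QOp (Option (Fin n) ⊕ Fin d)) (x : Fin d → Bool) :
    ∑ u, ind (HasPrefix u x) * ρ u u = (successBlock ρ x).trace := by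
  rw [sum_sumArrow]
  simp only [Matrix.trace, Matrix.diag_apply]
  refine Finset.sum_congr rfl fun v _ => ?_
  have h : ∀ b : Fin d → Bool, HasPrefix (Sum.elim v b) x ↔ b = x ∧ HasPrefix (Sum.elim v x) x := by
    intro b
    simp only [HasPrefix, Sum.elim_inl, Sum.elim_inr, funext_iff]
    tauto
  have h' : ∀ b : Fin d → Bool, ind (HasPrefix (Sum.elim v b) x) * ρ (Sum.elim v b) (Sum.elim v b) =
      ind (b = x) * (ind (HasPrefix (Sum.elim v x) x) * ρ (Sum.elim v b) (Sum.elim v b)) := by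
    intro b
    rw [ind_congr (h b), ind_and, mul_assoc]
  rw [Finset.sum_congr rfl fun b _ => h' b, sum_ind_eq, successBlock_apply, ← mul_assoc, ← ind_and,
    and_self]

/-- One round on a fresh output `ρ` and an old output `τ`: the new output is the success block of
`ρ`, and `τ` in case of failure. -/
theorem channel_selectRound (ρ : QOp (Option (Fin n) ⊕ Fin d)) (τ : QOp (Option (Fin n)))
    (x : Fin d → Bool) :
    (selectRound d n).channel (tensorState ρ (tensorState τ (basisState x))) =
      tensorState (τ.trace • successBlock ρ x + (ρ.trace - (successBlock ρ x).trace) • τ)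
        (basisState x) := by
  ext y y'
  rw [selectRound, channel_classicalCircuit _ _ _ _ run_roundGates]
  have hout : ⇑((Function.Embedding.inr.trans Function.Embedding.inl :
    Option (Fin n) ⊕ Fin d ↪ RoundReg d n)) = Sum.inl ∘ Sum.inr := rfl
  set yo := y ∘ Sum.inl with hyo
  set yo' := y' ∘ Sum.inl with hyo'
  set yx := y ∘ Sum.inr with hyx
  set yx' := y' ∘ Sum.inr with hyx'
  -- `G` is the contribution of one pair of basis states: both succeed, or both fail.
  let G : (Option (Fin n) ⊕ Fin d → Bool) → (Option (Fin n) → Bool) →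
      (Option (Fin n) ⊕ Fin d → Bool) → (Option (Fin n) → Bool) → ℂ := fun u o u' o' =>
    ind (yx = x) * ind (yx' = x) *
      (ind (u = Sum.elim yo x) * (ind (u' = Sum.elim yo' x) * (ind (o = o') *
        (ind (HasPrefix (Sum.elim yo x) x) * (ind (HasPrefix (Sum.elim yo' x) x) *
          (ρ u u' * τ o o'))))) +
      ind (o = yo) * (ind (o' = yo') * (ind (u = u') * ((1 - ind (HasPrefix u x)) *
          (ρ u u' * τ o o')))))
  have hG : ∀ u o u' o',
      ind (roundState (Sum.elim u (Sum.elim o x)) d Finset.univ ∘ (Sum.inl ∘ Sum.inr) = y) *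
      (ind (roundState (Sum.elim u' (Sum.elim o' x)) d Finset.univ ∘ (Sum.inl ∘ Sum.inr) = y') *
      (ind (EqOff (Sum.inl ∘ Sum.inr : Option (Fin n) ⊕ Fin d → RoundReg d n)
      (roundState (Sum.elim u (Sum.elim o x)) d Finset.univ)
      (roundState (Sum.elim u' (Sum.elim o' x)) d Finset.univ)) * (ρ u u' * τ o o'))) =
      G u o u' o' := by
    intro u o u' o'
    have hel : ∀ (a : Option (Fin n) → Bool) (z : Option (Fin n) ⊕ Fin d → Bool),
        Sum.elim a x = z ↔ a = z ∘ Sum.inl ∧ z ∘ Sum.inr = x := by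
      intro a z
      rw [eq_sum_iff, Sum.elim_comp_inl, Sum.elim_comp_inr, eq_comm (a := x)]
    by_cases hu : HasPrefix u x <;> by_cases hu' : HasPrefix u' x
    · have e1 := hasPrefix_and_iff u x yo
      have e2 := hasPrefix_and_iff u' x yo'
      simp only [hu, hu', true_and] at e1 e2
      rw [roundState_comp_of_hasPrefix hu, roundState_comp_of_hasPrefix hu',
        ind_congr (eqOff_roundState_iff u u' o o' x)]
      simp only [hel, hu, hu', true_and, not_true, false_and, or_false, ← hyo, ← hyo', e1, e2, ind_and, G,
        ind_pos trivial]
      ring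
    · rw [ind_neg (P := EqOff _ _ _) (by rw [eqOff_roundState_iff]; tauto)]
      have e2 := hasPrefix_and_iff u' x yo'
      simp only [hu', false_and, false_iff] at e2
      have e3 : ind (u' = Sum.elim yo' x) * ind (HasPrefix (Sum.elim yo' x) x) = 0 := by
        rw [← ind_and, ind_neg e2]
      have e4 : u ≠ u' := by rintro rfl; exact hu' hu
      simp only [G, ind_neg e4]
      linear_combination (-ind (yx = x) * ind (yx' = x) * (ind (u = Sum.elim yo x) * (ind (o = o') *
        (ind (HasPrefix (Sum.elim yo x) x) * (ρ u u' * τ o o'))))) * e3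
    · rw [ind_neg (P := EqOff _ _ _) (by rw [eqOff_roundState_iff]; tauto)]
      have e2 := hasPrefix_and_iff u x yo
      simp only [hu, false_and, false_iff] at e2
      have e3 : ind (u = Sum.elim yo x) * ind (HasPrefix (Sum.elim yo x) x) = 0 := by
        rw [← ind_and, ind_neg e2]
      have e4 : u ≠ u' := by rintro rfl; exact hu hu'
      simp only [G, ind_neg e4]
      linear_combination (-ind (yx = x) * ind (yx' = x) * (ind (u' = Sum.elim yo' x) * (ind (o = o') *
        (ind (HasPrefix (Sum.elim yo' x) x) * (ρ u u' * τ o o'))))) * e3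
    · rw [roundState_comp_of_not_hasPrefix hu, roundState_comp_of_not_hasPrefix hu',
        ind_congr (eqOff_roundState_iff u u' o o' x)]
      have e2 := hasPrefix_and_iff u x yo
      simp only [hu, false_and, false_iff] at e2
      have e3 : ind (u = Sum.elim yo x) * ind (HasPrefix (Sum.elim yo x) x) = 0 := by
        rw [← ind_and, ind_neg e2]
      simp only [hel, hu, hu', false_and, not_false_eq_true, true_and, false_or, ← hyo, ← hyo',
        ind_and, G, ind_neg not_false]
      linear_combination (-ind (yx = x) * ind (yx' = x) * (ind (u' = Sum.elim yo' x) * (ind (o = o') *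
        (ind (HasPrefix (Sum.elim yo' x) x) * (ρ u u' * τ o o'))))) * e3
  have hexp : ∀ (u u' : Option (Fin n) ⊕ Fin d → Bool) (o o' : Option (Fin n) → Bool)
      (ξ ξ' : Fin d → Bool), tensorState ρ (tensorState τ (basisState x))
        (Sum.elim u (Sum.elim o ξ)) (Sum.elim u' (Sum.elim o' ξ')) =
        ρ u u' * (τ o o' * (ind (ξ = x) * ind (ξ' = x))) := by
    intro u u' o o' ξ ξ'
    rw [← basisState_apply]
    rfl
  have hsum : ∀ F : ((Option (Fin n) ⊕ Fin d) ⊕ (Option (Fin n) ⊕ Fin d) → Bool) → ℂ,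
      ∑ v, F v = ∑ u, ∑ o, ∑ ξ, F (Sum.elim u (Sum.elim o ξ)) := by
    intro F
    rw [sum_sumArrow]
    exact Finset.sum_congr rfl fun u _ => sum_sumArrow _
  have hterm : ∀ (u u' : Option (Fin n) ⊕ Fin d → Bool) (o o' : Option (Fin n) → Bool)
      (ξ ξ' : Fin d → Bool),
      ind (roundState (Sum.elim u (Sum.elim o ξ)) d Finset.univ ∘ (Sum.inl ∘ Sum.inr) = y) *
      (ind (roundState (Sum.elim u' (Sum.elim o' ξ')) d Finset.univ ∘ (Sum.inl ∘ Sum.inr) = y') *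
      (ind (EqOff (Sum.inl ∘ Sum.inr : Option (Fin n) ⊕ Fin d → RoundReg d n)
      (roundState (Sum.elim u (Sum.elim o ξ)) d Finset.univ)
      (roundState (Sum.elim u' (Sum.elim o' ξ')) d Finset.univ)) *
        (ρ u u' * (τ o o' * (ind (ξ = x) * ind (ξ' = x)))))) =
      ind (ξ' = x) * (ind (ξ = x) * G u o u' o') := by
    intro u u' o o' ξ ξ'
    by_cases h : ξ = x
    · by_cases h' : ξ' = x
      · subst h'
        subst h
        rw [← hG, ind_pos rfl]
        ring
      · rw [ind_neg h']
        ring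
    · rw [ind_neg h]
      ring
  refine Eq.trans (b := ∑ u, ∑ o, ∑ ξ, ∑ u', ∑ o', ∑ ξ', ind (ξ' = x) * (ind (ξ = x) * G u o u' o'))
    ?_ ?_
  · rw [hsum]
    refine Finset.sum_congr rfl fun u _ => Finset.sum_congr rfl fun o _ =>
      Finset.sum_congr rfl fun ξ _ => ?_
    rw [hsum]
    refine Finset.sum_congr rfl fun u' _ => Finset.sum_congr rfl fun o' _ =>
      Finset.sum_congr rfl fun ξ' _ => ?_
    rw [hexp]
    exact hterm u u' o o' ξ ξ'
  simp only [sum_ind_eq, ← Finset.mul_sum]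
  have hA : (∑ u, ∑ o, ∑ u', ∑ o', ind (u = Sum.elim yo x) * (ind (u' = Sum.elim yo' x) *
      (ind (o = o') * (ind (HasPrefix (Sum.elim yo x) x) * (ind (HasPrefix (Sum.elim yo' x) x) *
          (ρ u u' * τ o o')))))) = τ.trace * successBlock ρ x yo yo' := by
    simp only [← Finset.mul_sum, sum_ind_eq, sum_ind_eq', successBlock_apply, Matrix.trace,
      Matrix.diag_apply]
    ring
  have hB : (∑ u, ∑ o, ∑ u', ∑ o', ind (o = yo) * (ind (o' = yo') * (ind (u = u') *
      ((1 - ind (HasPrefix u x)) * (ρ u u' * τ o o'))))) =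
      (ρ.trace - (successBlock ρ x).trace) * τ yo yo' := by
    rw [← sum_hasPrefix, Matrix.trace, ← Finset.sum_sub_distrib, Finset.sum_mul]
    simp only [← Finset.mul_sum, sum_ind_eq, sum_ind_eq', Matrix.diag_apply]
    exact Finset.sum_congr rfl fun u _ => by ring
  refine Eq.trans (b := ind (yx = x) * ind (yx' = x) * (τ.trace * successBlock ρ x yo yo' +
    (ρ.trace - (successBlock ρ x).trace) * τ yo yo')) ?_ ?_
  · rw [← hA, ← hB]
    simp only [← Finset.sum_add_distrib, Finset.mul_sum, G]
  · rw [← basisState_apply, mul_comm]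
    rfl

end Round

/-! ### The post-selection circuit -/

section PostSelect

variable (d n : ℕ)

/-- The qubits of an output on `d + n` qubits: the flag and the suffix, and the prefix. -/
def splitOutput : Option (Fin (d + n)) ≃ Option (Fin n) ⊕ Fin d where
  toFun o := o.elim (Sum.inl none)
    (Fin.addCases (fun i => Sum.inr i) (fun j => Sum.inl (some j)))
  invFun := Sum.elim (fun o => o.map (Fin.natAdd d)) (fun i => some (Fin.castAdd n i))
  left_inv := by
    rintro (_ | p)
    · rfl
    · refine Fin.addCases (fun i => ?_) (fun j => ?_) p <;> simp
  right_inv := by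
    rintro ((_ | j) | i) <;> simp

/-- The first of `q + 1` registers, and the others. -/
def splitFirst (B X : Type) (q : ℕ) : (Fin (q + 1) × B) ⊕ X ≃ B ⊕ ((Fin q × B) ⊕ X) where
  toFun := Sum.elim (fun p => Fin.cases (motive := fun _ => B ⊕ ((Fin q × B) ⊕ X)) (Sum.inl p.2)
    (fun r => Sum.inr (Sum.inl (r, p.2))) p.1) (fun x => Sum.inr (Sum.inr x))
  invFun := Sum.elim (fun b => Sum.inl (0, b))
    (Sum.elim (fun p => Sum.inl (p.1.succ, p.2)) Sum.inr)
  left_inv := by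
    rintro (⟨r, b⟩ | x)
    · refine Fin.cases ?_ (fun r => ?_) r <;> simp
    · rfl
  right_inv := by
    rintro (b | (⟨r, b⟩ | x)) <;> simp

/-- The circuit for the post-selection, with the sought prefix as an additional input and output.
With no fresh outputs it sets the flag; with one more fresh output it adds one round. The rounds
run from the last fresh output to the first, and each success replaces the output register: the
first success in the order of the fresh outputs determines the final output. -/
def selectCircuit : ∀ q : ℕ,
    QCircuit ((Fin q × Option (Fin (d + n))) ⊕ Fin d) (Option (Fin n) ⊕ Fin d)
  | 0 => (classicalCircuit (W := Option (Fin n) ⊕ Fin d) Function.Embedding.inr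
      [CGate.X (Sum.inl none)] (Function.Embedding.refl _)).reindexIn (Equiv.emptySum _ _)
  | q + 1 => (((QCircuit.ident (Option (Fin (d + n)))).par (selectCircuit q)).comp
      ((selectRound d n).reindexIn ((splitOutput d n).sumCongr (Equiv.refl _)))).reindexIn
        (splitFirst _ _ q)

theorem size_selectCircuit_le (q : ℕ) :
    (selectCircuit d n q).size ≤ (122 * q + 40) * (d + n + 2) := by
  induction q with
  | zero =>
    refine (size_classicalCircuit_le (W := Option (Fin n) ⊕ Fin d) _ _ _).trans ?_
    simp only [List.length_singleton, Fintype.card_sum, Fintype.card_option, Fintype.card_fin]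
    omega
  | succ q ih =>
    rw [selectCircuit, QCircuit.size_reindexIn, QCircuit.size_comp, QCircuit.size_par,
      QCircuit.size_ident, QCircuit.size_reindexIn]
    have := size_selectRound_le d n
    simp only [Fintype.card_option, Fintype.card_fin]
    nlinarith

variable {d n}

theorem noAbort_apply (ρ : QOp (Fin n)) (v w : Option (Fin n) → Bool) :
    noAbort ρ v w = ind (v none = false) * (ind (w none = false) *
      ρ (fun i => v (some i)) (fun i => w (some i))) := by
  simp only [noAbort, Matrix.of_apply]
  cases v none <;> cases w none <;> simp [ind]

theorem sum_option (F : (Option (Fin n) → Bool) → ℂ) :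
    ∑ v, F v = ∑ b : Bool, ∑ v : Fin n → Bool, F (fun o => o.elim b v) := by
  rw [← (Equiv.piOptionEquivProd (β := fun _ : Option (Fin n) => Bool)).symm.sum_comp,
    Fintype.sum_prod_type]
  refine Finset.sum_congr rfl fun b _ => Finset.sum_congr rfl fun v _ => ?_
  congr 1
  funext o
  cases o <;> rfl

theorem trace_noAbort (ρ : QOp (Fin n)) : (noAbort ρ).trace = ρ.trace := by
  simp only [Matrix.trace, Matrix.diag_apply, noAbort_apply, sum_option, Option.elim_none,
    Option.elim_some, ← Finset.mul_sum, sum_ind_eq]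
  rw [ind_pos trivial, one_mul]

theorem successBlock_submatrix (ρ : QOp (Option (Fin (d + n)))) (x : Fin d → Bool) :
    successBlock (ρ.submatrix (fun v => v ∘ splitOutput d n) (fun v => v ∘ splitOutput d n)) x =
      noAbort (prefixBlock ρ x) := by
  have h : ∀ v : Option (Fin n) → Bool, v none = false → Sum.elim v x ∘ splitOutput d n =
      fun o => o.elim false (Fin.append x fun i => v (some i)) := by
    intro v hv
    funext o
    rcases o with _ | p
    · simpa [splitOutput] using hv
    · refine Fin.addCases (fun i => ?_) (fun j => ?_) p <;> simp [splitOutput]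
  ext v w
  simp only [successBlock, noAbort, Matrix.of_apply, Matrix.submatrix_apply, prefixBlock]
  by_cases hv : v none = false
  · by_cases hw : w none = false
    · rw [h v hv, h w hw]
    · simp [hw]
  · simp [hv]

theorem trace_submatrix_comp {A B : Type} [Fintype A] [DecidableEq A] [Fintype B] [DecidableEq B]
    (e : A ≃ B) (ρ : QOp A) :
    (ρ.submatrix (fun v : B → Bool => v ∘ e) (fun v : B → Bool => v ∘ e)).trace = ρ.trace := by
  simp only [Matrix.trace, Matrix.diag_apply, Matrix.submatrix_apply]
  exact (Equiv.arrowCongr e.symm (Equiv.refl Bool)).sum_comp (fun v => ρ v v)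

/-- Positivity of `ρ` plays no role: with `p` the trace of the block, the weights are
`p * ∑ r < q, (1 - p) ^ r + (1 - p) ^ q = 1`. -/
theorem trace_postSelect {q : ℕ} (ρ : QOp (Option (Fin (d + n)))) (x : Fin d → Bool) :
    (postSelect q ρ x).trace = 1 := by
  rw [postSelect, Matrix.trace_add, Matrix.trace_sum, Matrix.trace_smul, abortState,
    trace_basisState]
  simp only [Matrix.trace_smul, trace_noAbort, smul_eq_mul, mul_one]
  have := geom_sum_mul (1 - (prefixBlock ρ x).trace) q
  rw [← Finset.sum_mul]
  linear_combination -this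

theorem postSelect_succ (q : ℕ) (ρ : QOp (Option (Fin (d + n)))) (x : Fin d → Bool) :
    postSelect (q + 1) ρ x =
      noAbort (prefixBlock ρ x) + (1 - (prefixBlock ρ x).trace) • postSelect q ρ x := by
  rw [postSelect, postSelect, Finset.sum_range_succ', smul_add, Finset.smul_sum]
  simp only [smul_smul, ← pow_succ', pow_zero, one_smul]
  abel

theorem channel_selectCircuit (q : ℕ) (ρ : QOp (Option (Fin (d + n)))) (hρ : ρ.trace = 1)
    (x : Fin d → Bool) :
    (selectCircuit d n q).channel (tensorState (tensorFamily fun _ => ρ) (basisState x)) =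
      tensorState (postSelect q ρ x) (basisState x) := by
  induction q with
  | zero =>
    have h : (tensorState (tensorFamily fun _ : Fin 0 => ρ) (basisState x)).submatrix
        (fun v => v ∘ Equiv.emptySum _ _) (fun v => v ∘ Equiv.emptySum _ _) = basisState x := by
      ext v w
      simp only [tensorState, tensorFamily, Matrix.submatrix_apply, Matrix.of_apply,
        Finset.univ_eq_empty, Finset.prod_empty, one_mul]
      rfl
    have h0 : Function.extend (Function.Embedding.inr : Fin d ↪ Option (Fin n) ⊕ Fin d) x
        (fun _ => false) = Sum.elim (fun _ => false) x := by
      rw [eq_comm, eq_extend_iff]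
      refine ⟨rfl, ?_⟩
      rintro (w | p) hj
      · rfl
      · exact absurd rfl (hj p)
    rw [selectCircuit, QCircuit.channel_reindexIn, h, channel_classicalCircuit_basisState, h0]
    simp only [postSelect, Finset.range_zero, Finset.sum_empty, pow_zero, one_smul, zero_add,
      abortState]
    rw [tensorState_basisState]
    congr 1
    funext w
    simp only [CGate.run_cons, CGate.run_nil, CGate.fn, Function.comp_apply, Function.update_apply]
    rcases w with (_ | w) | w <;> rfl
  | succ q ih =>
    have h : (tensorState (tensorFamily fun _ : Fin (q + 1) => ρ) (basisState x)).submatrix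
        (fun v => v ∘ splitFirst _ _ q) (fun v => v ∘ splitFirst _ _ q) =
        tensorState ρ (tensorState (tensorFamily fun _ : Fin q => ρ) (basisState x)) := by
      ext v w
      simp only [tensorState, tensorFamily, Matrix.submatrix_apply, Matrix.of_apply,
        Fin.prod_univ_succ, mul_assoc]
      rfl
    have h' : (tensorState ρ (tensorState (postSelect q ρ x) (basisState x))).submatrix
        (fun v => v ∘ (splitOutput d n).sumCongr (Equiv.refl _))
        (fun v => v ∘ (splitOutput d n).sumCongr (Equiv.refl _)) =
        tensorState (ρ.submatrix (fun v => v ∘ splitOutput d n) (fun v => v ∘ splitOutput d n))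
          (tensorState (postSelect q ρ x) (basisState x)) := by
      ext v w
      rfl
    rw [selectCircuit, QCircuit.channel_reindexIn, h, QCircuit.channel_comp, QCircuit.channel_par,
      QCircuit.channel_ident, ih, QCircuit.channel_reindexIn, h', channel_selectRound,
      trace_postSelect, successBlock_submatrix, trace_submatrix_comp, hρ, trace_noAbort, one_smul,
      postSelect_succ]

variable (d n)

/-- The post-selection circuit on `q` fresh outputs and the sought prefix. -/
def postSelectCircuit (q : ℕ) :
    QCircuit ((Fin q × Option (Fin (d + n))) ⊕ Fin d) (Option (Fin n)) :=
  (selectCircuit d n q).restrictOut Function.Embedding.inl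

variable {d n}

theorem channel_postSelectCircuit (q : ℕ) (ρ : QOp (Option (Fin (d + n)))) (hρ : ρ.trace = 1)
    (x : Fin d → Bool) :
    (postSelectCircuit d n q).channel (tensorState (tensorFamily fun _ => ρ) (basisState x)) =
      postSelect q ρ x := by
  rw [postSelectCircuit, QCircuit.channel_restrictOut, channel_selectCircuit q ρ hρ,
    traceOut_inl_tensorState, trace_basisState, one_smul]

variable (d n)

/-- The generator of the post-selected states: distribute the key, call the generator `q` times,
and select the prefix. -/
def postSelectGenerator (l q : ℕ) :
    BlackBoxCircuit (Fin l ⊕ Fin d) (Fin l) (Option (Fin (d + n))) (Option (Fin n)) where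
  calls := q
  mem := d
  pre := distribute q l d
  post := postSelectCircuit d n q

variable {d n}

theorem prfsOut_postSelectGenerator {l : ℕ} (q : ℕ) (G : QCircuit (Fin l) (Option (Fin (d + n))))
    (k : Fin l → Bool) (hG : (prsOut G k).trace = 1) (x : Fin d → Bool) :
    prfsOut ((postSelectGenerator d n l q).inst G) k x = postSelect q (prsOut G k) x := by
  rw [prfsOut, BlackBoxCircuit.inst, QCircuit.channel_comp, QCircuit.channel_comp]
  refine Eq.trans (b := (postSelectCircuit d n q).channel (((G.copies q).par
    (QCircuit.ident (Fin d))).channel ((distribute q l d).channel (basisState (Sum.elim k x))))) rfl ?_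
  rw [channel_distribute, QCircuit.channel_par, QCircuit.channel_copies, QCircuit.channel_ident]
  exact channel_postSelectCircuit q _ hG x

theorem size_postSelectGenerator_le {l : ℕ} (q : ℕ) (G : QCircuit (Fin l) (Option (Fin (d + n)))) :
    ((postSelectGenerator d n l q).inst G).size ≤ 300 * (q + 1) * G.size := by
  have h1 : ((postSelectGenerator d n l q).inst G).size =
      (distribute q l d).size + (q * G.size + 2 * d) + (selectCircuit d n q).size := by
    rw [BlackBoxCircuit.inst, QCircuit.size_comp, QCircuit.size_comp, QCircuit.size_par,
      QCircuit.size_copies, QCircuit.size_ident, Fintype.card_fin]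
    rfl
  have h2 : 2 * (d + n + 1) ≤ G.size := by
    have := Fintype.card_le_of_embedding G.out
    simp only [Fintype.card_option, Fintype.card_fin] at this
    unfold QCircuit.size
    omega
  have h3 : 2 * l ≤ G.size := by
    have := Fintype.card_le_of_embedding G.inp
    simp only [Fintype.card_fin] at this
    unfold QCircuit.size
    omega
  have h4 := size_distribute_le q l d
  have h5 := size_selectCircuit_le d n q
  rw [h1]
  have h6 : 39 * (q * l) ≤ 39 * (q * G.size) := by gcongr; omega
  have h7 : (122 * q + 40) * (d + n + 2) ≤ (122 * q + 40) * G.size := by gcongr; omega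
  have h8 : 2 * (l + d) ≤ 2 * G.size := by omega
  nlinarith

end PostSelect

/-! ### Recognizable abort of the post-selected states -/

/-- The Hilbert space of `n` qubits. -/
abbrev KetSpace (n : ℕ) : Type := EuclideanSpace ℂ (Fin n → Bool)

/-- The rank-one operator of a vector that need not be normalized. -/
def ketMat {n : ℕ} (v : KetSpace n) : QOp (Fin n) :=
  Matrix.of fun a b => v a * star (v b)

/-- The component of a vector on `d + n` qubits along the prefix `x`. -/
def ketBlock {d n : ℕ} (x : Fin d → Bool) (ψ : KetSpace (d + n)) :
    KetSpace n :=
  WithLp.toLp 2 fun v => ψ (Fin.append x v)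

instance unitKet_nonempty (n : ℕ) : Nonempty (UnitKet n) :=
  ⟨⟨EuclideanSpace.single (fun _ => false) 1, by simp⟩⟩

open Classical in
/-- The direction of a vector; the zero vector gets an arbitrary one. -/
def ketDir {n : ℕ} (v : KetSpace n) : UnitKet n :=
  if h : v = 0 then Classical.arbitrary _ else
    ⟨((‖v‖⁻¹ : ℝ) : ℂ) • v, by
      rw [mem_sphere_zero_iff_norm, norm_smul]
      simp [norm_ne_zero_iff.2 h]⟩

theorem ketMat_eq_smul_pureState {n : ℕ} (v : KetSpace n) :
    ketMat v = ((‖v‖ ^ 2 : ℝ) : ℂ) • pureState (ketDir v) := by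
  by_cases h : v = 0
  · subst h
    ext a b
    simp [ketMat]
  · have hn : ((‖v‖ : ℝ) : ℂ) ≠ 0 := by
      exact_mod_cast norm_ne_zero_iff.2 h
    ext a b
    simp only [ketMat, pureState, ketDir, dif_neg h, Matrix.of_apply, Matrix.smul_apply,
      PiLp.smul_apply, smul_eq_mul, star_mul']
    rw [show star (((‖v‖⁻¹ : ℝ) : ℂ)) = ((‖v‖⁻¹ : ℝ) : ℂ) from Complex.conj_ofReal _]
    push_cast
    field_simp

theorem prefixBlock_noAbort_pureState {d n : ℕ} (x : Fin d → Bool) (ψ : UnitKet (d + n)) :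
    prefixBlock (noAbort (pureState ψ)) x = ketMat (ketBlock x ψ.1) := by
  ext v w
  simp [prefixBlock, noAbort, pureState, ketMat, ketBlock]

theorem sum_norm_ketBlock {d n : ℕ} (ψ : KetSpace (d + n)) :
    ∑ x : Fin d → Bool, ‖ketBlock x ψ‖ ^ 2 = ‖ψ‖ ^ 2 := by
  simp only [EuclideanSpace.norm_sq_eq, ketBlock]
  rw [← (Fin.appendEquiv d n).sum_comp (fun w : Fin (d + n) → Bool => ‖ψ w‖ ^ 2),
    Fintype.sum_prod_type]
  rfl

theorem norm_ketBlock_le {d n : ℕ} (x : Fin d → Bool) (ψ : UnitKet (d + n)) :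
    ‖ketBlock x ψ.1‖ ^ 2 ≤ 1 := by
  have h := sum_norm_ketBlock ψ.1
  rw [mem_sphere_zero_iff_norm.1 ψ.2, one_pow] at h
  refine le_of_le_of_eq ?_ h
  exact Finset.single_le_sum (f := fun x => ‖ketBlock x ψ.1‖ ^ 2) (fun _ _ => by positivity)
    (Finset.mem_univ x)

theorem trace_pureState {n : ℕ} (ψ : UnitKet n) : (pureState ψ).trace = 1 := by
  have h : ‖ψ.1‖ ^ 2 = 1 := by rw [mem_sphere_zero_iff_norm.1 ψ.2, one_pow]
  rw [EuclideanSpace.norm_sq_eq] at h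
  simp only [Matrix.trace, Matrix.diag_apply, pureState, Matrix.of_apply]
  refine Eq.trans ?_ ((congrArg (fun r : ℝ => (r : ℂ)) h).trans Complex.ofReal_one)
  push_cast
  refine Finset.sum_congr rfl fun v _ => ?_
  rw [Complex.star_def, Complex.mul_conj, Complex.normSq_eq_norm_sq]
  push_cast
  rfl

/-- If the block of `ρ` at `x` is pure of weight `p`, then post-selection succeeds with probability
`1 - (1 - p) ^ q`, and in that case returns the normalized block. -/
theorem postSelect_eq {d n : ℕ} {ρ : QOp (Option (Fin (d + n)))} {x : Fin d → Bool} {p : ℝ}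
    {u : UnitKet n} (h : prefixBlock ρ x = (p : ℂ) • pureState u) (q : ℕ) :
    postSelect q ρ x = ((1 - (1 - p) ^ q : ℝ) : ℂ) • noAbort (pureState u) +
      (((1 - p) ^ q : ℝ) : ℂ) • abortState n := by
  have htr : (prefixBlock ρ x).trace = p := by
    rw [h, Matrix.trace_smul, trace_pureState, smul_eq_mul, mul_one]
  have hna : noAbort (prefixBlock ρ x) = (p : ℂ) • noAbort (pureState u) := by
    rw [h]
    ext v w
    simp only [noAbort_apply, Matrix.smul_apply, smul_eq_mul]
    ring
  rw [postSelect, htr, hna, ← Finset.sum_smul, smul_smul]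
  have := geom_sum_mul (1 - (p : ℂ)) q
  congr 2
  · push_cast
    linear_combination -this
  · push_cast
    rfl

theorem isRecognizable_postSelect {d n : ℕ} {ρ : QOp (Option (Fin (d + n)))}
    (h : IsRecognizable ρ) (q : ℕ) (x : Fin d → Bool) : IsRecognizable (postSelect q ρ x) := by
  obtain ⟨ψ, η, h0, h1, rfl⟩ := h
  set p : ℝ := η * ‖ketBlock x ψ.1‖ ^ 2 with hp
  have hp0 : 0 ≤ p := by positivity
  have hp1 : p ≤ 1 := mul_le_one₀ h1 (by positivity) (norm_ketBlock_le x ψ)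
  have hb : prefixBlock ((η : ℂ) • noAbort (pureState ψ) + ((1 - η : ℝ) : ℂ) • abortState (d + n)) x =
      (p : ℂ) • pureState (ketDir (ketBlock x ψ.1)) := by
    have : (p : ℂ) • pureState (ketDir (ketBlock x ψ.1)) =
        (η : ℂ) • prefixBlock (noAbort (pureState ψ)) x := by
      rw [prefixBlock_noAbort_pureState, ketMat_eq_smul_pureState, smul_smul, hp]
      push_cast
      rfl
    rw [this]
    ext v w
    have hab : ∀ v : Fin n → Bool, ¬ ((fun o : Option (Fin (d + n)) =>
        o.elim false (Fin.append x v)) = fun o => o.isNone) := by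
      intro v e
      have := congrFun e none
      simp at this
    simp only [prefixBlock, Matrix.of_apply, Matrix.add_apply, Matrix.smul_apply, abortState,
      basisState_apply, ind_neg (hab _), smul_eq_mul, mul_zero, add_zero]
  refine ⟨_, 1 - (1 - p) ^ q, ?_, ?_, by rw [postSelect_eq hb, sub_sub_cancel]⟩
  · have := pow_le_one₀ (n := q) (sub_nonneg.2 hp1) (by linarith)
    linarith
  · have := pow_nonneg (sub_nonneg.2 hp1) q
    linarith

/-! ### Density matrices -/

theorem trace_kron {A B : Type} [Fintype A] [DecidableEq A] [Fintype B] [DecidableEq B]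
    (σ : QOp A) (τ : QOp B) : (tensorState σ τ).trace = σ.trace * τ.trace := by
  simp only [Matrix.trace, Matrix.diag_apply, sum_sumArrow, Finset.sum_mul_sum]
  rfl

theorem trace_tensorFamily {S A : Type} [Fintype S] [DecidableEq S] [Fintype A] [DecidableEq A]
    (σ : S → QOp A) : (tensorFamily σ).trace = ∏ r, (σ r).trace := by
  simp only [Matrix.trace, Matrix.diag_apply, tensorFamily, Matrix.of_apply]
  rw [Finset.prod_univ_sum, ← (Equiv.curry S A Bool).symm.sum_comp]
  simp

open scoped MatrixOrder in
theorem exists_conjTranspose_mul_self {A : Type} [Fintype A] [DecidableEq A] {σ : QOp A}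
    (hσ : σ.PosSemidef) : ∃ P : QOp A, σ = P.conjTranspose * P :=
  CStarAlgebra.nonneg_iff_eq_star_mul_self.mp hσ.nonneg

theorem IsDensity.tensorState {A B : Type} [Fintype A] [DecidableEq A] [Fintype B] [DecidableEq B]
    {σ : QOp A} {τ : QOp B} (hσ : IsDensity σ) (hτ : IsDensity τ) : IsDensity (tensorState σ τ) := by
  refine ⟨?_, by rw [trace_kron, hσ.2, hτ.2, one_mul]⟩
  obtain ⟨P, rfl⟩ := exists_conjTranspose_mul_self hσ.1
  obtain ⟨R, rfl⟩ := exists_conjTranspose_mul_self hτ.1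
  rw [tensorState_eq_kron, ← kron_mul, ← kron_conjTranspose]
  exact Matrix.posSemidef_conjTranspose_mul_self _

theorem IsDensity.tensorFamily {S A : Type} [Fintype S] [DecidableEq S] [Fintype A] [DecidableEq A]
    {σ : S → QOp A} (hσ : ∀ r, IsDensity (σ r)) : IsDensity (tensorFamily σ) := by
  refine ⟨?_, by rw [trace_tensorFamily]; exact Finset.prod_eq_one fun r _ => (hσ r).2⟩
  choose P hP using fun r => exists_conjTranspose_mul_self (hσ r).1
  rw [tensorFamily_eq_famKron, show σ = fun r => (P r).conjTranspose * P r from funext hP,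
    ← famKron_mul, ← famKron_conjTranspose]
  exact Matrix.posSemidef_conjTranspose_mul_self _

theorem isDensity_basisState {A : Type} [Fintype A] [DecidableEq A] (v : A → Bool) :
    IsDensity (basisState v) := by
  refine ⟨?_, trace_basisState v⟩
  have : basisState v = Matrix.vecMulVec (fun w => ind (w = v)) (star fun w => ind (w = v)) := by
    ext w w'
    rw [basisState_apply, Matrix.vecMulVec_apply, Pi.star_apply, star_ind]
  rw [this]
  exact Matrix.posSemidef_vecMulVec_self_star _

theorem isDensity_noAbort_pureState {n : ℕ} (ψ : UnitKet n) :
    IsDensity (noAbort (pureState ψ)) := by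
  refine ⟨?_, by rw [trace_noAbort, trace_pureState]⟩
  have : noAbort (pureState ψ) = Matrix.vecMulVec
      (fun w => ind (w none = false) * ψ.1 fun i => w (some i))
      (star fun w => ind (w none = false) * ψ.1 fun i => w (some i)) := by
    ext w w'
    rw [noAbort_apply, Matrix.vecMulVec_apply, Pi.star_apply, star_mul', star_ind, pureState,
      Matrix.of_apply]
    ring
  rw [this]
  exact Matrix.posSemidef_vecMulVec_self_star _

theorem IsDensity.mix {A : Type} [Fintype A] [DecidableEq A] {σ τ : QOp A} (hσ : IsDensity σ)
    (hτ : IsDensity τ) {f : ℝ} (h0 : 0 ≤ f) (h1 : f ≤ 1) :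
    IsDensity (((1 - f : ℝ) : ℂ) • σ + (f : ℂ) • τ) := by
  refine ⟨(hσ.1.smul ?_).add (hτ.1.smul ?_), ?_⟩
  · exact_mod_cast sub_nonneg.2 h1
  · exact_mod_cast h0
  · rw [Matrix.trace_add, Matrix.trace_smul, Matrix.trace_smul, hσ.2, hτ.2]
    push_cast
    simp

theorem IsRecognizable.isDensity {n : ℕ} {ρ : QOp (Option (Fin n))} (h : IsRecognizable ρ) :
    IsDensity ρ := by
  obtain ⟨ψ, η, h0, h1, rfl⟩ := h
  have := (isDensity_noAbort_pureState ψ).mix (isDensity_basisState fun o => o.isNone)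
    (sub_nonneg.2 h1) (sub_le_self 1 h0)
  rwa [sub_sub_cancel] at this

/-! ### Acceptance probabilities -/

theorem traceOut_diag_nonneg {O W : Type} [Fintype W] [DecidableEq W] (f : O ↪ W) {σ : QOp W}
    (hσ : σ.PosSemidef) (y : O → Bool) : 0 ≤ traceOut f σ y y := by
  rw [traceOut_apply]
  refine Finset.sum_nonneg fun w _ => Finset.sum_nonneg fun w' _ => ?_
  by_cases h1 : w ∘ f = y
  · by_cases h2 : w' ∘ f = y
    · by_cases h3 : EqOff f w w'
      · rw [(eq_iff_eqOff f w w').2 ⟨h3, h1.trans h2.symm⟩]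
        simp only [ind_pos h2, one_mul]
        rw [ind_pos (show EqOff f w' w' from fun _ _ => rfl), one_mul]
        exact hσ.diag_nonneg
      · simp [ind_neg h3]
    · simp [ind_neg h2]
  · simp [ind_neg h1]

theorem trace_traceOut {O W : Type} [Fintype O] [DecidableEq O] [Fintype W] [DecidableEq W]
    (f : O ↪ W) (σ : QOp W) : (traceOut f σ).trace = σ.trace := by
  have h := sum_traceOut_mul f σ (fun y y' => ind (y = y'))
  simp only [mul_comm _ (ind (_ = (_ : O → Bool))), sum_ind_eq'] at h
  rw [Matrix.trace]
  refine Eq.trans h ?_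
  have : ∀ w w' : W → Bool, ind (w ∘ f = w' ∘ f) * (ind (EqOff f w w') * σ w w') =
      ind (w = w') * σ w w' := by
    intro w w'
    rw [ind_congr (eq_iff_eqOff f w w'), ind_and]
    ring
  simp only [this, sum_ind_eq']
  rfl

theorem conjTranspose_mul_self_adjoinZeros {I W : Type} [Fintype I] [DecidableEq I] [Fintype W]
    [DecidableEq W] (f : I ↪ W) : (adjoinZeros f).conjTranspose * adjoinZeros f = 1 := by
  ext v v'
  rw [Matrix.mul_apply, one_apply_ind]
  simp only [Matrix.conjTranspose_apply, adjoinZeros_apply, star_ind, sum_ind_eq]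
  refine ind_congr ⟨fun h => ?_, fun h => by rw [h]⟩
  rw [← extend_comp_self f v fun _ => false, h, extend_comp_self]

theorem IsDensity.conj {A B : Type} [Fintype A] [DecidableEq A] [Fintype B] [DecidableEq B]
    {ρ : QOp A} (hρ : IsDensity ρ) (V : Matrix (B → Bool) (A → Bool) ℂ)
    (hV : V.conjTranspose * V = 1) : IsDensity (V * ρ * V.conjTranspose) := by
  refine ⟨hρ.1.mul_mul_conjTranspose_same V, ?_⟩
  rw [Matrix.trace_mul_comm, ← Matrix.mul_assoc, hV, one_mul, hρ.2]

/-- A channel maps density matrices to matrices with nonnegative diagonal and trace 1. -/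
theorem channel_accept_mem {I : Type} [Fintype I] [DecidableEq I] (c : QCircuit I Unit)
    {ρ : QOp I} (hρ : IsDensity ρ) (b : Unit → Bool) :
    0 ≤ (c.channel ρ b b).re ∧ (c.channel ρ b b).re ≤ 1 := by
  have h := (hρ.conj _ (conjTranspose_mul_self_adjoinZeros c.inp)).conj _
    (gatesMat_conjTranspose_mul_self c.gates)
  have h0 := traceOut_diag_nonneg c.out h.1
  have h1 : ∑ y, c.channel ρ y y = 1 := (trace_traceOut c.out _).trans h.2
  refine ⟨(Complex.le_def.1 (h0 b)).1, ?_⟩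
  have h2 := congrArg Complex.re h1
  rw [Complex.re_sum, Complex.one_re] at h2
  rw [← h2]
  exact Finset.single_le_sum (f := fun y => (c.channel ρ y y).re)
    (fun y _ => (Complex.le_def.1 (h0 y)).1) (Finset.mem_univ b)

theorem acceptProb_mem {I : Type} [Fintype I] [DecidableEq I] {a : ℕ}
    (A : QCircuit (I ⊕ Fin a) Unit) {ρ : QOp I} {σ : QOp (Fin a)} (hρ : IsDensity ρ)
    (hσ : IsDensity σ) : 0 ≤ acceptProb A ρ σ ∧ acceptProb A ρ σ ≤ 1 :=
  channel_accept_mem A (hρ.tensorState hσ) _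

theorem channel_eq_sum {I O : Type} [Fintype I] [DecidableEq I] (c : QCircuit I O)
    (y y' : O → Bool) : ∃ K : (I → Bool) → (I → Bool) → ℂ, ∀ ρ : QOp I,
      c.channel ρ y y' = ∑ v, ∑ v', ρ v v' * K v v' := by
  set M := gatesMat c.gates * adjoinZeros c.inp with hM
  refine ⟨fun v v' => ∑ w, ∑ w', ind (w ∘ c.out = y) * (ind (w' ∘ c.out = y') *
    (ind (EqOff c.out w w') * (M w v * star (M w' v')))), fun ρ => ?_⟩
  have h : c.channel ρ = traceOut c.out (M * ρ * M.conjTranspose) := by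
    simp only [QCircuit.channel, hM, Matrix.conjTranspose_mul, Matrix.mul_assoc]
  rw [h, traceOut_apply]
  simp only [conj_apply, Finset.mul_sum]
  rw [sum_comm_four]
  refine Finset.sum_congr rfl fun v _ => Finset.sum_congr rfl fun v' _ =>
    Finset.sum_congr rfl fun w _ => Finset.sum_congr rfl fun w' _ => ?_
  ring

/-- The acceptance probability is a linear functional of the state. -/
theorem acceptProb_eq_sum {I : Type} [Fintype I] [DecidableEq I] {a : ℕ}
    (A : QCircuit (I ⊕ Fin a) Unit) (σ : QOp (Fin a)) :
    ∃ K : (I → Bool) → (I → Bool) → ℂ, ∀ ρ : QOp I,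
      acceptProb A ρ σ = (∑ v, ∑ v', ρ v v' * K v v').re := by
  obtain ⟨K, hK⟩ := channel_eq_sum A (fun _ => true) (fun _ => true)
  refine ⟨fun v v' => ∑ b, ∑ b', σ b b' * K (Sum.elim v b) (Sum.elim v' b'), fun ρ => ?_⟩
  rw [acceptProb, hK]
  congr 1
  simp only [sum_sumArrow, Finset.mul_sum]
  refine Finset.sum_congr rfl fun v _ => ?_
  rw [Finset.sum_comm]
  refine Finset.sum_congr rfl fun v' _ => Finset.sum_congr rfl fun b _ =>
    Finset.sum_congr rfl fun b' _ => ?_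
  exact mul_assoc _ _ _

/-- Hybrid argument: replacing the state `α r` by a mixture with `β r` of weight `f r`, for one `r`
after the other, changes a probability that is affine in each state by at most `∑ r, f r`. -/
theorem abs_sub_le_sum_of_mix {S Q : Type} [Fintype S] [DecidableEq S] [Fintype Q] [DecidableEq Q]
    (P : (S → QOp Q) → ℝ) (hb : ∀ ρ, (∀ r, IsDensity (ρ r)) → 0 ≤ P ρ ∧ P ρ ≤ 1)
    (hlin : ∀ (ρ : S → QOp Q) (r : S) (f : ℝ) (α β : QOp Q),
      P (Function.update ρ r (((1 - f : ℝ) : ℂ) • α + (f : ℂ) • β)) =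
        (1 - f) * P (Function.update ρ r α) + f * P (Function.update ρ r β))
    (α β : S → QOp Q) (hα : ∀ r, IsDensity (α r)) (hβ : ∀ r, IsDensity (β r)) (f : S → ℝ)
    (h0 : ∀ r, 0 ≤ f r) (h1 : ∀ r, f r ≤ 1) :
    |P (fun r => ((1 - f r : ℝ) : ℂ) • α r + (f r : ℂ) • β r) - P α| ≤ ∑ r, f r := by
  let mixed : Finset S → S → QOp Q := fun A r =>
    if r ∈ A then ((1 - f r : ℝ) : ℂ) • α r + (f r : ℂ) • β r else α r
  have hd : ∀ A r, IsDensity (mixed A r) := by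
    intro A r
    simp only [mixed]
    split_ifs
    · exact (hα r).mix (hβ r) (h0 r) (h1 r)
    · exact hα r
  have key : ∀ A : Finset S, |P (mixed A) - P α| ≤ ∑ r ∈ A, f r := by
    intro A
    induction A using Finset.induction_on with
    | empty => simp [mixed]
    | insert r A hr ih =>
      have e1 : mixed (insert r A) =
          Function.update (mixed A) r (((1 - f r : ℝ) : ℂ) • α r + (f r : ℂ) • β r) := by
        funext s
        by_cases hs : s = r
        · subst hs
          simp [mixed]
        · simp [mixed, hs]
      have e2 : mixed A = Function.update (mixed A) r (α r) := by
        rw [eq_comm, Function.update_eq_self_iff]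
        simp [mixed, hr]
      have hu : ∀ τ, IsDensity τ → ∀ s, IsDensity (Function.update (mixed A) r τ s) := by
        intro τ hτ s
        by_cases hs : s = r
        · subst hs
          simpa using hτ
        · simpa [hs] using hd A s
      have b1 := hb _ (hu _ (hα r))
      have b2 := hb _ (hu _ (hβ r))
      rw [e2] at ih
      rw [e1, hlin, Finset.sum_insert hr]
      have : (1 - f r) * P (Function.update (mixed A) r (α r)) +
          f r * P (Function.update (mixed A) r (β r)) - P α =
          f r * (P (Function.update (mixed A) r (β r)) - P (Function.update (mixed A) r (α r))) +
          (P (Function.update (mixed A) r (α r)) - P α) := by ring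
      rw [this]
      refine (abs_add_le _ _).trans (add_le_add ?_ ih)
      rw [abs_mul, abs_of_nonneg (h0 r)]
      refine mul_le_of_le_one_right (h0 r) (abs_le.2 ⟨?_, ?_⟩) <;> linarith [b1.1, b1.2, b2.1, b2.2]
  have := key Finset.univ
  simpa [mixed] using this

/-! ### Gaussian vectors and the Haar measure -/

/-- The unnormalized Gaussian weight of a vector. -/
def gaussWeight {n : ℕ} (b : ℝ) (v : KetSpace n) : ENNReal :=
  ENNReal.ofReal (Real.exp (-b * ‖v‖ ^ 2))

theorem measurable_gaussWeight {n : ℕ} (b : ℝ) : Measurable (gaussWeight (n := n) b) := by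
  unfold gaussWeight
  fun_prop

theorem integrable_gauss (n : ℕ) {b : ℝ} (hb : 0 < b) :
    Integrable fun v : KetSpace n => Real.exp (-b * ‖v‖ ^ 2) := by
  refine Integrable.of_integral_ne_zero ?_
  rw [GaussianFourier.integral_rexp_neg_mul_sq_norm hb]
  positivity

theorem finrank_ketSpace (n : ℕ) : Module.finrank ℝ (KetSpace n) = 2 * 2 ^ n := by
  rw [← Module.finrank_mul_finrank ℝ ℂ (KetSpace n), Complex.finrank_real_complex,
    finrank_euclideanSpace]
  simp

theorem lintegral_gaussWeight (n : ℕ) {b : ℝ} (hb : 0 < b) :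
    ∫⁻ v : KetSpace n, gaussWeight b v = ENNReal.ofReal ((Real.pi / b) ^ (2 ^ n)) := by
  unfold gaussWeight
  rw [← ofReal_integral_eq_lintegral_ofReal (integrable_gauss n hb)
    (Eventually.of_forall fun _ => (Real.exp_pos _).le),
    GaussianFourier.integral_rexp_neg_mul_sq_norm hb, finrank_ketSpace]
  congr 1
  rw [← Real.rpow_natCast]
  congr 1
  push_cast
  ring

/-- The law of a standard complex Gaussian vector on `n` qubits. -/
def gaussKet (n : ℕ) : Measure (KetSpace n) :=
  (ENNReal.ofReal (Real.pi ^ (2 ^ n)))⁻¹ • volume.withDensity (gaussWeight 1)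

theorem lintegral_gaussKet {n : ℕ} {f : KetSpace n → ENNReal} (hf : Measurable f) :
    ∫⁻ v, f v ∂gaussKet n =
      (ENNReal.ofReal (Real.pi ^ (2 ^ n)))⁻¹ * ∫⁻ v, gaussWeight 1 v * f v := by
  rw [gaussKet, lintegral_smul_measure, smul_eq_mul,
    lintegral_withDensity_eq_lintegral_mul _ (measurable_gaussWeight 1) hf]
  rfl

theorem ofReal_pi_pow_ne_zero (n : ℕ) : ENNReal.ofReal (Real.pi ^ (2 ^ n)) ≠ 0 := by
  have := Real.pi_pos
  simp only [ne_eq, ENNReal.ofReal_eq_zero, not_le]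
  positivity

instance isProbabilityMeasure_gaussKet (n : ℕ) : IsProbabilityMeasure (gaussKet n) := by
  constructor
  rw [← lintegral_one, lintegral_gaussKet measurable_const]
  simp only [mul_one]
  rw [lintegral_gaussWeight n one_pos, div_one]
  exact ENNReal.inv_mul_cancel (ofReal_pi_pow_ne_zero n) ENNReal.ofReal_ne_top

theorem lintegral_gaussKet_gaussWeight (n : ℕ) {a : ℝ} (ha : 0 ≤ a) :
    ∫⁻ v, gaussWeight a v ∂gaussKet n = ENNReal.ofReal (((1 + a) ^ (2 ^ n))⁻¹) := by
  have hpi := Real.pi_pos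
  rw [lintegral_gaussKet (measurable_gaussWeight a)]
  have : ∀ v : KetSpace n, gaussWeight 1 v * gaussWeight a v = gaussWeight (1 + a) v := by
    intro v
    rw [gaussWeight, gaussWeight, ← ENNReal.ofReal_mul (Real.exp_pos _).le, ← Real.exp_add,
      gaussWeight]
    congr 2
    ring
  simp only [this]
  rw [lintegral_gaussWeight n (by positivity), ← ENNReal.ofReal_inv_of_pos (by positivity),
    ← ENNReal.ofReal_mul (by positivity), div_pow]
  congr 1
  field_simp

/-! ### Blocks of a Gaussian vector -/

/-- The decomposition of a vector into its blocks. -/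
def ketBlockEquiv (d n : ℕ) : KetSpace (d + n) ≃L[ℝ] ((Fin d → Bool) → KetSpace n) :=
  LinearEquiv.toContinuousLinearEquiv
    { toFun := fun v x => ketBlock x v
      map_add' := fun _ _ => rfl
      map_smul' := fun _ _ => rfl
      invFun := fun g => WithLp.toLp 2 fun w =>
        g ((Fin.appendEquiv d n).symm w).1 ((Fin.appendEquiv d n).symm w).2
      left_inv := by
        intro v
        ext w
        obtain ⟨⟨x, u⟩, rfl⟩ := (Fin.appendEquiv d n).surjective w
        simp only [Equiv.symm_apply_apply]
        rfl
      right_inv := by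
        intro g
        funext x
        ext u
        have : Fin.append x u = Fin.appendEquiv d n (x, u) := rfl
        simp only [ketBlock, this, Equiv.symm_apply_apply] }

theorem measurable_ketBlock {d n : ℕ} (x : Fin d → Bool) :
    Measurable (ketBlock (d := d) (n := n) x) :=
  (measurable_pi_apply x).comp (ketBlockEquiv d n).continuous.measurable

/-- By the uniqueness of the Haar measure the factor `c` exists; its value will not matter. -/
theorem map_ketBlockEquiv_volume (d n : ℕ) : ∃ c : ENNReal,
    (volume : Measure (KetSpace (d + n))).map (ketBlockEquiv d n) =
      c • Measure.pi fun _ : Fin d → Bool => (volume : Measure (KetSpace n)) := by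
  have := (ketBlockEquiv d n).isAddHaarMeasure_map (volume : Measure (KetSpace (d + n)))
  have h2 := Measure.pi.isAddHaarMeasure
    (μ := fun _ : Fin d → Bool => (volume : Measure (KetSpace n)))
  exact ⟨_, Measure.isAddLeftInvariant_eq_smul _ _⟩

theorem lintegral_pi_prod_ofReal {ι : Type*} [Fintype ι] {E : ι → Type*}
    [∀ i, MeasurableSpace (E i)] (μ : ∀ i, Measure (E i)) [∀ i, SigmaFinite (μ i)]
    (f : ∀ i, E i → ℝ) (hf : ∀ i, Integrable (f i) (μ i)) (h0 : ∀ i x, 0 ≤ f i x) :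
    ∫⁻ x, ∏ i, ENNReal.ofReal (f i (x i)) ∂Measure.pi μ =
      ∏ i, ∫⁻ x, ENNReal.ofReal (f i x) ∂μ i := by
  simp_rw [← fun i => ofReal_integral_eq_lintegral_ofReal (hf i) (Eventually.of_forall (h0 i))]
  rw [← ENNReal.ofReal_prod_of_nonneg fun i _ => integral_nonneg (h0 i),
    ← integral_fintype_prod_eq_prod (𝕜 := ℝ)]
  rw [ofReal_integral_eq_lintegral_ofReal (Integrable.fintype_prod_dep hf)
    (Eventually.of_forall fun x => Finset.prod_nonneg fun i _ => h0 i _)]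
  refine lintegral_congr fun x => ?_
  rw [ENNReal.ofReal_prod_of_nonneg fun i _ => h0 i _]

theorem gaussWeight_eq_prod {d n : ℕ} (b : ℝ) (v : KetSpace (d + n)) :
    gaussWeight b v = ∏ x : Fin d → Bool, gaussWeight b (ketBlock x v) := by
  unfold gaussWeight
  rw [← ENNReal.ofReal_prod_of_nonneg fun _ _ => (Real.exp_pos _).le, ← Real.exp_sum,
    ← Finset.mul_sum, sum_norm_ketBlock]

/-- The blocks of a Gaussian vector are independent Gaussian vectors. -/
theorem map_ketBlockEquiv_gaussKet (d n : ℕ) :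
    (gaussKet (d + n)).map (ketBlockEquiv d n) =
      Measure.pi fun _ : Fin d → Bool => gaussKet n := by
  have hL : Measurable (ketBlockEquiv d n) := (ketBlockEquiv d n).continuous.measurable
  obtain ⟨c, hc⟩ := map_ketBlockEquiv_volume d n
  -- On boxes the two measures agree up to a factor, which is 1 because both are probabilities.
  obtain ⟨K, hK⟩ : ∃ K : ENNReal, ∀ s : (Fin d → Bool) → Set (KetSpace n),
      (∀ x, MeasurableSet (s x)) → (gaussKet (d + n)).map (ketBlockEquiv d n) (Set.univ.pi s) =
        K * ∏ x, gaussKet n (s x) := by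
    refine ⟨(ENNReal.ofReal (Real.pi ^ (2 ^ (d + n))))⁻¹ * c *
      ∏ _x : Fin d → Bool, ENNReal.ofReal (Real.pi ^ (2 ^ n)), fun s hs => ?_⟩
    have hbox : MeasurableSet (Set.univ.pi s) := MeasurableSet.univ_pi hs
    have hg : Measurable fun w : (Fin d → Bool) → KetSpace n =>
        ∏ x, gaussWeight 1 (w x) * (s x).indicator 1 (w x) := by
      refine Finset.measurable_prod _ fun x _ => ?_
      have : Measurable fun v : KetSpace n => gaussWeight 1 v * (s x).indicator 1 v :=
        (measurable_gaussWeight 1).mul (measurable_one.indicator (hs x))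
      exact this.comp (measurable_pi_apply x)
    have h1 : ∀ x, gaussKet n (s x) = (ENNReal.ofReal (Real.pi ^ (2 ^ n)))⁻¹ *
        ∫⁻ v, gaussWeight 1 v * (s x).indicator 1 v := by
      intro x
      rw [← lintegral_indicator_one (hs x), lintegral_gaussKet (measurable_one.indicator (hs x))]
    rw [Measure.map_apply hL hbox, ← lintegral_indicator_one (hL hbox),
      lintegral_gaussKet (measurable_one.indicator (hL hbox))]
    have h2 : ∀ v : KetSpace (d + n),
        gaussWeight 1 v * (ketBlockEquiv d n ⁻¹' Set.univ.pi s).indicator 1 v =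
          ∏ x, gaussWeight 1 (ketBlockEquiv d n v x) *
            (s x).indicator 1 (ketBlockEquiv d n v x) := by
      intro v
      rw [Finset.prod_mul_distrib, gaussWeight_eq_prod]
      congr 1
      by_cases h : ∀ x, ketBlockEquiv d n v x ∈ s x
      · rw [Set.indicator_of_mem (by simpa [Set.mem_pi] using h)]
        simp [h]
      · rw [Set.indicator_of_notMem (by simpa [Set.mem_pi] using h)]
        push Not at h
        obtain ⟨x, hx⟩ := h
        rw [Finset.prod_eq_zero (Finset.mem_univ x) (Set.indicator_of_notMem hx _)]
    simp only [h2]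
    rw [← lintegral_map hg hL, hc, lintegral_smul_measure, smul_eq_mul]
    have h3 : ∀ (x : Fin d → Bool) (v : KetSpace n),
        gaussWeight 1 v * (s x).indicator 1 v =
          ENNReal.ofReal ((s x).indicator (fun v => Real.exp (-1 * ‖v‖ ^ 2)) v) := by
      intro x v
      by_cases h : v ∈ s x <;> simp [h, gaussWeight]
    simp only [h1, h3]
    rw [lintegral_pi_prod_ofReal (fun _ => (volume : Measure (KetSpace n)))
      (fun x => (s x).indicator (fun v => Real.exp (-1 * ‖v‖ ^ 2)))
      (fun x => (integrable_gauss n one_pos).indicator (hs x))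
      (fun x v => Set.indicator_nonneg (fun _ _ => (Real.exp_pos _).le) v)]
    rw [Finset.prod_mul_distrib]
    simp only [mul_assoc]
    congr 2
    rw [← mul_assoc, ← Finset.prod_mul_distrib]
    simp only [ENNReal.mul_inv_cancel (ofReal_pi_pow_ne_zero n) ENNReal.ofReal_ne_top,
      Finset.prod_const_one, one_mul]
  have hp := Measure.isProbabilityMeasure_map (μ := gaussKet (d + n)) hL.aemeasurable
  have h1 := hK (fun _ => Set.univ) fun _ => MeasurableSet.univ
  simp only [Set.pi_univ, measure_univ, Finset.prod_const_one, mul_one] at h1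
  refine (Measure.pi_eq fun s hs => ?_).symm
  rw [hK s hs, ← h1, one_mul]

/-! ### Polar coordinates -/

theorem lintegral_polar {n : ℕ} {f : KetSpace n → ENNReal} (hf : Measurable f) :
    ∫⁻ v, f v = ∫⁻ θ : UnitKet n, ∫⁻ r : Set.Ioi (0 : ℝ), f (r.1 • θ.1)
      ∂Measure.volumeIoiPow (Module.finrank ℝ (KetSpace n) - 1) ∂(volume.toSphere) := by
  have hg : Measurable fun p : UnitKet n × Set.Ioi (0 : ℝ) => f (p.2.1 • p.1.1) := by fun_prop
  have hmp := (volume : Measure (KetSpace n)).measurePreserving_homeomorphUnitSphereProd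
  rw [← lintegral_prod (fun p : UnitKet n × Set.Ioi (0 : ℝ) => f (p.2.1 • p.1.1)) hg.aemeasurable,
    ← hmp.lintegral_comp hg]
  have : ∀ v : ({0}ᶜ : Set (KetSpace n)),
      f ((homeomorphUnitSphereProd (KetSpace n) v).2.1 •
        (homeomorphUnitSphereProd (KetSpace n) v).1.1) = f v.1 := by
    intro v
    rw [homeomorphUnitSphereProd_apply_snd_coe, homeomorphUnitSphereProd_apply_fst_coe,
      smul_inv_smul₀ (norm_ne_zero_iff.2 v.2)]
  simp only [this]
  rw [lintegral_subtype_comap (measurableSet_singleton _).compl]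
  rw [restrict_compl_singleton]

theorem toSphere_univ_ne_zero (n : ℕ) :
    (volume : Measure (KetSpace n)).toSphere Set.univ ≠ 0 := by
  have : NeZero (volume : Measure (KetSpace n)).toSphere := ⟨Measure.toSphere_ne_zero _⟩
  exact NeZero.ne _

instance isProbabilityMeasure_haarKet (n : ℕ) : IsProbabilityMeasure (haarKet n) := by
  constructor
  rw [haarKet, Measure.smul_apply, smul_eq_mul]
  exact ENNReal.inv_mul_cancel (toSphere_univ_ne_zero n) (measure_ne_top _ _)

theorem toSphere_eq_smul_haarKet (n : ℕ) : (volume : Measure (KetSpace n)).toSphere =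
    (volume : Measure (KetSpace n)).toSphere Set.univ • haarKet n := by
  rw [haarKet, smul_smul, ENNReal.mul_inv_cancel (toSphere_univ_ne_zero n) (measure_ne_top _ _),
    one_smul]

theorem ketDir_smul {n : ℕ} {r : ℝ} (hr : 0 < r) (v : KetSpace n) :
    ketDir (r • v) = ketDir v := by
  by_cases h : v = 0
  · simp [h]
  · have h' : r • v ≠ 0 := smul_ne_zero hr.ne' h
    have hn := norm_ne_zero_iff.2 h
    apply Subtype.ext
    simp only [ketDir, dif_neg h, dif_neg h']
    rw [← Complex.coe_smul r v, smul_smul, Complex.coe_smul, norm_smul, Real.norm_of_nonneg hr.le]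
    congr 1
    push_cast
    have hr' : (r : ℂ) ≠ 0 := by exact_mod_cast hr.ne'
    have hn' : (‖v‖ : ℂ) ≠ 0 := by exact_mod_cast hn
    field_simp

theorem ketDir_unitKet {n : ℕ} (θ : UnitKet n) : ketDir θ.1 = θ := by
  have h1 : ‖θ.1‖ = 1 := mem_sphere_zero_iff_norm.1 θ.2
  have h : θ.1 ≠ 0 := norm_ne_zero_iff.1 (by rw [h1]; exact one_ne_zero)
  apply Subtype.ext
  simp [ketDir, dif_neg h]

theorem measurable_ketDir (n : ℕ) : Measurable (ketDir (n := n)) := by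
  classical
  have : (fun v : KetSpace n => (ketDir v).1) = fun v => if v = 0 then
      (Classical.arbitrary (UnitKet n)).1 else ((‖v‖⁻¹ : ℝ) : ℂ) • v := by
    funext v
    by_cases h : v = 0 <;> simp [ketDir, h]
  refine (MeasurableEmbedding.subtype_coe Metric.isClosed_sphere.measurableSet).measurable_comp_iff.1 ?_
  change Measurable fun v : KetSpace n => (ketDir v).1
  rw [this]
  refine Measurable.ite (measurableSet_singleton 0) measurable_const ?_
  fun_prop

theorem ketBlock_smul {d n : ℕ} (x : Fin d → Bool) (r : ℝ) (v : KetSpace (d + n)) :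
    ketBlock x (r • v) = r • ketBlock x v := rfl

theorem gaussWeight_smul {n : ℕ} (b r : ℝ) (v : KetSpace n) :
    gaussWeight b (r • v) = ENNReal.ofReal (Real.exp (-(b * ‖v‖ ^ 2) * r ^ 2)) := by
  rw [gaussWeight, norm_smul, mul_pow, Real.norm_eq_abs, sq_abs]
  congr 2
  ring

/-- The radial part of the Gaussian integral, up to the area of the sphere. -/
theorem toSphere_mul_lintegral_exp (n : ℕ) {b : ℝ} (hb : 0 < b) :
    (volume : Measure (KetSpace n)).toSphere Set.univ *
      ∫⁻ r : Set.Ioi (0 : ℝ), ENNReal.ofReal (Real.exp (-b * r.1 ^ 2))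
        ∂Measure.volumeIoiPow (Module.finrank ℝ (KetSpace n) - 1) =
      ENNReal.ofReal ((Real.pi / b) ^ (2 ^ n)) := by
  rw [← lintegral_gaussWeight n hb, lintegral_polar (measurable_gaussWeight b)]
  have : ∀ (θ : UnitKet n) (r : Set.Ioi (0 : ℝ)), gaussWeight b (r.1 • θ.1) =
      ENNReal.ofReal (Real.exp (-b * r.1 ^ 2)) := by
    intro θ r
    rw [gaussWeight_smul, mem_sphere_zero_iff_norm.1 θ.2, one_pow, mul_one]
  simp only [this, lintegral_const, mul_comm]

/-- The direction of a Gaussian vector is Haar distributed. -/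
theorem map_ketDir_gaussKet (n : ℕ) : (gaussKet n).map ketDir = haarKet n := by
  refine Measure.ext_of_lintegral _ fun f hf => ?_
  have hfd : Measurable fun v : KetSpace n => f (ketDir v) := hf.comp (measurable_ketDir n)
  have hgd : Measurable fun v : KetSpace n => gaussWeight 1 v * f (ketDir v) :=
    (measurable_gaussWeight 1).mul hfd
  rw [lintegral_map hf (measurable_ketDir n), lintegral_gaussKet hfd,
    lintegral_polar hgd]
  have : ∀ (θ : UnitKet n) (r : Set.Ioi (0 : ℝ)),
      gaussWeight 1 (r.1 • θ.1) * f (ketDir (r.1 • θ.1)) =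
        ENNReal.ofReal (Real.exp (-1 * r.1 ^ 2)) * f θ := by
    intro θ r
    rw [gaussWeight_smul, mem_sphere_zero_iff_norm.1 θ.2, one_pow, mul_one,
      ketDir_smul r.2, ketDir_unitKet]
  simp only [this]
  simp only [lintegral_mul_const _ (show Measurable fun r : Set.Ioi (0 : ℝ) =>
    ENNReal.ofReal (Real.exp (-1 * r.1 ^ 2)) by fun_prop)]
  rw [lintegral_const_mul _ hf, toSphere_eq_smul_haarKet, lintegral_smul_measure, smul_eq_mul]
  have := toSphere_mul_lintegral_exp n one_pos
  rw [div_one] at this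
  rw [← mul_assoc _ (_ : ENNReal) (lintegral (haarKet n) f), mul_comm _ (Measure.toSphere _ _),
    this, ← mul_assoc, ENNReal.inv_mul_cancel (ofReal_pi_pow_ne_zero n) ENNReal.ofReal_ne_top,
    one_mul]

theorem ae_gaussKet_ne_zero (n : ℕ) : ∀ᵐ v ∂gaussKet n, v ≠ 0 := by
  have : ∀ᵐ v ∂(volume.withDensity (gaussWeight (n := n) 1)), v ≠ 0 :=
    (withDensity_absolutelyContinuous _ _).ae_le (Measure.ae_ne volume 0)
  exact Measure.ae_smul_measure this _

/-- The directions of the blocks of a Haar-random state are independent Haar-random states. -/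
theorem map_ketDir_ketBlock_haarKet (d n : ℕ) :
    (haarKet (d + n)).map (fun θ (x : Fin d → Bool) => ketDir (ketBlock x θ.1)) =
      Measure.pi fun _ => haarKet n := by
  have hm : Measurable fun (θ : UnitKet (d + n)) (x : Fin d → Bool) => ketDir (ketBlock x θ.1) :=
    measurable_pi_lambda _ fun x => ((measurable_ketDir n).comp (measurable_ketBlock x)).comp
      measurable_subtype_coe
  rw [← map_ketDir_gaussKet, Measure.map_map hm (measurable_ketDir _)]
  have h1 : (gaussKet (d + n)).map ((fun (θ : UnitKet (d + n)) (x : Fin d → Bool) =>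
        ketDir (ketBlock x θ.1)) ∘ ketDir) =
      (gaussKet (d + n)).map ((fun g x => ketDir (g x)) ∘ ketBlockEquiv d n) := by
    refine Measure.map_congr ((ae_gaussKet_ne_zero _).mono fun v hv => ?_)
    funext x
    have e : (ketDir v).1 = ‖v‖⁻¹ • v := by
      simp only [ketDir, dif_neg hv, Complex.coe_smul]
    refine Eq.trans (b := ketDir (ketBlock x (ketDir v).1)) rfl ?_
    rw [e, ketBlock_smul, ketDir_smul (inv_pos.2 (norm_pos_iff.2 hv))]
    rfl
  have hm' : Measurable fun (g : (Fin d → Bool) → KetSpace n) x => ketDir (g x) :=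
    measurable_pi_lambda _ fun x => (measurable_ketDir n).comp (measurable_pi_apply x)
  rw [h1, ← Measure.map_map hm' (ketBlockEquiv d n).continuous.measurable,
    map_ketBlockEquiv_gaussKet, Measure.pi_map_pi fun _ => (measurable_ketDir n).aemeasurable]
  simp only [map_ketDir_gaussKet]

/-- The directions of some of the blocks, at distinct prefixes. -/
theorem map_ketDir_ketBlock_comp_haarKet {d n s : ℕ} (x : Fin s → (Fin d → Bool))
    (hx : Function.Injective x) :
    (haarKet (d + n)).map (fun θ j => ketDir (ketBlock (x j) θ.1)) =
      Measure.pi fun _ => haarKet n := by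
  have hm : ∀ y : Fin d → Bool, Measurable fun θ : UnitKet (d + n) => ketDir (ketBlock y θ.1) :=
    fun y => ((measurable_ketDir n).comp (measurable_ketBlock y)).comp measurable_subtype_coe
  have h1 : ∀ y : Fin d → Bool,
      (haarKet (d + n)).map (fun θ => ketDir (ketBlock y θ.1)) = haarKet n := by
    intro y
    have h := congrArg (Measure.map (Function.eval y)) (map_ketDir_ketBlock_haarKet d n)
    rw [Measure.map_map (measurable_pi_apply y) (measurable_pi_lambda _ hm),
      (measurePreserving_eval (fun _ : Fin d → Bool => haarKet n) y).map_eq] at h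
    exact h
  have h2 : ProbabilityTheory.iIndepFun
      (fun (y : Fin d → Bool) (θ : UnitKet (d + n)) => ketDir (ketBlock y θ.1))
      (haarKet (d + n)) := by
    rw [ProbabilityTheory.iIndepFun_iff_map_fun_eq_pi_map fun y => (hm y).aemeasurable,
      map_ketDir_ketBlock_haarKet]
    simp only [h1]
  rw [(h2.precomp hx).map_fun_eq_pi_map fun j => (hm _).aemeasurable]
  simp only [h1]

/-- The Gaussian average of `exp (-a * ‖ketBlock x v‖ ^ 2)` in two ways: on the right from the law
of the block, on the left in polar coordinates, where the radial integral at the direction `θ` is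
`(1 + a * ‖ketBlock x θ‖ ^ 2) ^ (-2 ^ (d + n))`. -/
theorem lintegral_haarKet_ketBlock {d n : ℕ} (x : Fin d → Bool) {a : ℝ} (ha : 0 ≤ a) :
    ∫⁻ θ, ENNReal.ofReal (((1 + a * ‖ketBlock x θ.1‖ ^ 2) ^ (2 ^ (d + n)))⁻¹) ∂haarKet (d + n) =
      ENNReal.ofReal (((1 + a) ^ (2 ^ n))⁻¹) := by
  have hpi := Real.pi_pos
  have hm : Measurable fun v : KetSpace (d + n) => gaussWeight a (ketBlock x v) :=
    (measurable_gaussWeight a).comp (measurable_ketBlock x)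
  have h1 : ∫⁻ v, gaussWeight a (ketBlock x v) ∂gaussKet (d + n) =
      ENNReal.ofReal (((1 + a) ^ (2 ^ n))⁻¹) := by
    have e := lintegral_map (μ := gaussKet (d + n))
      ((measurable_gaussWeight (n := n) a).comp (measurable_pi_apply x))
      (ketBlockEquiv d n).continuous.measurable
    rw [map_ketBlockEquiv_gaussKet] at e
    refine Eq.trans e.symm ?_
    rw [← lintegral_gaussKet_gaussWeight n ha]
    exact (measurePreserving_eval (fun _ : Fin d → Bool => gaussKet n) x).lintegral_comp
      (measurable_gaussWeight a)
  have hgm : Measurable fun v : KetSpace (d + n) =>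
      gaussWeight 1 v * gaussWeight a (ketBlock x v) := (measurable_gaussWeight 1).mul hm
  rw [← h1, lintegral_gaussKet hm, lintegral_polar hgm,
    toSphere_eq_smul_haarKet, lintegral_smul_measure, smul_eq_mul]
  have h2 : ∀ (θ : UnitKet (d + n)) (r : Set.Ioi (0 : ℝ)),
      gaussWeight 1 (r.1 • θ.1) * gaussWeight a (ketBlock x (r.1 • θ.1)) =
        ENNReal.ofReal (Real.exp (-(1 + a * ‖ketBlock x θ.1‖ ^ 2) * r.1 ^ 2)) := by
    intro θ r
    rw [ketBlock_smul, gaussWeight_smul, gaussWeight_smul, mem_sphere_zero_iff_norm.1 θ.2,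
      ← ENNReal.ofReal_mul (Real.exp_pos _).le, ← Real.exp_add]
    congr 2
    ring
  simp only [h2]
  have hmeas : Measurable fun θ : UnitKet (d + n) => ∫⁻ r : Set.Ioi (0 : ℝ),
      ENNReal.ofReal (Real.exp (-(1 + a * ‖ketBlock x θ.1‖ ^ 2) * r.1 ^ 2))
        ∂Measure.volumeIoiPow (Module.finrank ℝ (KetSpace (d + n)) - 1) := by
    refine Measurable.lintegral_prod_right' (f := fun p : UnitKet (d + n) × Set.Ioi (0 : ℝ) =>
      ENNReal.ofReal (Real.exp (-(1 + a * ‖ketBlock x p.1.1‖ ^ 2) * p.2.1 ^ 2))) ?_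
    have h : Measurable fun p : UnitKet (d + n) × Set.Ioi (0 : ℝ) => ‖ketBlock x p.1.1‖ :=
      ((measurable_ketBlock (n := n) x).comp (measurable_subtype_coe.comp measurable_fst)).norm
    fun_prop
  rw [← lintegral_const_mul _ hmeas, ← lintegral_const_mul _ (hmeas.const_mul _)]
  refine lintegral_congr fun θ => ?_
  have hp : 0 < 1 + a * ‖ketBlock x θ.1‖ ^ 2 := by positivity
  rw [toSphere_mul_lintegral_exp _ hp, ← ENNReal.ofReal_inv_of_pos (by positivity),
    ← ENNReal.ofReal_mul (by positivity), div_pow]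
  congr 1
  field_simp

/-! ### Post-selection from Haar-random states -/

/-- The probability that the outcome `x` does not occur in `2 ^ d * l` rounds, averaged over a
Haar-random state. -/
theorem integral_one_sub_pow_le {d n : ℕ} (l : ℕ) (x : Fin d → Bool) :
    ∫ θ, (1 - ‖ketBlock x θ.1‖ ^ 2) ^ (2 ^ d * l) ∂haarKet (d + n) ≤
      ((1 + (l : ℝ) / 2 ^ n) ^ (2 ^ n))⁻¹ := by
  set a : ℝ := (l : ℝ) / 2 ^ n with ha
  have ha0 : 0 ≤ a := by positivity
  have hcont : Continuous fun θ : UnitKet (d + n) => ketBlock x θ.1 :=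
    ((continuous_apply x).comp (ketBlockEquiv d n).continuous).comp continuous_subtype_val
  have hpt : ∀ θ : UnitKet (d + n), (1 - ‖ketBlock x θ.1‖ ^ 2) ^ (2 ^ d * l) ≤
      ((1 + a * ‖ketBlock x θ.1‖ ^ 2) ^ (2 ^ (d + n)))⁻¹ := by
    intro θ
    have h1 := norm_ketBlock_le x θ
    set p := ‖ketBlock x θ.1‖ ^ 2
    have h0 : 0 ≤ p := by positivity
    -- Both sides are compared with `exp (-(2 ^ d * l * p))`.
    have e1 : (1 - p) ^ (2 ^ d * l) ≤ Real.exp (-(2 ^ d * l * p)) := by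
      refine (pow_le_pow_left₀ (by linarith) (Real.one_sub_le_exp_neg p) _).trans_eq ?_
      rw [← Real.exp_nat_mul]
      congr 1
      push_cast
      ring
    have e2 : (1 + a * p) ^ (2 ^ (d + n)) ≤ Real.exp (2 ^ d * l * p) := by
      refine (pow_le_pow_left₀ (by positivity)
        ((add_comm 1 _).trans_le (Real.add_one_le_exp (a * p))) _).trans_eq ?_
      rw [← Real.exp_nat_mul]
      congr 1
      rw [ha]
      push_cast
      rw [pow_add]
      field_simp
    refine e1.trans ?_
    rw [Real.exp_neg]
    exact inv_anti₀ (by positivity) e2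
  have hbase : ∀ θ : UnitKet (d + n), 0 < 1 + a * ‖ketBlock x θ.1‖ ^ 2 := fun θ => by positivity
  have hc : Continuous fun θ : UnitKet (d + n) =>
      ((1 + a * ‖ketBlock x θ.1‖ ^ 2) ^ (2 ^ (d + n)))⁻¹ :=
    Continuous.inv₀ (by fun_prop) fun θ => (pow_pos (hbase θ) _).ne'
  have hint : Integrable (fun θ : UnitKet (d + n) =>
      ((1 + a * ‖ketBlock x θ.1‖ ^ 2) ^ (2 ^ (d + n)))⁻¹) (haarKet (d + n)) :=
    hc.integrable_of_hasCompactSupport (HasCompactSupport.of_compactSpace _)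
  refine (integral_mono ((show Continuous fun θ : UnitKet (d + n) =>
    (1 - ‖ketBlock x θ.1‖ ^ 2) ^ (2 ^ d * l) by fun_prop).integrable_of_hasCompactSupport
    (HasCompactSupport.of_compactSpace _)) hint hpt).trans_eq ?_
  rw [integral_eq_lintegral_of_nonneg_ae (Eventually.of_forall fun θ => by
    have := hbase θ
    positivity) hc.aestronglyMeasurable, lintegral_haarKet_ketBlock x ha0,
    ENNReal.toReal_ofReal (by positivity)]

section AcceptOutputs

variable {d n s t a : ℕ}

/-- The acceptance probability of a distinguisher that is given the inputs `x j` and a family of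
outputs, `t` of them for each input. -/
def acceptOutputs (A : QCircuit (((Fin s × Fin d) ⊕ (Fin s × (Fin t × Option (Fin n)))) ⊕ Fin a)
    Unit) (x : Fin s → (Fin d → Bool)) (σ : QOp (Fin a))
    (ω : Fin s × Fin t → QOp (Option (Fin n))) : ℝ :=
  acceptProb A (tensorState (basisState (fun p => x p.1 p.2))
    (tensorFamily fun j => tensorFamily fun i => ω (j, i))) σ

variable (A : QCircuit (((Fin s × Fin d) ⊕ (Fin s × (Fin t × Option (Fin n)))) ⊕ Fin a) Unit)
  (x : Fin s → (Fin d → Bool)) (σ : QOp (Fin a))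

theorem acceptOutputs_eq_sum :
    ∃ K : (((Fin s × Fin d) ⊕ (Fin s × (Fin t × Option (Fin n)))) → Bool) →
      (((Fin s × Fin d) ⊕ (Fin s × (Fin t × Option (Fin n)))) → Bool) → ℂ,
    ∀ ω, acceptOutputs A x σ ω = (∑ v, ∑ v',
      (∏ p : Fin s × Fin t, ω p (fun o => v (Sum.inr (p.1, (p.2, o))))
        (fun o => v' (Sum.inr (p.1, (p.2, o))))) * K v v').re := by
  obtain ⟨K, hK⟩ := acceptProb_eq_sum A σ
  refine ⟨fun v v' => basisState (fun p : Fin s × Fin d => x p.1 p.2)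
    (fun i => v (Sum.inl i)) (fun i => v' (Sum.inl i)) * K v v', fun ω => ?_⟩
  rw [acceptOutputs, hK]
  congr 1
  refine Finset.sum_congr rfl fun v _ => Finset.sum_congr rfl fun v' _ => ?_
  simp only [tensorState, tensorFamily, Matrix.of_apply, Fintype.prod_prod_type]
  ring

theorem acceptOutputs_mem (hσ : IsDensity σ) (ω : Fin s × Fin t → QOp (Option (Fin n)))
    (hω : ∀ p, IsDensity (ω p)) :
    0 ≤ acceptOutputs A x σ ω ∧ acceptOutputs A x σ ω ≤ 1 :=
  acceptProb_mem A ((isDensity_basisState _).tensorState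
    (IsDensity.tensorFamily fun _ => IsDensity.tensorFamily fun _ => hω _)) hσ

theorem prod_update_apply {S Q : Type} [Fintype S] [DecidableEq S] (ω : S → QOp Q) (r : S)
    (τ : QOp Q) (v w : S → Q → Bool) :
    ∏ p, Function.update ω r τ p (v p) (w p) =
      τ (v r) (w r) * ∏ p ∈ Finset.univ.erase r, ω p (v p) (w p) := by
  rw [← Finset.mul_prod_erase _ _ (Finset.mem_univ r), Function.update_self]
  congr 1
  refine Finset.prod_congr rfl fun p hp => ?_
  rw [Function.update_of_ne (Finset.ne_of_mem_erase hp)]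

theorem acceptOutputs_update_mix (ω : Fin s × Fin t → QOp (Option (Fin n))) (r : Fin s × Fin t)
    (f : ℝ) (α β : QOp (Option (Fin n))) :
    acceptOutputs A x σ (Function.update ω r (((1 - f : ℝ) : ℂ) • α + (f : ℂ) • β)) =
      (1 - f) * acceptOutputs A x σ (Function.update ω r α) +
        f * acceptOutputs A x σ (Function.update ω r β) := by
  obtain ⟨K, hK⟩ := acceptOutputs_eq_sum A x σ
  simp only [hK]
  rw [← Complex.re_ofReal_mul, ← Complex.re_ofReal_mul, ← Complex.add_re]
  congr 1
  simp only [Finset.mul_sum, ← Finset.sum_add_distrib]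
  refine Finset.sum_congr rfl fun v _ => Finset.sum_congr rfl fun v' _ => ?_
  have := fun τ => prod_update_apply ω r τ (fun p o => v (Sum.inr (p.1, (p.2, o))))
    (fun p o => v' (Sum.inr (p.1, (p.2, o))))
  rw [this, this, this]
  simp only [Matrix.add_apply, Matrix.smul_apply, smul_eq_mul]
  ring

theorem measurable_acceptOutputs {Ω : Type*} [MeasurableSpace Ω]
    (ω : Ω → Fin s × Fin t → QOp (Option (Fin n)))
    (hω : ∀ p v w, Measurable fun θ => ω θ p v w) :
    Measurable fun θ => acceptOutputs A x σ (ω θ) := by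
  obtain ⟨K, hK⟩ := acceptOutputs_eq_sum A x σ
  simp only [hK]
  refine Complex.measurable_re.comp (Finset.measurable_sum _ fun v _ =>
    Finset.measurable_sum _ fun v' _ => Measurable.mul_const ?_ _)
  exact Finset.measurable_prod _ fun p _ => hω _ _ _

theorem measurable_noAbort_pureState (v w : Option (Fin n) → Bool) :
    Measurable fun θ : UnitKet n => noAbort (pureState θ) v w := by
  have : Continuous fun θ : UnitKet n => noAbort (pureState θ) v w := by
    simp only [noAbort_apply, pureState, Matrix.of_apply]
    have h : ∀ u : Fin n → Bool, Continuous fun θ : UnitKet n => θ.1 u := fun u => by fun_prop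
    have h1 := h fun i => v (some i)
    have h2 := h fun i => w (some i)
    fun_prop
  exact this.measurable

theorem integrable_of_mem_unit {Ω : Type*} [MeasurableSpace Ω] {μ : Measure Ω}
    [IsFiniteMeasure μ] {f : Ω → ℝ} (hf : Measurable f) (h : ∀ θ, 0 ≤ f θ ∧ f θ ≤ 1) :
    Integrable f μ :=
  Integrable.of_bound hf.aestronglyMeasurable 1 (Eventually.of_forall fun θ => by
    rw [Real.norm_of_nonneg (h θ).1]
    exact (h θ).2)

/-- Post-selecting the prefixes `x j` from copies of a single Haar-random state is almost as good
as being given independent Haar-random states. -/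
theorem abs_integral_postSelect_sub_le (hx : Function.Injective x) (hσ : IsDensity σ) (l : ℕ) :
    |∫ θ, acceptOutputs A x σ (fun p => postSelect (2 ^ d * l) (noAbort (pureState θ)) (x p.1))
          ∂haarKet (d + n) -
        ∫ θ : Fin s → UnitKet n, acceptOutputs A x σ (fun p => noAbort (pureState (θ p.1)))
          ∂(Measure.pi fun _ => haarKet n)| ≤
      s * t * ((1 + (l : ℝ) / 2 ^ n) ^ (2 ^ n))⁻¹ := by
  let f : UnitKet (d + n) → Fin s → ℝ := fun θ j => (1 - ‖ketBlock (x j) θ.1‖ ^ 2) ^ (2 ^ d * l)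
  let u : UnitKet (d + n) → Fin s → UnitKet n := fun θ j => ketDir (ketBlock (x j) θ.1)
  have hf0 : ∀ θ j, 0 ≤ f θ j := fun θ j =>
    pow_nonneg (sub_nonneg.2 (norm_ketBlock_le (x j) θ)) _
  have hf1 : ∀ θ j, f θ j ≤ 1 := fun θ j =>
    pow_le_one₀ (sub_nonneg.2 (norm_ketBlock_le (x j) θ)) (sub_le_self 1 (by positivity))
  have hu : ∀ j, Measurable fun θ => u θ j := fun j =>
    ((measurable_ketDir n).comp (measurable_ketBlock (x j))).comp measurable_subtype_coe
  have hfc : ∀ j, Continuous fun θ => f θ j := by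
    intro j
    have hcont : Continuous fun θ : UnitKet (d + n) => ketBlock (x j) θ.1 :=
      ((continuous_apply (x j)).comp (ketBlockEquiv d n).continuous).comp continuous_subtype_val
    fun_prop
  have hfi : ∀ j, Integrable (fun θ => f θ j) (haarKet (d + n)) := fun j =>
    integrable_of_mem_unit (hfc j).measurable fun θ => ⟨hf0 θ j, hf1 θ j⟩
  have hps : ∀ θ j, postSelect (2 ^ d * l) (noAbort (pureState θ)) (x j) =
      ((1 - f θ j : ℝ) : ℂ) • noAbort (pureState (u θ j)) + ((f θ j : ℝ) : ℂ) • abortState n :=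
    fun θ j => postSelect_eq ((prefixBlock_noAbort_pureState (x j) θ).trans
      (ketMat_eq_smul_pureState _)) _
  simp only [hps]
  have hud : ∀ θ (p : Fin s × Fin t), IsDensity (noAbort (pureState (u θ p.1))) :=
    fun θ p => isDensity_noAbort_pureState _
  have habort : IsDensity (abortState n) := isDensity_basisState _
  -- The second integral is an integral over the same Haar-random state.
  have hm2 : Measurable fun θ : Fin s → UnitKet n =>
      acceptOutputs A x σ (fun p : Fin s × Fin t => noAbort (pureState (θ p.1))) :=
    measurable_acceptOutputs A x σ _ fun p v w =>
      (measurable_noAbort_pureState v w).comp (measurable_pi_apply p.1)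
  have h2 : ∫ θ : Fin s → UnitKet n, acceptOutputs A x σ (fun p => noAbort (pureState (θ p.1)))
      ∂(Measure.pi fun _ => haarKet n) =
      ∫ θ, acceptOutputs A x σ (fun p => noAbort (pureState (u θ p.1))) ∂haarKet (d + n) := by
    rw [← map_ketDir_ketBlock_comp_haarKet x hx]
    exact integral_map (measurable_pi_lambda _ hu).aemeasurable hm2.aestronglyMeasurable
  have hm1 : Measurable fun θ => acceptOutputs A x σ (fun p : Fin s × Fin t =>
      ((1 - f θ p.1 : ℝ) : ℂ) • noAbort (pureState (u θ p.1)) +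
        ((f θ p.1 : ℝ) : ℂ) • abortState n) := by
    refine measurable_acceptOutputs A x σ _ fun p v w => ?_
    simp only [Matrix.add_apply, Matrix.smul_apply, smul_eq_mul]
    have e1 := (measurable_noAbort_pureState v w).comp (hu p.1)
    have e2 := (hfc p.1).measurable
    simp only [Function.comp_def] at e1
    fun_prop
  have i1 : Integrable (fun θ => acceptOutputs A x σ (fun p : Fin s × Fin t =>
      ((1 - f θ p.1 : ℝ) : ℂ) • noAbort (pureState (u θ p.1)) +
        ((f θ p.1 : ℝ) : ℂ) • abortState n)) (haarKet (d + n)) :=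
    integrable_of_mem_unit hm1 fun θ => acceptOutputs_mem A x σ hσ _ fun p =>
      (hud θ p).mix habort (hf0 θ p.1) (hf1 θ p.1)
  have i2 : Integrable (fun θ => acceptOutputs A x σ (fun p : Fin s × Fin t =>
      noAbort (pureState (u θ p.1)))) (haarKet (d + n)) :=
    integrable_of_mem_unit (hm2.comp (measurable_pi_lambda _ hu)) fun θ =>
      acceptOutputs_mem A x σ hσ _ fun p => hud θ p
  rw [h2, ← integral_sub i1 i2]
  refine (abs_integral_le_integral_abs).trans ?_
  have hpt : ∀ θ, |acceptOutputs A x σ (fun p : Fin s × Fin t =>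
      ((1 - f θ p.1 : ℝ) : ℂ) • noAbort (pureState (u θ p.1)) +
        ((f θ p.1 : ℝ) : ℂ) • abortState n) -
      acceptOutputs A x σ (fun p : Fin s × Fin t => noAbort (pureState (u θ p.1)))| ≤
      ∑ p : Fin s × Fin t, f θ p.1 := fun θ =>
    abs_sub_le_sum_of_mix (acceptOutputs A x σ) (acceptOutputs_mem A x σ hσ)
      (acceptOutputs_update_mix A x σ) (fun p => noAbort (pureState (u θ p.1)))
      (fun _ => abortState n) (hud θ) (fun _ => habort) (fun p => f θ p.1)
      (fun p => hf0 θ p.1) (fun p => hf1 θ p.1)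
  refine (integral_mono (i1.sub i2).abs
    (integrable_finsetSum _ fun p _ => hfi p.1) hpt).trans ?_
  rw [integral_finsetSum _ fun p _ => hfi p.1]
  refine (Finset.sum_le_card_nsmul _ _ _ fun p _ => integral_one_sub_pow_le l (x p.1)).trans_eq ?_
  simp

end AcceptOutputs

/-! ### The reduction -/

theorem IsDensity.submatrix_equiv {R Q : Type} [Fintype R] [DecidableEq R] [Fintype Q]
    [DecidableEq Q] {σ : QOp R} (hσ : IsDensity σ) (e : Q ≃ R) :
    IsDensity (σ.submatrix (fun v : Q → Bool => v ∘ e.symm) (fun v => v ∘ e.symm)) := by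
  refine ⟨hσ.1.submatrix _, ?_⟩
  rw [← hσ.2]
  exact (e.arrowCongr (Equiv.refl Bool)).sum_comp fun w => σ w w

section Reduction

variable {d n s t a : ℕ} (q : ℕ)

/-- The advice register of the reduction: the inputs, the inputs once more for each of the
post-selections, and the advice register of the given distinguisher. -/
abbrev ReductionAdvice (d s t a : ℕ) : Type :=
  ((Fin s × Fin d) ⊕ (Fin s × (Fin t × Fin d))) ⊕ Fin a

/-- The rearrangement of the copies and the advice to the input register of the
post-selections followed by the given distinguisher. -/
def reductionShuffle (d n s t a q : ℕ) :
    ((Fin s × (Fin t × Fin q)) × Option (Fin (d + n))) ⊕ ReductionAdvice d s t a ≃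
      ((Fin s × Fin d) ⊕ (Fin s × (Fin t × ((Fin q × Option (Fin (d + n))) ⊕ Fin d)))) ⊕
        Fin a where
  toFun
    | .inl ((j, i, r), o) => .inl (.inr (j, i, .inl (r, o)))
    | .inr (.inl (.inl p)) => .inl (.inl p)
    | .inr (.inl (.inr (j, i, b))) => .inl (.inr (j, i, .inr b))
    | .inr (.inr c) => .inr c
  invFun
    | .inl (.inr (j, i, .inl (r, o))) => .inl ((j, i, r), o)
    | .inl (.inl p) => .inr (.inl (.inl p))
    | .inl (.inr (j, i, .inr b)) => .inr (.inl (.inr (j, i, b)))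
    | .inr c => .inr (.inr c)
  left_inv := by rintro (⟨⟨j, i, r⟩, o⟩ | (p | ⟨j, i, b⟩) | c) <;> rfl
  right_inv := by rintro ((p | ⟨j, i, ⟨r, o⟩ | b⟩) | c) <;> rfl

/-- The number of states that the reduction consumes. -/
def reductionCopies (s t q : ℕ) : ℕ := Fintype.card (Fin s × (Fin t × Fin q))

/-- The number of qubits of advice of the reduction. -/
def reductionAdviceSize (d s t a : ℕ) : ℕ := Fintype.card (ReductionAdvice d s t a)

/-- The numbering of the copies. -/
def reductionCopiesEquiv (s t q : ℕ) : Fin (reductionCopies s t q) ≃ Fin s × (Fin t × Fin q) :=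
  (Fintype.equivFin _).symm

/-- The numbering of the advice qubits. -/
def reductionAdviceEquiv (d s t a : ℕ) :
    Fin (reductionAdviceSize d s t a) ≃ ReductionAdvice d s t a :=
  (Fintype.equivFin _).symm

/-- The identification of the input registers. -/
def reductionEquiv (d n s t a q : ℕ) :
    (Fin (reductionCopies s t q) × Option (Fin (d + n))) ⊕ Fin (reductionAdviceSize d s t a) ≃
      ((Fin s × Fin d) ⊕ (Fin s × (Fin t × ((Fin q × Option (Fin (d + n))) ⊕ Fin d)))) ⊕
        Fin a :=
  (((reductionCopiesEquiv s t q).prodCongr (Equiv.refl _)).sumCongr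
    (reductionAdviceEquiv d s t a)).trans (reductionShuffle d n s t a q)

/-- The distinguisher for the state generator: run `s * t` post-selections on the given copies,
then the given distinguisher. -/
def reduction
    (A : QCircuit (((Fin s × Fin d) ⊕ (Fin s × (Fin t × Option (Fin n)))) ⊕ Fin a) Unit) :
    QCircuit ((Fin (reductionCopies s t q) × Option (Fin (d + n))) ⊕
      Fin (reductionAdviceSize d s t a)) Unit :=
  ((((QCircuit.ident (Fin s × Fin d)).par (((postSelectCircuit d n q).copies t).copies s)).par
    (QCircuit.ident (Fin a))).comp A).reindexIn
    (reductionEquiv d n s t a q)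

/-- The advice state of the reduction. -/
def reductionAdvice (t : ℕ) (x : Fin s → (Fin d → Bool)) (σ : QOp (Fin a)) :
    QOp (Fin (reductionAdviceSize d s t a)) :=
  (tensorState (tensorState (basisState fun p : Fin s × Fin d => x p.1 p.2)
    (tensorFamily fun j => tensorFamily fun _ : Fin t => basisState (x j))) σ).submatrix
    (fun v => v ∘ (reductionAdviceEquiv d s t a).symm)
    (fun v => v ∘ (reductionAdviceEquiv d s t a).symm)

theorem isDensity_reductionAdvice (x : Fin s → (Fin d → Bool)) {σ : QOp (Fin a)}
    (hσ : IsDensity σ) : IsDensity (reductionAdvice t x σ) :=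
  (((isDensity_basisState _).tensorState (IsDensity.tensorFamily fun _ =>
    IsDensity.tensorFamily fun _ => isDensity_basisState _)).tensorState hσ).submatrix_equiv
    (reductionAdviceEquiv d s t a)

theorem acceptProb_reduction
    (A : QCircuit (((Fin s × Fin d) ⊕ (Fin s × (Fin t × Option (Fin n)))) ⊕ Fin a) Unit)
    (x : Fin s → (Fin d → Bool)) (σ : QOp (Fin a)) (ρ : QOp (Option (Fin (d + n))))
    (hρ : ρ.trace = 1) :
    acceptProb (reduction q A) (tensorFamily fun _ => ρ) (reductionAdvice t x σ) =
      acceptOutputs A x σ fun p => postSelect q ρ (x p.1) := by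
  have h : (tensorState (tensorFamily fun _ : Fin (reductionCopies s t q) => ρ)
      (reductionAdvice t x σ)).submatrix
      (fun v => v ∘ reductionEquiv d n s t a q) (fun v => v ∘ reductionEquiv d n s t a q) =
      tensorState (tensorState (basisState fun p : Fin s × Fin d => x p.1 p.2)
        (tensorFamily fun j => tensorFamily fun _ : Fin t =>
          tensorState (tensorFamily fun _ : Fin q => ρ) (basisState (x j)))) σ := by
    ext v w
    have h1 : ∏ r, ρ
        (fun o => v (reductionEquiv d n s t a q (Sum.inl (r, o))))
        (fun o => w (reductionEquiv d n s t a q (Sum.inl (r, o)))) =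
        ∏ j, ∏ i, ∏ r, ρ (fun o => v (Sum.inl (Sum.inr (j, i, Sum.inl (r, o)))))
          (fun o => w (Sum.inl (Sum.inr (j, i, Sum.inl (r, o))))) := by
      refine Eq.trans ((reductionCopiesEquiv s t q).prod_comp fun p => ρ
        (fun o => v (reductionShuffle d n s t a q (Sum.inl (p, o))))
        (fun o => w (reductionShuffle d n s t a q (Sum.inl (p, o))))) ?_
      simp only [Fintype.prod_prod_type]
      rfl
    have h2 : ∀ i, reductionEquiv d n s t a q (Sum.inr ((reductionAdviceEquiv d s t a).symm i)) =
        reductionShuffle d n s t a q (Sum.inr i) := fun i =>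
      congrArg (fun i => reductionShuffle d n s t a q (Sum.inr i))
        ((reductionAdviceEquiv d s t a).apply_symm_apply i)
    simp only [Matrix.submatrix_apply, tensorState, tensorFamily, Matrix.of_apply, reductionAdvice,
      Function.comp_def, h2, Finset.prod_mul_distrib]
    rw [h1]
    simp only [reductionShuffle, Equiv.coe_fn_mk]
    ring
  rw [acceptProb, reduction, QCircuit.channel_reindexIn, h, QCircuit.channel_comp,
    QCircuit.channel_par, QCircuit.channel_par, QCircuit.channel_ident, QCircuit.channel_ident,
    QCircuit.channel_copies, acceptOutputs, acceptProb]
  simp only [QCircuit.channel_copies, channel_postSelectCircuit q ρ hρ]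

theorem size_reduction_le
    (A : QCircuit (((Fin s × Fin d) ⊕ (Fin s × (Fin t × Option (Fin n)))) ⊕ Fin a) Unit) :
    (reduction q A).size ≤ s * (t * ((122 * q + 40) * (d + n + 2))) + 2 * A.size := by
  have h1 : 2 * (s * d) + 2 * a ≤ A.size := by
    have h := Fintype.card_le_of_embedding A.inp
    simp only [Fintype.card_sum, Fintype.card_prod, Fintype.card_fin, Fintype.card_option] at h
    rw [QCircuit.size]
    omega
  rw [reduction, QCircuit.size_reindexIn, QCircuit.size_comp, QCircuit.size_par,
    QCircuit.size_par, QCircuit.size_copies, QCircuit.size_copies, QCircuit.size_ident,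
    QCircuit.size_ident, Fintype.card_prod, Fintype.card_fin, Fintype.card_fin, Fintype.card_fin]
  have h2 : s * (t * (postSelectCircuit d n q).size) ≤
      s * (t * ((122 * q + 40) * (d + n + 2))) :=
    Nat.mul_le_mul_left _ (Nat.mul_le_mul_left _ (size_selectCircuit_le d n q))
  omega

end Reduction

/-! ### Asymptotics -/

theorem PolyBounded.mono {f g : ℕ → ℕ} (hg : PolyBounded g) (h : ∀ l, f l ≤ g l) :
    PolyBounded f := by
  obtain ⟨p, hp⟩ := hg
  exact ⟨p, fun l => (h l).trans (hp l)⟩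

theorem PolyBounded.add {f g : ℕ → ℕ} (hf : PolyBounded f) (hg : PolyBounded g) :
    PolyBounded fun l => f l + g l := by
  obtain ⟨p, hp⟩ := hf
  obtain ⟨r, hr⟩ := hg
  exact ⟨p + r, fun l => by
    rw [Polynomial.eval_add]
    exact add_le_add (hp l) (hr l)⟩

theorem PolyBounded.mul {f g : ℕ → ℕ} (hf : PolyBounded f) (hg : PolyBounded g) :
    PolyBounded fun l => f l * g l := by
  obtain ⟨p, hp⟩ := hf
  obtain ⟨r, hr⟩ := hg
  exact ⟨p * r, fun l => by
    rw [Polynomial.eval_mul]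
    exact Nat.mul_le_mul (hp l) (hr l)⟩

theorem PolyBounded.const (c : ℕ) : PolyBounded fun _ => c :=
  ⟨Polynomial.C c, fun l => by simp⟩

theorem PolyBounded.id : PolyBounded fun l => l :=
  ⟨Polynomial.X, fun l => by simp⟩

theorem PolyBounded.of_eventually_le_pow {f : ℕ → ℕ} {K : ℕ} (h : ∀ᶠ l in atTop, f l ≤ l ^ K) :
    PolyBounded f := by
  obtain ⟨N, hN⟩ := eventually_atTop.1 h
  refine ⟨Polynomial.X ^ K + Polynomial.C (∑ i ∈ Finset.range N, f i), fun l => ?_⟩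
  simp only [Polynomial.eval_add, Polynomial.eval_pow, Polynomial.eval_X, Polynomial.eval_C]
  by_cases hl : N ≤ l
  · exact (hN l hl).trans (Nat.le_add_right _ _)
  · exact (Finset.single_le_sum (f := f) (fun _ _ => Nat.zero_le _)
      (Finset.mem_range.2 (not_le.1 hl))).trans (Nat.le_add_left _ _)

theorem polyBounded_two_pow {d : ℕ → ℕ}
    (hd : (fun l : ℕ => (d l : ℝ)) =O[atTop] (fun l : ℕ => Real.log (l : ℝ))) :
    PolyBounded fun l => 2 ^ d l := by
  obtain ⟨C, hC⟩ := hd.bound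
  refine PolyBounded.of_eventually_le_pow (K := ⌈C⌉₊) ?_
  filter_upwards [hC, eventually_ge_atTop 1] with l hl h1
  have hl1 : (1 : ℝ) ≤ l := by exact_mod_cast h1
  have hlog := Real.log_nonneg hl1
  rw [Real.norm_of_nonneg (Nat.cast_nonneg _), Real.norm_of_nonneg hlog] at hl
  have h2 : (2 : ℝ) ^ d l ≤ (l : ℝ) ^ ⌈C⌉₊ := by
    calc (2 : ℝ) ^ d l ≤ Real.exp 1 ^ d l :=
          pow_le_pow_left₀ zero_le_two Real.exp_one_gt_two.le _
      _ = Real.exp (d l) := by rw [← Real.exp_nat_mul, mul_one]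
      _ ≤ Real.exp (⌈C⌉₊ * Real.log l) := Real.exp_le_exp.2
          (hl.trans (mul_le_mul_of_nonneg_right (Nat.le_ceil C) hlog))
      _ = (l : ℝ) ^ ⌈C⌉₊ := by
          rw [Real.exp_nat_mul, Real.exp_log (by linarith)]
  exact_mod_cast h2

theorem Negligible.mul_polyBounded {ε : ℕ → ℝ} (hε : Negligible ε) {f : ℕ → ℕ}
    (hf : PolyBounded f) : Negligible fun l => (f l : ℝ) * ε l := by
  obtain ⟨p, hp⟩ := hf
  refine (Asymptotics.SuperpolynomialDecay.polynomial_mul hε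
    (p.map (Nat.castRingHom ℝ))).trans_abs_le fun l => ?_
  have : (p.map (Nat.castRingHom ℝ)).eval (l : ℝ) = ((p.eval l : ℕ) : ℝ) := by
    simp
  rw [this, abs_mul, abs_mul, Nat.abs_cast, Nat.abs_cast]
  exact mul_le_mul_of_nonneg_right (by exact_mod_cast hp l) (abs_nonneg _)

/-- With `N = 2 ^ n`, the base satisfies `(1 + l / N) ^ N ≥ exp (N * l / (N + l))`, and both `N` and
`l` grow faster than every multiple of `log l`. -/
theorem negligible_inv_one_add_div_pow {n : ℕ → ℕ}
    (hn : Tendsto (fun l : ℕ => (n l : ℝ) / Real.log (Real.log (l : ℝ))) atTop atTop) :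
    Negligible fun l => ((1 + (l : ℝ) / 2 ^ n l) ^ (2 ^ n l))⁻¹ := by
  have hcast : Tendsto (fun l : ℕ => (l : ℝ)) atTop atTop := tendsto_natCast_atTop_atTop
  have hlog := Real.tendsto_log_atTop.comp hcast
  have hloglog := Real.tendsto_log_atTop.comp hlog
  intro k
  have hsmall : ∀ᶠ l : ℕ in atTop, Real.log l ≤ (1 / (2 * (k + 1) : ℝ)) * l := by
    have h := (Real.isLittleO_log_id_atTop.comp_tendsto hcast).bound
      (show (0 : ℝ) < 1 / (2 * (k + 1)) by positivity)
    filter_upwards [h, eventually_ge_atTop 1] with l hl h1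
    have hl1 : (1 : ℝ) ≤ l := by exact_mod_cast h1
    simpa [Real.norm_of_nonneg (Real.log_nonneg hl1)] using hl
  refine squeeze_zero' (g := fun l : ℕ => ((l : ℝ))⁻¹) (Eventually.of_forall fun l => by positivity)
    ?_ (tendsto_inv_atTop_zero.comp hcast)
  filter_upwards [hsmall, hlog.eventually_ge_atTop (2 * (k + 1) : ℝ),
    hloglog.eventually_gt_atTop 0, hn.eventually_ge_atTop 4, eventually_ge_atTop 1]
    with l h1 h2 h3 h4 h5
  simp only [Function.comp_apply] at h2 h3
  have hl : (0 : ℝ) < l := by exact_mod_cast h5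
  have hk : (0 : ℝ) < k + 1 := by positivity
  have hlogpos : 0 < Real.log l := lt_of_lt_of_le (by positivity) h2
  set N : ℝ := 2 ^ n l with hN
  have hNpos : 0 < N := by positivity
  -- `2 ^ n ≥ exp (2 * log (log l)) = (log l) ^ 2`
  have hNlog : 2 * (k + 1) * Real.log l ≤ N := by
    have e1 : 4 * Real.log (Real.log l) ≤ n l := (le_div_iff₀ h3).1 h4
    have e2 : Real.log l ^ 2 ≤ N := by
      rw [← Real.exp_log hNpos, hN, Real.log_pow, ← Real.exp_log hlogpos, ← Real.exp_nat_mul,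
        Real.exp_le_exp]
      have := Real.log_two_gt_d9
      push_cast
      nlinarith
    nlinarith
  have hllog : 2 * (k + 1) * Real.log l ≤ l := by
    rw [div_mul_eq_mul_div, one_mul, le_div_iff₀ (by positivity)] at h1
    linarith
  have hexp : (k + 1) * Real.log l ≤ N * ((l / N) / (1 + l / N)) := by
    have : N * ((l / N) / (1 + l / N)) = N * l / (N + l) := by field_simp
    rw [this, le_div_iff₀ (by positivity)]
    nlinarith
  have hbase : Real.exp ((l / N) / (1 + l / N)) ≤ 1 + l / N := by
    have hy : 0 < 1 + l / N := by positivity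
    have := Real.one_sub_le_exp_neg ((l / N) / (1 + l / N))
    rw [Real.exp_neg, show 1 - (l / N) / (1 + l / N) = (1 + l / N)⁻¹ by field_simp; ring] at this
    exact (inv_le_inv₀ hy (Real.exp_pos _)).1 this
  have hpow : (l : ℝ) ^ (k + 1) ≤ (1 + l / N) ^ (2 ^ n l) := by
    calc (l : ℝ) ^ (k + 1) = Real.exp ((k + 1) * Real.log l) := by
          rw [← Real.exp_log hl, ← Real.exp_nat_mul, Real.exp_log hl]
          push_cast
          rfl
      _ ≤ Real.exp (N * ((l / N) / (1 + l / N))) := Real.exp_le_exp.2 hexp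
      _ = Real.exp ((l / N) / (1 + l / N)) ^ (2 ^ n l) := by
          rw [← Real.exp_nat_mul]
          push_cast
          rfl
      _ ≤ _ := pow_le_pow_left₀ (Real.exp_pos _).le hbase _
  calc (l : ℝ) ^ k * ((1 + (l : ℝ) / N) ^ (2 ^ n l))⁻¹ ≤ (l : ℝ) ^ k * ((l : ℝ) ^ (k + 1))⁻¹ := by
        gcongr
    _ = (l : ℝ)⁻¹ := by
        rw [pow_succ]
        field_simp

theorem tendsto_div_log_log {d n : ℕ → ℕ}
    (hn : Tendsto (fun l : ℕ => ((n l : ℝ) - (d l : ℝ)) / Real.log (Real.log (l : ℝ)))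
      atTop atTop) :
    Tendsto (fun l : ℕ => (n l : ℝ) / Real.log (Real.log (l : ℝ))) atTop atTop := by
  have hloglog := Real.tendsto_log_atTop.comp
    (Real.tendsto_log_atTop.comp (tendsto_natCast_atTop_atTop (R := ℝ)))
  refine tendsto_atTop_mono' _ ?_ hn
  filter_upwards [hloglog.eventually_gt_atTop 0] with l hl
  have hd : (0 : ℝ) ≤ d l := Nat.cast_nonneg _
  exact div_le_div_of_nonneg_right (by linarith) (le_of_lt hl)

/-! ### Pseudorandom function-like states from pseudorandom states -/

theorem output_add_two_le_size {I : Type} {m : ℕ} (G : QCircuit I (Option (Fin m))) :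
    m + 2 ≤ G.size := by
  have := Fintype.card_le_of_embedding G.out
  simp only [Fintype.card_option, Fintype.card_fin] at this
  unfold QCircuit.size
  omega

/-- The reduction to the pseudorandomness of `G` replaces the post-selected outputs of `G` by
post-selections from a Haar-random state; these are statistically close to independent Haar-random
states. -/
theorem pseudorandom_postSelectGenerator {d n : ℕ → ℕ}
    (hd : (fun l : ℕ => (d l : ℝ)) =O[atTop] (fun l : ℕ => Real.log (l : ℝ)))
    (hn : Tendsto (fun l : ℕ => ((n l : ℝ) - (d l : ℝ)) / Real.log (Real.log (l : ℝ)))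
      atTop atTop)
    {G : ∀ l, QCircuit (Fin l) (Option (Fin (d l + n l)))} (hG : IsPRS (fun l => d l + n l) G) :
    PRFSPseudorandom d n
      (fun l => (postSelectGenerator (d l) (n l) l (2 ^ d l * l)).inst (G l)) := by
  intro s t hs ht x hx a A σ hA hσ
  have hq : PolyBounded fun l => 2 ^ d l * l := (polyBounded_two_pow hd).mul PolyBounded.id
  have hdn : PolyBounded fun l => d l + n l + 2 :=
    PolyBounded.mono hG.qpt fun l => output_add_two_le_size (G l)
  have hT : PolyBounded fun l => reductionCopies (s l) (t l) (2 ^ d l * l) := by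
    refine (hs.mul (ht.mul hq)).mono fun l => le_of_eq ?_
    simp [reductionCopies]
  have hR : IsQPT fun l => reduction (2 ^ d l * l) (A l) :=
    ((hs.mul (ht.mul ((((PolyBounded.const 122).mul hq).add (PolyBounded.const 40)).mul hdn))).add
      ((PolyBounded.const 2).mul hA)).mono fun l => size_reduction_le _ (A l)
  obtain ⟨ε, hε, hle⟩ := hG.pseudorandom _ hT _ (fun l => reduction (2 ^ d l * l) (A l))
    (fun l => reductionAdvice (t l) (x l) (σ l)) hR fun l => isDensity_reductionAdvice _ (hσ l)
  refine ⟨fun l => ε l + ((s l * t l : ℕ) : ℝ) * ((1 + (l : ℝ) / 2 ^ n l) ^ (2 ^ n l))⁻¹,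
    hε.add ((negligible_inv_one_add_div_pow (tendsto_div_log_log hn)).mul_polyBounded (hs.mul ht)),
    fun l => ?_⟩
  have h1 := hle l
  have h2 := abs_integral_postSelect_sub_le (t := t l) (A l) (x l) (σ l) (hx l) (hσ l) l
  have htr : ∀ k, (prsOut (G l) k).trace = 1 := fun k => (hG.stateGeneration l k).isDensity.2
  have e1 : ∀ k, acceptProb (reduction (2 ^ d l * l) (A l)) (tensorFamily fun _ => prsOut (G l) k)
      (reductionAdvice (t l) (x l) (σ l)) = acceptProb (A l)
        (tensorState (basisState (fun p => x l p.1 p.2))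
          (tensorFamily fun j => tensorFamily fun _ : Fin (t l) =>
            prfsOut ((postSelectGenerator (d l) (n l) l (2 ^ d l * l)).inst (G l)) k (x l j)))
        (σ l) := by
    intro k
    rw [acceptProb_reduction _ _ _ _ _ (htr k), acceptOutputs]
    simp only [prfsOut_postSelectGenerator _ _ _ (htr k)]
  have e2 : ∀ θ : UnitKet (d l + n l), acceptProb (reduction (2 ^ d l * l) (A l))
      (tensorFamily fun _ => noAbort (pureState θ)) (reductionAdvice (t l) (x l) (σ l)) =
        acceptOutputs (A l) (x l) (σ l) fun p =>
          postSelect (2 ^ d l * l) (noAbort (pureState θ)) (x l p.1) := fun θ =>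
    acceptProb_reduction _ _ _ _ _ (isDensity_noAbort_pureState θ).2
  simp only [e1, e2] at h1
  push_cast
  exact (abs_sub_le _ _ _).trans (add_le_add h1 h2)

theorem theorem3p1 (d n : ℕ → ℕ)
    (hd : (fun l : ℕ => (d l : ℝ)) =O[Filter.atTop] (fun l : ℕ => Real.log (l : ℝ)))
    (hn : Filter.Tendsto
      (fun l : ℕ => ((n l : ℝ) - (d l : ℝ)) / Real.log (Real.log (l : ℝ)))
      Filter.atTop Filter.atTop) :
    ∃ (C : ∀ l, BlackBoxCircuit (Fin l ⊕ Fin (d l)) (Fin l) (Option (Fin (d l + n l)))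
        (Option (Fin (n l)))) (c : ℕ),
      (∀ l, (C l).calls ≤ 2 ^ d l * l) ∧
      ∀ G : ∀ l, QCircuit (Fin l) (Option (Fin (d l + n l))),
        IsPRS (fun l => d l + n l) G →
          IsPRFS d n (fun l => (C l).inst (G l)) ∧
          RecognizableAbort (fun l => (C l).inst (G l)) ∧
          (∀ l, ((C l).inst (G l)).size ≤ c * (2 ^ d l * l + 1) * (G l).size) ∧
          ∀ l k x, prfsOut ((C l).inst (G l)) k x =
            postSelect (2 ^ d l * l) (prsOut (G l) k) x := by
  refine ⟨fun l => postSelectGenerator (d l) (n l) l (2 ^ d l * l), 300, fun l => le_rfl,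
    fun G hG => ?_⟩
  have hout : ∀ l k x, prfsOut ((postSelectGenerator (d l) (n l) l (2 ^ d l * l)).inst (G l)) k x =
      postSelect (2 ^ d l * l) (prsOut (G l) k) x := fun l k x =>
    prfsOut_postSelectGenerator _ _ _ (hG.stateGeneration l k).isDensity.2 x
  refine ⟨⟨?_, pseudorandom_postSelectGenerator hd hn hG⟩, fun l k x => ?_,
    fun l => size_postSelectGenerator_le _ _, hout⟩
  · exact (((PolyBounded.const 300).mul (((polyBounded_two_pow hd).mul PolyBounded.id).add
      (PolyBounded.const 1))).mul hG.qpt).mono fun l => size_postSelectGenerator_le _ _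
  · rw [hout]
    exact isRecognizable_postSelect (hG.stateGeneration l k) _ x

end
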